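/- Setting. Let $(x,y)\in\mathbb R^p\times\mathbb R$ have law $\mathbb F$ with $\mathbb E|y|<\infty$, let $(x_i,y_i)_{i\le n}$ be i.i.d. from $\mathbb F$ with joint law $\mathbb F_n$, let $X$ be the $n\times p$ design matrix and $Y$ the response vector. Fix $\tau\in(0,1)$, $\rho_\tau(u)=u\{\tau-1(u<0)\}$, a symmetric kernel $K\ge0$ with $\int K=1$ and $\int u^2K(u)\,du<\infty$, bandwidths $h=h_n>0$ with $h_n=o(n^{-1/4})$, and put $K_h(u)=h^{-1}K(u/h)$ and $$\widehat Q_{n;h}(\theta;Y)=\frac1n\sum_{i=1}^n\int\rho_\tau(u)K_h(u+\theta_i-y_i)\,du,\qquad\theta\in\mathbb R^n .$$ Fix $E\subseteq\{1,\dots,p\}$ with complement $E'$, $q=|E|$, and $j\in E$. Let $b^*=\arg\min_{b\in\mathbb R^q}\mathbb E_{\mathbb F_n}\big[n^{-1/2}\sum_i\rho_\tau(y_i-x_{i,E}^\top b)\big]$, $b_n=\arg\min_b\mathbb E_{\mathbb F_n}[\sqrt n\,\widehat Q_{n;h}(X_Eb;Y)]$ and $\hat\beta=\arg\min_b\sqrt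 n\,\widehat Q_{n;h}(X_Eb;Y)$ ($b_n$ any minimizer, $\hat\beta$ any measurable choice of minimizer). Assumptions. (A) There is $\sigma$ with $\mathbb E\exp(tu^\top x)\le\exp(\sigma^2t^2)$ for all $t\in\mathbb R$ and all unit vectors $u$. (B) For every $S\subseteq\{1,\dots,p\}$ the conditional density $f_{y\mid x_S}$ exists and is, almost surely in $x_S$, Lipschitz with a deterministic constant $l_{0,S}>0$; and for the fixed set $E$ there is $m_{0,E}>0$, not depending on $n$, with $\mathbb E[K_h(y-x_E^\top b^*)x_Ex_E^\top]\succeq m_{0,E}I$ for all $h=h_n$. Notation. Let $J=\mathbb E_{\mathbb F_n}[X^\top\nabla^2\widehat Q_{n;h}(X_Eb_n;Y)X]$, $H=\mathrm{Cov}_{\mathbb F_n}(\sqrt n\,X^\top\nabla\widehat Q_{n;h}(X_Eb_n;Y))$ (both $p\times p$), $\Sigma=J_{E,E}^{-1}H_{E,E}J_{E,E}^{-1}$, and, with $\mathbb S_A$ the matrix selecting the rows in $A$ and $H^{1/2}$ written in the order $E,E'$, $$\Lambda_2=\begin{bmatrix}\mathbb S_{E\setminus j}\big(\tfrac1{\Sigma_{jj}}\Sigma_{E,j}\mathbb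 S_jJ_{E,E}^{-1}-J_{E,E}^{-1}\big)&0\\-H_{E',E}H_{E,E}^{-1}&I\end{bmatrix}H^{1/2},$$ $$\hat\gamma_{n,j}=\begin{pmatrix}\mathbb S_{E\setminus j}\big(\hat\beta-\tfrac1{\Sigma_{jj}}\Sigma_{E,j}\hat\beta_j\big)\\X_{E'}^\top\nabla\widehat Q_{n;h}(X_E\hat\beta;Y)+(H_{E',E}H_{E,E}^{-1}J_{E,E}-J_{E',E})\hat\beta\end{pmatrix},$$ $$\gamma_{n,j}=\begin{pmatrix}\mathbb S_{E\setminus j}\big(b_n-\tfrac1{\Sigma_{jj}}\Sigma_{E,j}b_{n,j}\big)\\\mathbb E_{\mathbb F_n}[X_{E'}^\top\nabla\widehat Q_{n;h}(X_Eb_n;Y)]+(H_{E',E}H_{E,E}^{-1}J_{E,E}-J_{E',E})b_n\end{pmatrix}.$$ ($J,H,\Sigma,\Lambda_2$ depend on $n$ through $h=h_n$ and $b_n$.) Claim. For all large $n$ the matrices $J_{E,E}$ and $H_{E,E}$ are invertible; as $n\to\infty$, $\Sigma_{jj}$ converges to a number $s>0$ and $\Lambda_2\Lambda_2^\top$ converges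 to a matrix $V$; and $$\sqrt n\begin{pmatrix}\hat\beta_j-b^*_j\\\hat\gamma_{n,j}-\gamma_{n,j}\end{pmatrix}\Rightarrow\mathcal N\left(0_p,\begin{bmatrix}s&0\\0&V\end{bmatrix}\right),\qquad s=\lim_n\Sigma_{jj},\quad V=\lim_n\Lambda_2\Lambda_2^\top .$$ Thus the limiting covariance is block-diagonal with blocks $\Sigma_{jj}$ and $\Lambda_2\Lambda_2^\top$ (in the limit), and the two parts are asymptotically independent. -/

import Mathlib

open MeasureTheory ProbabilityTheory Filter Topology
open scoped Matrix MatrixOrder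

noncomputable section

namespace SQR

/-! ### Losses -/

/-- The check loss `ρ_τ(u) = u (τ - 1(u < 0))`. -/
def checkLoss (τ u : ℝ) : ℝ := u * (τ - if u < 0 then 1 else 0)

/-- The rescaled kernel `K_h(u) = K(u / h) / h`. -/
def scaledKernel (K : ℝ → ℝ) (h u : ℝ) : ℝ := 1 / h * K (u / h)

/-- The convolution smoothed quantile loss
`Q_{n;h}(θ; Y) = (1/n) ∑ᵢ ∫ ρ_τ(u) K_h(u + θᵢ - yᵢ) du`. -/
def smoothedLoss (K : ℝ → ℝ) (τ h : ℝ) {n : ℕ} (θ Y : Fin n → ℝ) : ℝ :=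
  1 / (n : ℝ) * ∑ i, ∫ u, checkLoss τ u * scaledKernel K h (u + θ i - Y i)

/-- The gradient `∇ Q_{n;h}(θ; Y)` with respect to `θ ∈ ℝⁿ`. -/
def gradLoss (K : ℝ → ℝ) (τ h : ℝ) {n : ℕ} (θ Y : Fin n → ℝ) : Fin n → ℝ :=
  fun i => fderiv ℝ (fun θ' : Fin n → ℝ => smoothedLoss K τ h θ' Y) θ (Pi.single i 1)

/-- The Hessian `∇² Q_{n;h}(θ; Y)` with respect to `θ ∈ ℝⁿ`. -/
def hessLoss (K : ℝ → ℝ) (τ h : ℝ) {n : ℕ} (θ Y : Fin n → ℝ) : Matrix (Fin n) (Fin n) ℝ :=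
  Matrix.of fun i k =>
    fderiv ℝ (fun θ' : Fin n → ℝ => gradLoss K τ h θ' Y i) θ (Pi.single k 1)

/-! ### The sample -/

/-- A sample of size `n`: the pairs `(xᵢ, yᵢ) ∈ ℝᵖ × ℝ`, `i = 1, …, n`. -/
abbrev Sample (n p : ℕ) : Type := Fin n → (Fin p → ℝ) × ℝ

/-- The law `𝔽_n = 𝔽 × ⋯ × 𝔽` (`n` times) of the sample. -/
abbrev sampleLaw {p : ℕ} (F : Measure ((Fin p → ℝ) × ℝ)) (n : ℕ) : Measure (Sample n p) :=
  Measure.pi fun _ : Fin n => F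

/-- The `n × p` design matrix `X`. -/
def design {n p : ℕ} (ω : Sample n p) : Matrix (Fin n) (Fin p) ℝ := Matrix.of fun i k => (ω i).1 k

/-- The `n × q` design matrix `X_E`. -/
def designOn {n p : ℕ} (E : Finset (Fin p)) (ω : Sample n p) : Matrix (Fin n) E ℝ :=
  Matrix.of fun i k => (ω i).1 k

/-- The response vector `Y`. -/
def response {n p : ℕ} (ω : Sample n p) : Fin n → ℝ := fun i => (ω i).2

/-- The subvector `x_S` of a covariate vector `x`. -/
def subvec {p : ℕ} (S : Finset (Fin p)) (x : Fin p → ℝ) : S → ℝ := fun k => x k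

/-! ### Assumptions on the data generating distribution and on the kernel -/

/-- `K` is symmetric, non-negative, integrates to one and has a finite second moment. -/
structure IsKernel (K : ℝ → ℝ) : Prop where
  nonneg : ∀ u, 0 ≤ K u
  symm : ∀ u, K (-u) = K u
  integral_eq_one : ∫ u, K u = 1
  integrable_sq : Integrable fun u => |u| ^ 2 * K u

/-- Sub-Gaussian covariates: `𝔼 exp(t uᵀx) ≤ exp(σ² t²)` for every real `t` and unit vector `u`. -/
def SubGaussianCovariates {p : ℕ} (F : Measure ((Fin p → ℝ) × ℝ)) (σ : ℝ) : Prop :=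
  ∀ (t : ℝ) (u : Fin p → ℝ), u ⬝ᵥ u = 1 →
    Integrable (fun z : (Fin p → ℝ) × ℝ => Real.exp (t * (u ⬝ᵥ z.1))) F ∧
      ∫ z, Real.exp (t * (u ⬝ᵥ z.1)) ∂F ≤ Real.exp (σ ^ 2 * t ^ 2)

/-- The conditional law of `y` given `x_S` has, for almost every value of `x_S`, a density
`f_{y|x_S}` that is Lipschitz continuous with a constant `l` not depending on the value of `x_S`. -/
def HasLipschitzCondDensity {p : ℕ} (F : Measure ((Fin p → ℝ) × ℝ)) [IsFiniteMeasure F]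
    (S : Finset (Fin p)) : Prop :=
  ∃ l > 0, ∃ f : (S → ℝ) → ℝ → ℝ, Measurable (Function.uncurry f) ∧
    ∀ᵐ v ∂(F.map fun z => subvec S z.1),
      (∀ u, 0 ≤ f v u) ∧ (∀ u u', |f v u - f v u'| ≤ l * |u - u'|) ∧
        condDistrib Prod.snd (fun z : (Fin p → ℝ) × ℝ => subvec S z.1) F v =
          volume.withDensity fun u => ENNReal.ofReal (f v u)

/-- `𝔼[K_h(y - x_Eᵀ b) x_E x_Eᵀ] ⪰ m` in the Loewner order. -/
def CurvatureBound {p : ℕ} (F : Measure ((Fin p → ℝ) × ℝ)) (K : ℝ → ℝ) (h : ℝ)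
    (E : Finset (Fin p)) (b : E → ℝ) (m : ℝ) : Prop :=
  ((Matrix.of fun a c : E =>
      ∫ z, scaledKernel K h (z.2 - subvec E z.1 ⬝ᵥ b) * (z.1 a * z.1 c) ∂F) -
    m • (1 : Matrix E E ℝ)).PosSemidef

/-! ### Target, pseudo-parameter, estimator -/

/-- `b` minimizes `𝔼_{𝔽_n}[n^{-1/2} ∑ᵢ ρ_τ(yᵢ - x_{i,E}ᵀ b)]`. -/
def IsTarget {p : ℕ} (F : Measure ((Fin p → ℝ) × ℝ)) (τ : ℝ) (n : ℕ) (E : Finset (Fin p))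
    (b : E → ℝ) : Prop :=
  IsMinOn (fun b' : E → ℝ => ∫ ω, 1 / √(n : ℝ) *
    ∑ i, checkLoss τ (response ω i - (designOn E ω *ᵥ b') i) ∂(sampleLaw F n)) Set.univ b

/-- `b` minimizes `𝔼_{𝔽_n}[√n Q_{n;h}(X_E b; Y)]`. -/
def IsPseudoParameter {p : ℕ} (F : Measure ((Fin p → ℝ) × ℝ)) (K : ℝ → ℝ) (τ h : ℝ) (n : ℕ)
    (E : Finset (Fin p)) (b : E → ℝ) : Prop :=
  IsMinOn (fun b' : E → ℝ => ∫ ω, √(n : ℝ) *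
    smoothedLoss K τ h (designOn E ω *ᵥ b') (response ω) ∂(sampleLaw F n)) Set.univ b

/-- `b` minimizes the sample loss `√n Q_{n;h}(X_E b; Y)`. -/
def IsRefittedEstimate {p : ℕ} (K : ℝ → ℝ) (τ h : ℝ) {n : ℕ} (E : Finset (Fin p))
    (ω : Sample n p) (b : E → ℝ) : Prop :=
  IsMinOn (fun b' : E → ℝ => √(n : ℝ) *
    smoothedLoss K τ h (designOn E ω *ᵥ b') (response ω)) Set.univ b

/-! ### The matrices `J`, `H`, `Σ_{E,E}`, `Λ₂` -/

/-- `Xᵀ ∇ Q_{n;h}(X_E b; Y) ∈ ℝᵖ`. -/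
def score (K : ℝ → ℝ) (τ h : ℝ) {n p : ℕ} (E : Finset (Fin p)) (b : E → ℝ) (ω : Sample n p) :
    Fin p → ℝ :=
  (design ω)ᵀ *ᵥ gradLoss K τ h (designOn E ω *ᵥ b) (response ω)

/-- `J = 𝔼_{𝔽_n}[Xᵀ ∇² Q_{n;h}(X_E b; Y) X]`. -/
def matJ {p : ℕ} (F : Measure ((Fin p → ℝ) × ℝ)) (K : ℝ → ℝ) (τ h : ℝ) (n : ℕ)
    (E : Finset (Fin p)) (b : E → ℝ) : Matrix (Fin p) (Fin p) ℝ :=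
  Matrix.of fun a c => ∫ ω,
    ((design ω)ᵀ * hessLoss K τ h (designOn E ω *ᵥ b) (response ω) * design ω) a c
      ∂(sampleLaw F n)

/-- `H = Cov_{𝔽_n}(√n Xᵀ ∇ Q_{n;h}(X_E b; Y), √n Xᵀ ∇ Q_{n;h}(X_E b; Y))`. -/
def matH {p : ℕ} (F : Measure ((Fin p → ℝ) × ℝ)) (K : ℝ → ℝ) (τ h : ℝ) (n : ℕ)
    (E : Finset (Fin p)) (b : E → ℝ) : Matrix (Fin p) (Fin p) ℝ :=
  Matrix.of fun a c =>
    cov[fun ω => √(n : ℝ) * score K τ h E b ω a, fun ω => √(n : ℝ) * score K τ h E b ω c;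
      sampleLaw F n]

/-- The index set `E' = [p] \ E`. -/
abbrev Compl {p : ℕ} (E : Finset (Fin p)) : Type := {k : Fin p // k ∉ E}

/-- The index set `E \ {j}`. -/
abbrev Minus {p : ℕ} {E : Finset (Fin p)} (j : E) : Type := {k : E // k ≠ j}

/-- The block `M_{E,E}`. -/
def blockEE {p : ℕ} (E : Finset (Fin p)) (M : Matrix (Fin p) (Fin p) ℝ) : Matrix E E ℝ :=
  M.submatrix Subtype.val Subtype.val

/-- The block `M_{E',E}`. -/
def blockCE {p : ℕ} (E : Finset (Fin p)) (M : Matrix (Fin p) (Fin p) ℝ) : Matrix (Compl E) E ℝ :=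
  M.submatrix Subtype.val Subtype.val

/-- `M` with its rows and columns listed in the order `E`, `E'`. -/
def ordered {p : ℕ} (E : Finset (Fin p)) (M : Matrix (Fin p) (Fin p) ℝ) :
    Matrix (E ⊕ Compl E) (E ⊕ Compl E) ℝ :=
  M.submatrix (Sum.elim Subtype.val Subtype.val) (Sum.elim Subtype.val Subtype.val)

/-- `Σ_{E,E} = J_{E,E}⁻¹ H_{E,E} J_{E,E}⁻¹`. -/
def matSigma {p : ℕ} (E : Finset (Fin p)) (J H : Matrix (Fin p) (Fin p) ℝ) : Matrix E E ℝ :=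
  (blockEE E J)⁻¹ * blockEE E H * (blockEE E J)⁻¹

/-- The matrix `Λ₂`; `CFC.sqrt` is the positive semidefinite square root. -/
def matLambda₂ {p : ℕ} (E : Finset (Fin p)) (j : E) (J H : Matrix (Fin p) (Fin p) ℝ) :
    Matrix (Minus j ⊕ Compl E) (E ⊕ Compl E) ℝ :=
  Matrix.fromBlocks
    (Matrix.of fun (k : Minus j) (c : E) =>
      1 / matSigma E J H j j * matSigma E J H k j * (blockEE E J)⁻¹ j c - (blockEE E J)⁻¹ k c)
    0
    (-(blockCE E H * (blockEE E H)⁻¹))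
    1 * CFC.sqrt (ordered E H)

/-! ### The statistic `γ̂_{n,j}` and the nuisance parameter `γ_{n,j}` -/

/-- The map `(b, g) ↦ (b_{E∖j} - Σ_{E∖j,j} b_j / Σ_{jj},
g_{E'} + (H_{E',E} H_{E,E}⁻¹ J_{E,E} - J_{E',E}) b)`. -/
def adjust {p : ℕ} (E : Finset (Fin p)) (j : E) (J H : Matrix (Fin p) (Fin p) ℝ)
    (b : E → ℝ) (g : Fin p → ℝ) : Minus j ⊕ Compl E → ℝ :=
  Sum.elim
    (fun k => b k - 1 / matSigma E J H j j * matSigma E J H k j * b j)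
    (fun k => g k +
      ((blockCE E H * (blockEE E H)⁻¹ * blockEE E J - blockCE E J) *ᵥ b) k)

/-- `γ̂_{n,j}`, computed from the value `bhat` of the refitted estimator; `b` is the
pseudo-parameter, which enters through `J` and `H`. -/
def gammaHat {p : ℕ} (F : Measure ((Fin p → ℝ) × ℝ)) (K : ℝ → ℝ) (τ h : ℝ) {n : ℕ}
    (E : Finset (Fin p)) (j : E) (b bhat : E → ℝ) (ω : Sample n p) : Minus j ⊕ Compl E → ℝ :=
  adjust E j (matJ F K τ h n E b) (matH F K τ h n E b) bhat (score K τ h E bhat ω)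

/-- `γ_{n,j}`, where `b` is the pseudo-parameter. -/
def gammaPar {p : ℕ} (F : Measure ((Fin p → ℝ) × ℝ)) (K : ℝ → ℝ) (τ h : ℝ) (n : ℕ)
    (E : Finset (Fin p)) (j : E) (b : E → ℝ) : Minus j ⊕ Compl E → ℝ :=
  adjust E j (matJ F K τ h n E b) (matH F K τ h n E b) b
    (fun k => ∫ ω, score K τ h E b ω k ∂(sampleLaw F n))

/-- `√n (β̂_j - b*_j, γ̂_{n,j} - γ_{n,j}) ∈ ℝᵖ`. -/
def centredStatistic {p : ℕ} (F : Measure ((Fin p → ℝ) × ℝ)) (K : ℝ → ℝ) (τ h : ℝ) {n : ℕ}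
    (E : Finset (Fin p)) (j : E) (bstar b bhat : E → ℝ) (ω : Sample n p) :
    EuclideanSpace ℝ (Unit ⊕ (Minus j ⊕ Compl E)) :=
  WithLp.toLp 2 (Sum.elim
    (fun _ => √(n : ℝ) * (bhat j - bstar j))
    (fun k => √(n : ℝ) * (gammaHat F K τ h E j b bhat ω k - gammaPar F K τ h n E j b k)))

end SQR

end

set_option linter.unusedSectionVars false

namespace SQR

/-! The gradient of the smoothed loss is explicit. With `G` the distribution function of `K_h`, the
score at `b` is the sample mean of `x (G(x_E · b - y) - τ)`. Everything is read off from this sum: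
it is an average of independent terms, and it is monotone along rays in `b`.

Regularity comes from the law and not from the kernel. Conditioning on all covariates gives `y` a
density that is Lipschitz with a constant free of `x`, and sub-Gaussianity gives all moments of `x`
(`exists_isRegularLaw`). By Fubini, the mean of `G(s - y)` given `x` is the distribution function of
`y` averaged against `K_h`, so its Taylor bounds do not depend on `h`. Hence no lower bound on `h`
is needed, and `K` may be merely integrable.

Bias: symmetry of `K` removes the first-order term, so smoothing changes the population score by
`O(h²)`. With the curvature bound and ray monotonicity this confines `b_n` to a ball of radius `C
h²` about `b*` (`exists_norm_pseudoParameter_sub_le`), and `√n h² → 0`. So `β̂_j` may be centred at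
`b*_j` instead of `b_{n,j}`.

Linearization: let `J₀`, `H₀` be the limits of `J`, `H`. The increment of the `√n`-scaled score from
`b_n` to `b_n + t/√n` tends to `J₀ t` in probability, uniformly for bounded `t`: for fixed `t` by a
mean and second moment computation, uniformly by bracketing on a finite net. Ray monotonicity then
forces the zero `β̂` of the score on `E` to lie within `O(n^{-1/2})` of `b_n`
(`boundedInProb_estimator`). Write `t = √n (β̂ - b_n)` and let `Z` be the normalized sum of the
unsmoothed scores at `b*`. The `E` equations give `t = -J_{E,E}⁻¹ Z_E + o_p(1)`, and the `E'` score
is `Z_{E'} + J_{E',E} t + o_p(1)`. The whole statistic is therefore `D Z + o_p(1)` with a fixed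
matrix `D`, namely `influenceCoeff` at `J₀`, `H₀`.

The central limit theorem for `Z` gives the covariance `D H₀ Dᵀ`. It is block diagonal because the
nuisance part consists of regression residuals: `β̂_k` minus its projection on `β̂_j`, and `Z_{E'}`
minus its projection on `Z_E`, of which `β̂_j` is asymptotically a linear function
(`influenceCoeff_mul_ordered_mul_transpose`). -/

theorem integrable_fun_sub {α : Type*} [MeasurableSpace α] {μ : Measure α} {f g : α → ℝ}
    (hf : Integrable f μ) (hg : Integrable g μ) : Integrable (fun x => f x - g x) μ := hf.sub hg

/-! ### Kernels and their distribution functions -/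

/-- A non-integrable function has Bochner integral `0` by convention, which contradicts total mass
`1`. -/
theorem IsKernel.integrable {k : ℝ → ℝ} (hk : IsKernel k) : Integrable k := by
  by_contra h
  have := hk.integral_eq_one
  rw [integral_undef h] at this
  exact zero_ne_one this

theorem IsKernel.integrable_abs_mul {k : ℝ → ℝ} (hk : IsKernel k) :
    Integrable fun u => |u| * k u := by
  refine (hk.integrable.add hk.integrable_sq).mono'
    (by have := hk.integrable.aestronglyMeasurable; fun_prop) (.of_forall fun u => ?_)
  have h0 := hk.nonneg u
  rw [Real.norm_eq_abs, abs_mul, abs_abs, abs_of_nonneg h0]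
  simp only [Pi.add_apply]
  nlinarith [sq_nonneg (|u| - 1), abs_nonneg u, mul_nonneg (abs_nonneg u) h0,
    mul_nonneg (sq_nonneg (|u| - 1)) h0]

theorem IsKernel.integrable_mul {k : ℝ → ℝ} (hk : IsKernel k) : Integrable fun u => u * k u := by
  refine hk.integrable_abs_mul.mono
    (by have := hk.integrable.aestronglyMeasurable; fun_prop) (.of_forall fun u => ?_)
  simp

theorem IsKernel.integral_mul_eq_zero {k : ℝ → ℝ} (hk : IsKernel k) : ∫ u, u * k u = 0 := by
  have h : ∫ u, u * k u = ∫ u, -u * k (-u) :=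
    (integral_neg_eq_self (fun u => u * k u) volume).symm
  simp_rw [hk.symm, neg_mul, integral_neg] at h
  linarith

theorem scaledKernel_abs_pow {K : ℝ → ℝ} {h : ℝ} (hh : 0 < h) (r : ℕ) :
    (fun u => |u| ^ r * scaledKernel K h u)
      = fun u => h ^ r / h * (fun v => |v| ^ r * K v) (u / h) := by
  funext u
  simp only [scaledKernel, abs_div, abs_of_pos hh, div_pow]
  field_simp

/-- Change of variable `u = h v`. The case `r = 0` keeps the mass at one, `r = 1` bounds the
smoothing error of a density, and `r = 2` produces the `h²` bias of a distribution function. -/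
theorem integral_scaledKernel_abs_pow (K : ℝ → ℝ) {h : ℝ} (hh : 0 < h) (r : ℕ) :
    ∫ u, |u| ^ r * scaledKernel K h u = h ^ r * ∫ u, |u| ^ r * K u := by
  rw [scaledKernel_abs_pow hh, integral_const_mul,
    Measure.integral_comp_div (fun v => |v| ^ r * K v), smul_eq_mul, abs_of_pos hh]
  field_simp

theorem IsKernel.scaledKernel {K : ℝ → ℝ} (hK : IsKernel K) {h : ℝ} (hh : 0 < h) :
    IsKernel (scaledKernel K h) where
  nonneg u := mul_nonneg (by positivity) (hK.nonneg _)
  symm u := by simp [SQR.scaledKernel, neg_div, hK.symm]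
  integral_eq_one := by
    have := integral_scaledKernel_abs_pow K hh 0
    simpa [hK.integral_eq_one] using this
  integrable_sq := by
    rw [scaledKernel_abs_pow hh]
    exact (hK.integrable_sq.comp_div hh.ne').const_mul _

/-- The distribution function `t ↦ ∫_{v < t} k(v) dv`. -/
noncomputable def kernelCdf (k : ℝ → ℝ) (t : ℝ) : ℝ := ∫ v in Set.Iio t, k v

theorem kernelCdf_nonneg {k : ℝ → ℝ} (hk : IsKernel k) (t : ℝ) : 0 ≤ kernelCdf k t :=
  setIntegral_nonneg measurableSet_Iio fun v _ => hk.nonneg v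

theorem kernelCdf_le_one {k : ℝ → ℝ} (hk : IsKernel k) (t : ℝ) : kernelCdf k t ≤ 1 := by
  rw [← hk.integral_eq_one]
  exact setIntegral_le_integral hk.integrable (.of_forall hk.nonneg)

theorem monotone_kernelCdf {k : ℝ → ℝ} (hk : IsKernel k) : Monotone (kernelCdf k) := fun _ _ h =>
  setIntegral_mono_set hk.integrable.integrableOn (.of_forall hk.nonneg)
    (Set.Iio_subset_Iio h).eventuallyLE

theorem measurable_kernelCdf {k : ℝ → ℝ} (hk : IsKernel k) : Measurable (kernelCdf k) :=
  (monotone_kernelCdf hk).measurable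

theorem abs_kernelCdf_sub_le_one {k : ℝ → ℝ} (hk : IsKernel k) (s t : ℝ) :
    |kernelCdf k s - kernelCdf k t| ≤ 1 := by
  rw [abs_le]
  constructor <;> linarith [kernelCdf_nonneg hk s, kernelCdf_nonneg hk t, kernelCdf_le_one hk s,
    kernelCdf_le_one hk t]

theorem kernelCdf_scaledKernel (K : ℝ → ℝ) {h : ℝ} (hh : 0 < h) (t : ℝ) :
    kernelCdf (scaledKernel K h) t = kernelCdf K (t / h) := by
  unfold kernelCdf
  rw [← integral_indicator measurableSet_Iio, ← integral_indicator measurableSet_Iio]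
  have : (Set.Iio t).indicator (scaledKernel K h)
      = fun u => 1 / h * (Set.Iio (t / h)).indicator K (u / h) := by
    funext u
    by_cases hu : u < t
    · rw [Set.indicator_of_mem (by exact hu),
        Set.indicator_of_mem (by exact div_lt_div_of_pos_right hu hh)]
      rfl
    · rw [Set.indicator_of_notMem (by exact hu), Set.indicator_of_notMem, mul_zero]
      simp only [Set.mem_Iio, not_lt] at hu ⊢
      exact div_le_div_of_nonneg_right hu hh.le
  rw [this, integral_const_mul, Measure.integral_comp_div (fun v => (Set.Iio (t / h)).indicator K v),
    smul_eq_mul, abs_of_pos hh]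
  field_simp

theorem continuous_kernelCdf {k : ℝ → ℝ} (hk : IsKernel k) : Continuous (kernelCdf k) := by
  have h : ∀ t, kernelCdf k t = kernelCdf k 0 + ∫ v in (0 : ℝ)..t, k v := by
    intro t
    have := intervalIntegral.integral_Iic_sub_Iic (f := k) (μ := volume) (a := 0) (b := t)
      hk.integrable.integrableOn hk.integrable.integrableOn
    simp only [kernelCdf, ← integral_Iic_eq_integral_Iio] at *
    linarith
  rw [funext h]
  exact continuous_const.add (intervalIntegral.continuous_primitive
    (fun a b => hk.integrable.intervalIntegrable) 0)

/-- Lebesgue differentiation. The kernel need not be continuous, so the Hessian of the loss is only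
meaningful off a null set of residuals. -/
theorem ae_hasDerivAt_kernelCdf {k : ℝ → ℝ} (hk : IsKernel k) :
    ∀ᵐ t, HasDerivAt (kernelCdf k) (k t) t := by
  have h : ∀ t, kernelCdf k t = kernelCdf k 0 + ∫ v in (0 : ℝ)..t, k v := by
    intro t
    have := intervalIntegral.integral_Iic_sub_Iic (f := k) (μ := volume) (a := 0) (b := t)
      hk.integrable.integrableOn hk.integrable.integrableOn
    simp only [kernelCdf, ← integral_Iic_eq_integral_Iio] at *
    linarith
  rw [funext h]
  filter_upwards [LocallyIntegrable.ae_hasDerivAt_integral hk.integrable.locallyIntegrable] with t ht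
  exact (ht 0).const_add _

theorem tendsto_kernelCdf_atTop {k : ℝ → ℝ} (hk : IsKernel k) :
    Tendsto (kernelCdf k) atTop (𝓝 1) := by
  have := tendsto_setIntegral_of_monotone (μ := volume) (f := k) (s := fun t : ℝ => Set.Iio t)
    (fun t => measurableSet_Iio) (fun _ _ h => Set.Iio_subset_Iio h) hk.integrable.integrableOn
  rw [Set.iUnion_Iio, setIntegral_univ, hk.integral_eq_one] at this
  exact this

theorem tendsto_kernelCdf_atBot {k : ℝ → ℝ} (hk : IsKernel k) :
    Tendsto (kernelCdf k) atBot (𝓝 0) := by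
  have h1 : ∀ t, kernelCdf k t = 1 - kernelCdf k (-t) := by
    intro t
    have e : kernelCdf k (-t) = ∫ v in Set.Ioi t, k v := by
      have := integral_comp_neg_Ioi (E := ℝ) t k
      simp_rw [hk.symm] at this
      rw [this, kernelCdf, ← integral_Iic_eq_integral_Iio]
    have := integral_add_compl (measurableSet_Iic (a := t)) hk.integrable
    rw [Set.compl_Iic, hk.integral_eq_one] at this
    rw [e, kernelCdf, ← integral_Iic_eq_integral_Iio]
    linarith
  rw [funext h1]
  have := (tendsto_kernelCdf_atTop hk).comp tendsto_neg_atBot_atTop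
  simpa using this.const_sub 1

/-! ### Lipschitz densities -/

/-- `f` is a probability density on the line which is Lipschitz with constant `l`. -/
structure IsLipschitzDensity (l : ℝ) (f : ℝ → ℝ) : Prop where
  nonneg : ∀ u, 0 ≤ f u
  lipschitz : ∀ u u', |f u - f u'| ≤ l * |u - u'|
  integrable : Integrable f
  integral_eq_one : ∫ u, f u = 1

theorem IsLipschitzDensity.continuous {l : ℝ} {f : ℝ → ℝ} (hf : IsLipschitzDensity l f) :
    Continuous f := by
  have hl : LipschitzWith (Real.toNNReal l) f := LipschitzWith.of_dist_le' fun x y => by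
    simpa [Real.dist_eq] using hf.lipschitz x y
  exact hl.continuous

theorem IsLipschitzDensity.const_nonneg {l : ℝ} {f : ℝ → ℝ} (hf : IsLipschitzDensity l f) :
    0 ≤ l := by
  have := hf.lipschitz 1 0
  simp at this
  exact (abs_nonneg _).trans this

/-- On `[s, s + 1]` the density is at least `f s - l`, and its mass there is at most one. The
resulting bound depends on `l` alone, hence is uniform over the covariates. -/
theorem IsLipschitzDensity.le {l : ℝ} {f : ℝ → ℝ} (hf : IsLipschitzDensity l f) (s : ℝ) :
    f s ≤ 1 + l := by
  have h1 : ∫ u in Set.Icc s (s + 1), f u ≤ 1 := by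
    rw [← hf.integral_eq_one]
    exact setIntegral_le_integral hf.integrable (.of_forall hf.nonneg)
  have h2 : ∫ u in Set.Icc s (s + 1), (f s - l) ≤ ∫ u in Set.Icc s (s + 1), f u := by
    refine setIntegral_mono_on (by simp) hf.integrable.integrableOn measurableSet_Icc ?_
    intro u hu
    have := (abs_le.1 (hf.lipschitz s u)).2
    have h3 : |s - u| ≤ 1 := by rw [abs_le]; constructor <;> linarith [hu.1, hu.2]
    nlinarith [hf.const_nonneg]
  simp at h2
  linarith

/-- The distribution function of a density. -/
noncomputable def cdfOf (f : ℝ → ℝ) (s : ℝ) : ℝ := ∫ u in Set.Iio s, f u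

theorem IsLipschitzDensity.cdfOf_sub {l : ℝ} {f : ℝ → ℝ} (hf : IsLipschitzDensity l f) (s s' : ℝ) :
    cdfOf f s' - cdfOf f s = ∫ u in s..s', f u := by
  have := intervalIntegral.integral_Iic_sub_Iic (f := f) (μ := volume) (a := s) (b := s')
    hf.integrable.integrableOn hf.integrable.integrableOn
  simpa only [cdfOf, ← integral_Iic_eq_integral_Iio] using this

theorem IsLipschitzDensity.abs_cdfOf_taylor {l : ℝ} {f : ℝ → ℝ} (hf : IsLipschitzDensity l f)
    (s s' : ℝ) : |cdfOf f s' - cdfOf f s - f s * (s' - s)| ≤ l * (s' - s) ^ 2 := by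
  have h1 : cdfOf f s' - cdfOf f s - f s * (s' - s) = ∫ u in s..s', (f u - f s) := by
    rw [intervalIntegral.integral_sub hf.integrable.intervalIntegrable (by simp), hf.cdfOf_sub]
    simp
    ring
  rw [h1]
  have h2 := intervalIntegral.norm_integral_le_of_norm_le_const (a := s) (b := s')
    (f := fun u => f u - f s) (C := l * |s' - s|) (fun u hu => by
      rw [Real.norm_eq_abs]
      refine (hf.lipschitz u s).trans (mul_le_mul_of_nonneg_left ?_ hf.const_nonneg)
      exact Set.abs_sub_left_of_mem_uIcc (Set.uIoc_subset_uIcc hu))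
  rw [Real.norm_eq_abs] at h2
  refine h2.trans (le_of_eq ?_)
  rw [mul_assoc, ← sq, sq_abs]

theorem IsLipschitzDensity.abs_cdfOf_sub_le {l : ℝ} {f : ℝ → ℝ} (hf : IsLipschitzDensity l f)
    (s s' : ℝ) : |cdfOf f s' - cdfOf f s| ≤ (1 + l) * |s' - s| := by
  rw [hf.cdfOf_sub]
  have h2 := intervalIntegral.norm_integral_le_of_norm_le_const (a := s) (b := s')
    (f := f) (C := 1 + l) (fun u hu => by
      rw [Real.norm_eq_abs, abs_of_nonneg (hf.nonneg u)]
      exact hf.le u)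
  simpa using h2

theorem IsLipschitzDensity.continuous_cdfOf {l : ℝ} {f : ℝ → ℝ} (hf : IsLipschitzDensity l f) :
    Continuous (cdfOf f) := by
  have hl : LipschitzWith (Real.toNNReal (1 + l)) (cdfOf f) := LipschitzWith.of_dist_le' fun x y => by
    simpa [Real.dist_eq] using hf.abs_cdfOf_sub_le y x
  exact hl.continuous

theorem IsLipschitzDensity.abs_cdfOf_le_one {l : ℝ} {f : ℝ → ℝ} (hf : IsLipschitzDensity l f)
    (s : ℝ) : |cdfOf f s| ≤ 1 := by
  rw [cdfOf, abs_of_nonneg (setIntegral_nonneg measurableSet_Iio fun v _ => hf.nonneg v)]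
  rw [← hf.integral_eq_one]
  exact setIntegral_le_integral hf.integrable (.of_forall hf.nonneg)

/-- Both sides are the mass that `f ⊗ k` gives to the half-plane `u + v < s`, integrated in the two
orders. This moves the smoothing from the indicator to the distribution function of `f`, whose
regularity then survives averaging against any kernel. -/
theorem integral_mul_kernelCdf {l : ℝ} {f k : ℝ → ℝ} (hf : IsLipschitzDensity l f)
    (hk : IsKernel k) (s : ℝ) :
    ∫ u, f u * kernelCdf k (s - u) = ∫ v, k v * cdfOf f (s - v) := by
  have hint : Integrable (Function.uncurry fun u v => Set.indicator {q : ℝ × ℝ | q.1 + q.2 < s}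
      (fun q => f q.1 * k q.2) (u, v)) (volume.prod volume) :=
    (hf.integrable.mul_prod hk.integrable).indicator
      (measurableSet_lt (by fun_prop) (by fun_prop))
  have h1 : ∀ u, f u * kernelCdf k (s - u)
      = ∫ v, Set.indicator {q : ℝ × ℝ | q.1 + q.2 < s} (fun q => f q.1 * k q.2) (u, v) := by
    intro u
    rw [kernelCdf, ← integral_indicator measurableSet_Iio, ← integral_const_mul]
    refine integral_congr_ae (.of_forall fun v => ?_)
    simp only [Set.indicator, Set.mem_Iio, Set.mem_ofPred_eq, lt_sub_iff_add_lt']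
    split_ifs <;> simp
  have h2 : ∀ v, k v * cdfOf f (s - v)
      = ∫ u, Set.indicator {q : ℝ × ℝ | q.1 + q.2 < s} (fun q => f q.1 * k q.2) (u, v) := by
    intro v
    rw [cdfOf, ← integral_indicator measurableSet_Iio, ← integral_const_mul]
    refine integral_congr_ae (.of_forall fun u => ?_)
    simp only [Set.indicator, Set.mem_Iio, Set.mem_ofPred_eq, lt_sub_iff_add_lt]
    split_ifs <;> simp [mul_comm]
  simp_rw [h1, h2]
  exact integral_integral_swap hint

theorem integral_mul_kernel_sub {f k : ℝ → ℝ} (s : ℝ) :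
    ∫ u, f u * k (s - u) = ∫ v, k v * f (s - v) := by
  rw [← integral_sub_left_eq_self _ _ s]
  simp [mul_comm]

theorem IsKernel.integrable_mul_bdd {k g : ℝ → ℝ} (hk : IsKernel k) (hg : Continuous g) {C : ℝ}
    (hC : ∀ v, |g v| ≤ C) : Integrable fun v => k v * g v :=
  hk.integrable.mul_bdd (c := C) hg.aestronglyMeasurable (.of_forall hC)

theorem IsLipschitzDensity.integrable_mul_kernelCdf {l : ℝ} {f k : ℝ → ℝ}
    (hf : IsLipschitzDensity l f) (hk : IsKernel k) (s : ℝ) :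
    Integrable fun u => f u * kernelCdf k (s - u) :=
  hf.integrable.mul_bdd (c := 1)
    ((continuous_kernelCdf hk).comp (continuous_const.sub continuous_id)).aestronglyMeasurable
    (.of_forall fun u => by
      rw [Real.norm_eq_abs, abs_of_nonneg (kernelCdf_nonneg hk _)]; exact kernelCdf_le_one hk _)

theorem IsLipschitzDensity.integrable_mul_kernel {l : ℝ} {f k : ℝ → ℝ}
    (hf : IsLipschitzDensity l f) (hk : IsKernel k) (s : ℝ) :
    Integrable fun u => f u * k (s - u) :=
  (hk.integrable.comp_sub_left s).bdd_mul (c := 1 + l) hf.continuous.aestronglyMeasurable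
    (.of_forall fun u => by
      rw [Real.norm_eq_abs, abs_of_nonneg (hf.nonneg _)]; exact hf.le u)

theorem IsLipschitzDensity.abs_apply_le {l : ℝ} {f : ℝ → ℝ}
    (hf : IsLipschitzDensity l f) (s : ℝ) : |f s| ≤ 1 + l := by
  rw [abs_of_nonneg (hf.nonneg _)]; exact hf.le s

/-- Second order expansion of the smoothed distribution function. -/
theorem IsLipschitzDensity.abs_integral_mul_kernelCdf_taylor {l : ℝ} {f k : ℝ → ℝ}
    (hf : IsLipschitzDensity l f) (hk : IsKernel k) (s s' : ℝ) :
    |∫ u, f u * (kernelCdf k (s' - u) - kernelCdf k (s - u) - k (s - u) * (s' - s))|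
      ≤ l * (s' - s) ^ 2 := by
  have hc : ∀ r, Integrable fun v => k v * cdfOf f (r - v) := fun r => hk.integrable_mul_bdd
    (hf.continuous_cdfOf.comp (continuous_const.sub continuous_id)) fun v => hf.abs_cdfOf_le_one _
  have hd : Integrable fun v => k v * f (s - v) := hk.integrable_mul_bdd
    (hf.continuous.comp (continuous_const.sub continuous_id)) fun v => hf.abs_apply_le _
  have e : ∫ u, f u * (kernelCdf k (s' - u) - kernelCdf k (s - u) - k (s - u) * (s' - s))
      = ∫ v, k v * (cdfOf f (s' - v) - cdfOf f (s - v) - f (s - v) * (s' - s)) := by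
    have e1 : ∀ u, f u * (kernelCdf k (s' - u) - kernelCdf k (s - u) - k (s - u) * (s' - s))
      = f u * kernelCdf k (s' - u) - f u * kernelCdf k (s - u) - f u * k (s - u) * (s' - s) :=
        fun u => by ring
    have e2 : ∀ v, k v * (cdfOf f (s' - v) - cdfOf f (s - v) - f (s - v) * (s' - s))
      = k v * cdfOf f (s' - v) - k v * cdfOf f (s - v) - k v * f (s - v) * (s' - s) :=
        fun u => by ring
    simp_rw [e1, e2]
    rw [integral_sub (integrable_fun_sub (hf.integrable_mul_kernelCdf hk _)
      (hf.integrable_mul_kernelCdf hk _))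
      ((hf.integrable_mul_kernel hk s).mul_const _),
      integral_sub (hf.integrable_mul_kernelCdf hk _) (hf.integrable_mul_kernelCdf hk _),
      integral_sub (integrable_fun_sub (hc _) (hc _)) (hd.mul_const _), integral_sub (hc _) (hc _),
      integral_mul_const, integral_mul_const, integral_mul_kernelCdf hf hk,
      integral_mul_kernelCdf hf hk, integral_mul_kernel_sub (f := f)]
  rw [e, ← Real.norm_eq_abs]
  refine (norm_integral_le_of_norm_le (hk.integrable.mul_const (l * (s' - s) ^ 2))
    (.of_forall fun v => ?_)).trans ?_
  · rw [Real.norm_eq_abs, abs_mul, abs_of_nonneg (hk.nonneg v)]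
    refine mul_le_mul_of_nonneg_left ?_ (hk.nonneg v)
    have := hf.abs_cdfOf_taylor (s - v) (s' - v)
    simpa using this
  · rw [integral_mul_const, hk.integral_eq_one, one_mul]

/-- Since `kernelCdf` is monotone, the absolute value has a constant sign in `u` once `s ≤ s'`, and
what is left is an averaged difference of distribution functions. -/
theorem IsLipschitzDensity.integral_mul_abs_kernelCdf_sub_le {l : ℝ} {f k : ℝ → ℝ}
    (hf : IsLipschitzDensity l f) (hk : IsKernel k) (s s' : ℝ) :
    ∫ u, f u * |kernelCdf k (s' - u) - kernelCdf k (s - u)| ≤ (1 + l) * |s' - s| := by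
  wlog hs : s ≤ s' generalizing s s'
  · have := this s' s (le_of_not_ge hs)
    rw [abs_sub_comm s s'] at this
    simpa only [abs_sub_comm] using this
  have hc : ∀ r, Integrable fun v => k v * cdfOf f (r - v) := fun r => hk.integrable_mul_bdd
    (hf.continuous_cdfOf.comp (continuous_const.sub continuous_id)) fun v => hf.abs_cdfOf_le_one _
  have e : ∀ u, f u * |kernelCdf k (s' - u) - kernelCdf k (s - u)|
      = f u * kernelCdf k (s' - u) - f u * kernelCdf k (s - u) := fun u => by
    rw [abs_of_nonneg (sub_nonneg.2 (monotone_kernelCdf hk (by linarith)))]; ring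
  simp_rw [e]
  rw [integral_sub (hf.integrable_mul_kernelCdf hk _) (hf.integrable_mul_kernelCdf hk _),
    integral_mul_kernelCdf hf hk, integral_mul_kernelCdf hf hk, ← integral_sub (hc _) (hc _)]
  have : ∫ v, k v * ((1 + l) * |s' - s|) = (1 + l) * |s' - s| := by
    rw [integral_mul_const, hk.integral_eq_one, one_mul]
  rw [← this]
  refine integral_mono ((hc _).sub (hc _)) (hk.integrable.mul_const _) fun v => ?_
  simp only [← mul_sub]
  refine mul_le_mul_of_nonneg_left ?_ (hk.nonneg v)
  have := (abs_le.1 (hf.abs_cdfOf_sub_le (s - v) (s' - v))).2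
  rwa [sub_sub_sub_cancel_right] at this

theorem IsLipschitzDensity.integral_mul_kernel_le {l : ℝ} {f k : ℝ → ℝ}
    (hf : IsLipschitzDensity l f) (hk : IsKernel k) (s : ℝ) :
    ∫ u, f u * k (s - u) ≤ 1 + l := by
  rw [integral_mul_kernel_sub]
  have : ∫ v, k v * (1 + l) = 1 + l := by
    rw [integral_mul_const, hk.integral_eq_one, one_mul]
  rw [← this]
  exact integral_mono (hk.integrable_mul_bdd
    (hf.continuous.comp (continuous_const.sub continuous_id)) fun v => hf.abs_apply_le _)
    (hk.integrable.mul_const _) fun v => mul_le_mul_of_nonneg_left (hf.le _) (hk.nonneg v)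

theorem IsLipschitzDensity.abs_integral_mul_kernel_sub_le {l : ℝ} {f k : ℝ → ℝ}
    (hf : IsLipschitzDensity l f) (hk : IsKernel k) (s s' : ℝ) :
    |(∫ u, f u * k (s' - u)) - f s| ≤ l * (|s' - s| + ∫ v, |v| * k v) := by
  have hd : Integrable fun v => k v * f (s' - v) := hk.integrable_mul_bdd
    (hf.continuous.comp (continuous_const.sub continuous_id)) fun v => hf.abs_apply_le _
  have e : (∫ u, f u * k (s' - u)) - f s = ∫ v, k v * (f (s' - v) - f s) := by
    simp_rw [mul_sub]
    rw [integral_sub hd (hk.integrable.mul_const _), integral_mul_const, hk.integral_eq_one,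
      one_mul, integral_mul_kernel_sub]
  have e2 : l * (|s' - s| + ∫ v, |v| * k v) = ∫ v, l * (|s' - s| * k v + |v| * k v) := by
    rw [integral_const_mul, integral_add (hk.integrable.const_mul _) hk.integrable_abs_mul,
      integral_const_mul, hk.integral_eq_one, mul_one]
  rw [e, e2, ← Real.norm_eq_abs]
  refine norm_integral_le_of_norm_le
    (((hk.integrable.const_mul _).add hk.integrable_abs_mul).const_mul _) (.of_forall fun v => ?_)
  rw [Real.norm_eq_abs, abs_mul, abs_of_nonneg (hk.nonneg v), ← add_mul, ← mul_assoc,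
    mul_comm (k v)]
  refine mul_le_mul_of_nonneg_right ((hf.lipschitz _ _).trans ?_) (hk.nonneg v)
  refine mul_le_mul_of_nonneg_left ?_ hf.const_nonneg
  have : s' - v - s = (s' - s) - v := by ring
  rw [this]
  exact abs_sub _ _

/-- The smoothing bias of the distribution function is of second order. -/
theorem IsLipschitzDensity.abs_integral_mul_kernelCdf_sub_cdfOf_le {l : ℝ} {f k : ℝ → ℝ}
    (hf : IsLipschitzDensity l f) (hk : IsKernel k) (s : ℝ) :
    |(∫ u, f u * kernelCdf k (s - u)) - cdfOf f s| ≤ l * ∫ v, |v| ^ 2 * k v := by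
  have hc : ∀ r, Integrable fun v => k v * cdfOf f (r - v) := fun r => hk.integrable_mul_bdd
    (hf.continuous_cdfOf.comp (continuous_const.sub continuous_id)) fun v => hf.abs_cdfOf_le_one _
  -- The linear term `f s * (s - v - s)` is inserted for free, because a symmetric kernel has first
  -- moment zero. Only the second-order Taylor remainder survives.
  have e : (∫ u, f u * kernelCdf k (s - u)) - cdfOf f s
      = ∫ v, k v * (cdfOf f (s - v) - cdfOf f s - f s * (s - v - s)) := by
    have e1 : ∀ v, k v * (cdfOf f (s - v) - cdfOf f s - f s * (s - v - s))
      = k v * cdfOf f (s - v) - k v * cdfOf f s + f s * (v * k v) := fun v => by ring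
    simp_rw [e1]
    rw [integral_add (integrable_fun_sub (hc s) (hk.integrable.mul_const _)) (hk.integrable_mul.const_mul _),
      integral_sub (hc s) (hk.integrable.mul_const _), integral_mul_const, integral_const_mul,
      hk.integral_eq_one, hk.integral_mul_eq_zero, integral_mul_kernelCdf hf hk]
    ring
  rw [e, ← Real.norm_eq_abs, ← integral_const_mul]
  refine norm_integral_le_of_norm_le (hk.integrable_sq.const_mul l) (.of_forall fun v => ?_)
  rw [Real.norm_eq_abs, abs_mul, abs_of_nonneg (hk.nonneg v), ← mul_assoc, mul_comm]
  refine mul_le_mul_of_nonneg_right ?_ (hk.nonneg v)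
  have := hf.abs_cdfOf_taylor s (s - v)
  have h2 : (s - v - s) ^ 2 = |v| ^ 2 := by rw [sq_abs]; ring
  rwa [h2] at this

theorem cdfOf_eq_integral (f : ℝ → ℝ) (s : ℝ) :
    ∫ u, f u * (if 0 < s - u then 1 else 0) = cdfOf f s := by
  rw [cdfOf, ← integral_indicator measurableSet_Iio]
  refine integral_congr_ae (.of_forall fun u => ?_)
  simp [Set.indicator]

/-! ### The check loss and its smoothed version -/

theorem checkLoss_eq_max (τ u : ℝ) :
    checkLoss τ u = max (u * τ) (u * (τ - 1)) := by
  unfold checkLoss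
  split_ifs with h
  · rw [max_eq_right (by nlinarith)]
  · rw [max_eq_left (by nlinarith), sub_zero]

theorem abs_checkLoss_sub_le {τ : ℝ} (hτ : τ ∈ Set.Ioo (0 : ℝ) 1) (u v : ℝ) :
    |checkLoss τ u - checkLoss τ v| ≤ |u - v| := by
  rw [checkLoss_eq_max, checkLoss_eq_max]
  refine (abs_max_sub_max_le_max _ _ _ _).trans (max_le ?_ ?_)
  · rw [← sub_mul, abs_mul, abs_of_pos hτ.1]
    exact mul_le_of_le_one_right (abs_nonneg _) hτ.2.le
  · rw [← sub_mul, abs_mul, abs_of_neg (show τ - 1 < 0 by linarith [hτ.2])]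
    exact mul_le_of_le_one_right (abs_nonneg _) (by linarith [hτ.1])

theorem abs_checkLoss_le {τ : ℝ} (hτ : τ ∈ Set.Ioo (0 : ℝ) 1) (u : ℝ) :
    |checkLoss τ u| ≤ |u| := by
  have := abs_checkLoss_sub_le hτ u 0
  simpa [checkLoss] using this

theorem continuous_checkLoss (τ : ℝ) : Continuous (checkLoss τ) := by
  rw [funext (checkLoss_eq_max τ)]
  fun_prop

theorem hasDerivAt_checkLoss_sub (τ : ℝ) {v t : ℝ} (h : v ≠ t) :
    HasDerivAt (fun t' => checkLoss τ (v - t')) ((if v < t then 1 else 0) - τ) t := by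
  rcases lt_or_gt_of_ne h with hvt | hvt
  · rw [if_pos hvt]
    have h1 : HasDerivAt (fun t' : ℝ => (v - t') * (τ - 1)) (1 - τ) t :=
      (((hasDerivAt_id t).const_sub v).mul_const (τ - 1)).congr_deriv (by ring)
    refine h1.congr_of_eventuallyEq ?_
    filter_upwards [lt_mem_nhds hvt] with t' ht'
    simp [checkLoss, ht']
  · rw [if_neg (not_lt.2 hvt.le)]
    have h1 : HasDerivAt (fun t' : ℝ => (v - t') * τ) (0 - τ) t :=
      (((hasDerivAt_id t).const_sub v).mul_const τ).congr_deriv (by ring)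
    refine h1.congr_of_eventuallyEq ?_
    filter_upwards [gt_mem_nhds hvt] with t' ht'
    simp [checkLoss, ht'.le]

/-- The check loss convolved with `k`. -/
noncomputable def smoothCheck (k : ℝ → ℝ) (τ t : ℝ) : ℝ := ∫ u, checkLoss τ u * k (u + t)

theorem smoothCheck_eq (k : ℝ → ℝ) (τ t : ℝ) :
    smoothCheck k τ t = ∫ v, checkLoss τ (v - t) * k v := by
  rw [smoothCheck, ← integral_add_right_eq_self (fun v => checkLoss τ (v - t) * k v) t]
  simp

theorem integrable_checkLoss_mul {k : ℝ → ℝ} (hk : IsKernel k) {τ : ℝ}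
    (hτ : τ ∈ Set.Ioo (0 : ℝ) 1) (t : ℝ) : Integrable fun v => checkLoss τ (v - t) * k v := by
  have hc := continuous_checkLoss τ
  have hm := hk.integrable.aestronglyMeasurable
  refine (hk.integrable_abs_mul.add (hk.integrable.const_mul |t|)).mono'
    (AEStronglyMeasurable.mul (by fun_prop) hm) (.of_forall fun v => ?_)
  rw [Real.norm_eq_abs, abs_mul, abs_of_nonneg (hk.nonneg v), Pi.add_apply, ← add_mul]
  exact mul_le_mul_of_nonneg_right ((abs_checkLoss_le hτ _).trans (abs_sub _ _)) (hk.nonneg v)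

theorem abs_smoothCheck_sub_le {k : ℝ → ℝ} (hk : IsKernel k) {τ : ℝ}
    (hτ : τ ∈ Set.Ioo (0 : ℝ) 1) (s t : ℝ) : |smoothCheck k τ s - smoothCheck k τ t| ≤ |s - t| := by
  rw [smoothCheck_eq, smoothCheck_eq,
    ← integral_sub (integrable_checkLoss_mul hk hτ s) (integrable_checkLoss_mul hk hτ t)]
  have e : |s - t| = ∫ v, |s - t| * k v := by
    rw [integral_const_mul, hk.integral_eq_one, mul_one]
  rw [e, ← Real.norm_eq_abs]
  refine norm_integral_le_of_norm_le (hk.integrable.const_mul _) (.of_forall fun v => ?_)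
  rw [← sub_mul, Real.norm_eq_abs, abs_mul, abs_of_nonneg (hk.nonneg v)]
  refine mul_le_mul_of_nonneg_right ?_ (hk.nonneg v)
  refine (abs_checkLoss_sub_le hτ _ _).trans (le_of_eq ?_)
  rw [sub_sub_sub_cancel_left, abs_sub_comm]

/-- Differentiation under the integral: the check loss is 1-Lipschitz, so `k` dominates the
difference quotients, and the kink at `v = t` is a null set. -/
theorem hasDerivAt_smoothCheck {k : ℝ → ℝ} (hk : IsKernel k) {τ : ℝ}
    (hτ : τ ∈ Set.Ioo (0 : ℝ) 1) (t : ℝ) :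
    HasDerivAt (smoothCheck k τ) (kernelCdf k t - τ) t := by
  have hm := hk.integrable.aestronglyMeasurable
  have key := hasDerivAt_integral_of_dominated_loc_of_lip (μ := volume) (s := Set.univ) (x₀ := t)
    (F := fun t' v => checkLoss τ (v - t') * k v) (bound := k)
    (F' := fun v => ((if v < t then 1 else 0) - τ) * k v) univ_mem
    (.of_forall fun t' => (integrable_checkLoss_mul hk hτ t').aestronglyMeasurable)
    (integrable_checkLoss_mul hk hτ t)
    (AEStronglyMeasurable.mul (Measurable.aestronglyMeasurable
      ((Measurable.ite measurableSet_Iio measurable_const measurable_const).sub_const _)) hm)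
    (.of_forall fun v => by
      refine LipschitzOnWith.of_dist_le_mul fun x _ y _ => ?_
      simp only [Real.dist_eq, Real.coe_nnabs]
      rw [← sub_mul, abs_mul, mul_comm]
      refine mul_le_mul_of_nonneg_left ?_ (abs_nonneg _)
      refine (abs_checkLoss_sub_le hτ _ _).trans (le_of_eq ?_)
      rw [sub_sub_sub_cancel_left, abs_sub_comm])
    hk.integrable
    (by
      filter_upwards [compl_mem_ae_iff.2 (measure_singleton (μ := volume) t)] with v hv
      exact (hasDerivAt_checkLoss_sub τ hv).mul_const _)
  have e : ∫ v, ((if v < t then 1 else 0) - τ) * k v = kernelCdf k t - τ := by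
    have e1 : ∀ v, ((if v < t then 1 else 0) - τ) * k v = (Set.Iio t).indicator k v - τ * k v := by
      intro v
      by_cases hv : v < t <;> simp [Set.indicator, hv, sub_mul]
    simp_rw [e1]
    rw [integral_sub (hk.integrable.indicator measurableSet_Iio) (hk.integrable.const_mul _),
      integral_indicator measurableSet_Iio, integral_const_mul, hk.integral_eq_one, mul_one]
    rfl
  rw [← e, funext (smoothCheck_eq k τ)]
  exact key.2

/-- First order condition for minimizers of an integrated Lipschitz loss along a direction. -/
theorem integral_mul_deriv_eq_zero_of_isMinOn {α : Type*} [MeasurableSpace α] {μ : Measure α}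
    {L L' : ℝ → ℝ} (hL : ∀ s t, |L s - L t| ≤ |s - t|) (hL' : Measurable L') {c t : α → ℝ}
    (hc : Integrable c μ) (ht : AEStronglyMeasurable t μ) (hLt : Integrable (fun z => L (t z)) μ)
    (hd : ∀ᵐ z ∂μ, HasDerivAt L (L' (t z)) (t z))
    (hmin : ∀ s : ℝ, ∫ z, L (t z) ∂μ ≤ ∫ z, L (t z + s * c z) ∂μ) :
    ∫ z, c z * L' (t z) ∂μ = 0 := by
  have hLc : Continuous L := by
    have : LipschitzWith (Real.toNNReal 1) L := LipschitzWith.of_dist_le' fun x y => by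
      simpa [Real.dist_eq] using hL x y
    exact this.continuous
  have key := hasDerivAt_integral_of_dominated_loc_of_lip (μ := μ) (s := Set.univ) (x₀ := (0 : ℝ))
    (F := fun s z => L (t z + s * c z)) (bound := c)
    (F' := fun z => c z * L' (t z)) univ_mem
    (.of_forall fun s => hLc.comp_aestronglyMeasurable
      (ht.add (hc.aestronglyMeasurable.const_mul s)))
    (by simpa using hLt)
    (hc.aestronglyMeasurable.mul (hL'.comp_aemeasurable ht.aemeasurable).aestronglyMeasurable)
    (.of_forall fun z => by
      refine LipschitzOnWith.of_dist_le_mul fun x _ y _ => ?_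
      simp only [Real.dist_eq, Real.coe_nnabs]
      refine (hL _ _).trans (le_of_eq ?_)
      rw [add_sub_add_left_eq_sub, ← sub_mul, abs_mul, mul_comm])
    hc
    (by
      filter_upwards [hd] with z hz
      have h1 : HasDerivAt (fun s : ℝ => t z + s * c z) (c z) 0 := by
        simpa using ((hasDerivAt_id (0 : ℝ)).mul_const (c z)).const_add (t z)
      have h2 : HasDerivAt L (L' (t z)) (t z + 0 * c z) := by simpa using hz
      have := h2.comp (0 : ℝ) h1
      rw [mul_comm]
      exact this)
  refine IsLocalMin.hasDerivAt_eq_zero (.of_forall fun s => ?_) key.2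
  simpa using hmin s

/-! ### Gradient, Hessian and score of the sample loss -/

theorem smoothedLoss_eq (K : ℝ → ℝ) (τ h : ℝ) {n : ℕ} (θ Y : Fin n → ℝ) :
    smoothedLoss K τ h θ Y = 1 / (n : ℝ) * ∑ i, smoothCheck (scaledKernel K h) τ (θ i - Y i) := by
  simp only [smoothedLoss, smoothCheck, add_sub_assoc]

theorem gradLoss_eq {K : ℝ → ℝ} (hK : IsKernel K) {τ h : ℝ} (hτ : τ ∈ Set.Ioo (0 : ℝ) 1)
    (hh : 0 < h) {n : ℕ} (θ Y : Fin n → ℝ) (i : Fin n) :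
    gradLoss K τ h θ Y i = 1 / (n : ℝ) * (kernelCdf (scaledKernel K h) (θ i - Y i) - τ) := by
  unfold gradLoss
  simp_rw [smoothedLoss_eq]
  have h1 : ∀ m : Fin n, HasFDerivAt (fun θ' : Fin n → ℝ =>
      smoothCheck (scaledKernel K h) τ (θ' m - Y m))
      ((kernelCdf (scaledKernel K h) (θ m - Y m) - τ) •
        (ContinuousLinearMap.proj m : (Fin n → ℝ) →L[ℝ] ℝ)) θ := fun m =>
    (hasDerivAt_smoothCheck (hK.scaledKernel hh) hτ (θ m - Y m)).comp_hasFDerivAt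
      (f := fun θ' : Fin n → ℝ => θ' m - Y m) θ ((hasFDerivAt_apply m θ).sub_const _)
  have h2 := (HasFDerivAt.fun_sum (u := Finset.univ) fun m _ => h1 m).const_mul (1 / (n : ℝ))
  rw [h2.fderiv]
  simp [Pi.single_apply]

/-- The hypothesis `hd` asks for differentiability at the actual residuals only. It holds for almost
every sample because the law of `y` given `x` has a density. -/
theorem hessLoss_eq {K : ℝ → ℝ} (hK : IsKernel K) {τ h : ℝ} (hτ : τ ∈ Set.Ioo (0 : ℝ) 1)
    (hh : 0 < h) {n : ℕ} (θ Y : Fin n → ℝ)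
    (hd : ∀ i, HasDerivAt (kernelCdf (scaledKernel K h)) (scaledKernel K h (θ i - Y i))
      (θ i - Y i)) :
    hessLoss K τ h θ Y
      = Matrix.diagonal fun i => 1 / (n : ℝ) * scaledKernel K h (θ i - Y i) := by
  ext i m
  simp only [hessLoss, Matrix.of_apply]
  simp_rw [gradLoss_eq hK hτ hh]
  have h1 : HasFDerivAt (fun θ' : Fin n → ℝ => kernelCdf (scaledKernel K h) (θ' i - Y i))
      (scaledKernel K h (θ i - Y i) • (ContinuousLinearMap.proj i : (Fin n → ℝ) →L[ℝ] ℝ)) θ :=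
    (hd i).comp_hasFDerivAt (f := fun θ' : Fin n → ℝ => θ' i - Y i) θ
      ((hasFDerivAt_apply i θ).sub_const _)
  have h2 := (h1.sub_const τ).const_mul (1 / (n : ℝ))
  rw [h2.fderiv]
  simp [Matrix.diagonal_apply, Pi.single_apply]

/-- The contribution of one observation to the score, for the step function `G`. -/
noncomputable def obsScore {p : ℕ} (G : ℝ → ℝ) (τ : ℝ) (E : Finset (Fin p)) (b : E → ℝ)
    (a : Fin p) (z : (Fin p → ℝ) × ℝ) : ℝ := z.1 a * (G (subvec E z.1 ⬝ᵥ b - z.2) - τ)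

theorem designOn_mulVec {n p : ℕ} (E : Finset (Fin p)) (ω : Sample n p) (b : E → ℝ) (i : Fin n) :
    (designOn E ω *ᵥ b) i = subvec E (ω i).1 ⬝ᵥ b := rfl

theorem score_eq {K : ℝ → ℝ} (hK : IsKernel K) {τ h : ℝ} (hτ : τ ∈ Set.Ioo (0 : ℝ) 1)
    (hh : 0 < h) {n p : ℕ} (E : Finset (Fin p)) (b : E → ℝ) (ω : Sample n p) (a : Fin p) :
    score K τ h E b ω a
      = 1 / (n : ℝ) * ∑ i, obsScore (kernelCdf (scaledKernel K h)) τ E b a (ω i) := by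
  simp only [score, Matrix.mulVec, dotProduct, Matrix.transpose_apply, design, Matrix.of_apply,
    gradLoss_eq hK hτ hh, Finset.mul_sum, obsScore, response]
  refine Finset.sum_congr rfl fun i _ => ?_
  have := designOn_mulVec E ω b i
  simp only [Matrix.mulVec, dotProduct] at this
  rw [this]
  ring

theorem design_hess_design {K : ℝ → ℝ} (hK : IsKernel K) {τ h : ℝ} (hτ : τ ∈ Set.Ioo (0 : ℝ) 1)
    (hh : 0 < h) {n p : ℕ} (E : Finset (Fin p)) (b : E → ℝ) (ω : Sample n p)
    (hd : ∀ i, HasDerivAt (kernelCdf (scaledKernel K h))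
      (scaledKernel K h (subvec E (ω i).1 ⬝ᵥ b - (ω i).2)) (subvec E (ω i).1 ⬝ᵥ b - (ω i).2))
    (a c : Fin p) :
    ((design ω)ᵀ * hessLoss K τ h (designOn E ω *ᵥ b) (response ω) * design ω) a c
      = 1 / (n : ℝ) * ∑ i, (ω i).1 a * (ω i).1 c *
          scaledKernel K h (subvec E (ω i).1 ⬝ᵥ b - (ω i).2) := by
  rw [hessLoss_eq hK hτ hh (designOn E ω *ᵥ b) (response ω) hd, Matrix.mul_apply, Finset.mul_sum]
  refine Finset.sum_congr rfl fun i _ => ?_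
  rw [Matrix.mul_diagonal, designOn_mulVec]
  simp only [Matrix.transpose_apply, design, Matrix.of_apply, response]
  ring

/-- The refitted estimator annihilates the score on `E`. -/
theorem score_eq_zero_of_isRefittedEstimate {K : ℝ → ℝ} (hK : IsKernel K) {τ h : ℝ}
    (hτ : τ ∈ Set.Ioo (0 : ℝ) 1) (hh : 0 < h) {n p : ℕ} (E : Finset (Fin p)) (b : E → ℝ)
    (ω : Sample n p) (hb : IsRefittedEstimate K τ h E ω b) (a : E) :
    score K τ h E b ω a = 0 := by
  rcases Nat.eq_zero_or_pos n with rfl | hn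
  · rw [score_eq hK hτ hh]; simp
  have hn' : (0 : ℝ) < n := by exact_mod_cast hn
  rw [score_eq hK hτ hh]
  -- Integration against the counting measure on the observation indices turns the sample problem
  -- into an instance of the same first order condition as the population problem.
  have key := integral_mul_deriv_eq_zero_of_isMinOn (μ := (Measure.count : Measure (Fin n)))
    (L := smoothCheck (scaledKernel K h) τ) (L' := fun t => kernelCdf (scaledKernel K h) t - τ)
    (abs_smoothCheck_sub_le (hK.scaledKernel hh) hτ)
    ((measurable_kernelCdf (hK.scaledKernel hh)).sub_const τ)
    (c := fun i => (ω i).1 a) (t := fun i => subvec E (ω i).1 ⬝ᵥ b - (ω i).2)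
    .of_finite (by fun_prop) .of_finite
    (.of_forall fun z => hasDerivAt_smoothCheck (hK.scaledKernel hh) hτ _) (fun s => by
      have := hb (Set.mem_univ (b + s • Pi.single a 1))
      simp only [Set.mem_ofPred_eq, smoothedLoss_eq, designOn_mulVec] at this
      rw [integral_count, integral_count]
      have h3 := le_of_mul_le_mul_left this (Real.sqrt_pos.2 hn')
      have h4 := le_of_mul_le_mul_left h3 (by positivity)
      refine h4.trans (le_of_eq (Finset.sum_congr rfl fun i _ => ?_))
      rw [dotProduct_add, dotProduct_smul, dotProduct_single_one]
      congr 1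
      simp only [subvec, response, smul_eq_mul]
      ring)
  rw [integral_count] at key
  simp only [obsScore]
  rw [key, mul_zero]

/-! ### Laws with a Lipschitz conditional density and moments of all orders -/

/-- The response has, given the covariates, the `l`-Lipschitz density `g x`, and all moments of the
covariates are finite. -/
structure IsRegularLaw {p : ℕ} (F : Measure ((Fin p → ℝ) × ℝ)) (l : ℝ)
    (g : (Fin p → ℝ) → ℝ → ℝ) : Prop where
  measurable : Measurable (Function.uncurry g)
  density : ∀ᵐ x ∂F.fst, IsLipschitzDensity l (g x)
  eq_withDensity : F = (F.fst.prod volume).withDensity fun z => ENNReal.ofReal (g z.1 z.2)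
  moments : ∀ r : ℕ, Integrable (fun z : (Fin p → ℝ) × ℝ => ‖z.1‖ ^ r) F

theorem SubGaussianCovariates.integrable_norm_pow {p : ℕ} {F : Measure ((Fin p → ℝ) × ℝ)}
    [IsProbabilityMeasure F] {σ : ℝ} (hA : SubGaussianCovariates F σ) (r : ℕ) :
    Integrable (fun z : (Fin p → ℝ) × ℝ => ‖z.1‖ ^ r) F := by
  have h1 : ∀ a : Fin p, Integrable (fun z : (Fin p → ℝ) × ℝ => |z.1 a| ^ r) F := by
    intro a
    have hu : (Pi.single a 1 : Fin p → ℝ) ⬝ᵥ Pi.single a 1 = 1 := by simp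
    have h2 := (hA 1 _ hu).1
    have h3 := (hA (-1) _ hu).1
    simp only [single_one_dotProduct] at h2 h3
    exact integrable_pow_abs_of_integrable_exp_mul one_ne_zero h2 h3 r
  -- The summand `1` covers `p = 0` with `r = 0`, where the left side is `1` and the sum over
  -- coordinates is empty.
  refine ((integrable_const 1).add (integrable_finsetSum Finset.univ fun a _ => h1 a)).mono'
    (by fun_prop) (.of_forall fun z => ?_)
  rw [Real.norm_of_nonneg (by positivity)]
  simp only [Pi.add_apply]
  rcases isEmpty_or_nonempty (Fin p) with hp | hp
  · have : z.1 = 0 := Subsingleton.elim _ _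
    rw [this, norm_zero]
    rcases r with _ | r <;> simp
  · obtain ⟨a, ha⟩ := Finite.exists_max fun a => |z.1 a|
    have h4 : ‖z.1‖ ≤ |z.1 a| := (pi_norm_le_iff_of_nonneg (abs_nonneg _)).2 ha
    have h5 : |z.1 a| ^ r ≤ ∑ a, |z.1 a| ^ r :=
      Finset.single_le_sum (f := fun a => |z.1 a| ^ r) (fun _ _ => by positivity)
        (Finset.mem_univ a)
    have h6 : ‖z.1‖ ^ r ≤ |z.1 a| ^ r := pow_le_pow_left₀ (norm_nonneg _) h4 r
    linarith

theorem measurable_subvec {p : ℕ} (S : Finset (Fin p)) : Measurable (subvec S) :=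
  measurable_pi_lambda _ fun _ => measurable_pi_apply _

/-- Conditioning on `x_S` with `S` the full index set is conditioning on `x`, since `e'` undoes the
restriction `e`. Disintegrating `F` along `e` then exhibits it as `F.fst ⊗ volume` weighted by the
conditional density. -/
theorem exists_isRegularLaw {p : ℕ} (F : Measure ((Fin p → ℝ) × ℝ)) [IsProbabilityMeasure F]
    {σ : ℝ} (hA : SubGaussianCovariates F σ) (hB : HasLipschitzCondDensity F Finset.univ) :
    ∃ l g, IsRegularLaw F l g := by
  obtain ⟨l, -, f, hfm, hf⟩ := hB
  set e : (Fin p → ℝ) → (↥(Finset.univ : Finset (Fin p)) → ℝ) := subvec Finset.univ with he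
  have hem : Measurable e := measurable_subvec _
  set e' : (↥(Finset.univ : Finset (Fin p)) → ℝ) → (Fin p → ℝ) :=
    fun v k => v ⟨k, Finset.mem_univ k⟩ with he'
  have hem' : Measurable e' := measurable_pi_lambda _ fun k => measurable_pi_apply _
  have hee : ∀ x, e' (e x) = x := fun x => rfl
  set κ := condDistrib Prod.snd (fun z : (Fin p → ℝ) × ℝ => e z.1) F with hκ
  have hgm : Measurable (Function.uncurry fun x u => f (e x) u) :=
    hfm.comp ((hem.comp measurable_fst).prodMk measurable_snd)
  have hae : ∀ᵐ x ∂F.fst, (∀ u, 0 ≤ f (e x) u) ∧ (∀ u u', |f (e x) u - f (e x) u'| ≤ l * |u - u'|) ∧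
      κ (e x) = volume.withDensity fun u => ENNReal.ofReal (f (e x) u) := by
    have : F.map (fun z => e z.1) = F.fst.map e := (Measure.map_map hem measurable_fst).symm
    rw [this] at hf
    exact ae_of_ae_map hem.aemeasurable hf
  refine ⟨l, fun x u => f (e x) u, hgm, ?_, ?_, hA.integrable_norm_pow⟩
  · filter_upwards [hae] with x hx
    obtain ⟨h0, hl, hk⟩ := hx
    -- Unit mass is inherited from `κ (e x)` being a probability measure; integrability of the
    -- density follows from it.
    have h1 : ∫⁻ u, ENNReal.ofReal (f (e x) u) = 1 := by
      have := measure_univ (μ := κ (e x))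
      rwa [hk, withDensity_apply _ MeasurableSet.univ, setLIntegral_univ] at this
    have hm : Measurable fun u => f (e x) u := hgm.comp measurable_prodMk_left
    have hi : Integrable fun u => f (e x) u := by
      refine ⟨hm.aestronglyMeasurable, ?_⟩
      rw [hasFiniteIntegral_iff_ofReal (.of_forall h0), h1]
      exact ENNReal.one_lt_top
    refine ⟨h0, hl, hi, ?_⟩
    rw [integral_eq_lintegral_of_nonneg_ae (.of_forall h0) hm.aestronglyMeasurable, h1]
    rfl
  · ext A hAm
    have hem1 : Measurable fun z : (Fin p → ℝ) × ℝ => e z.1 := hem.comp measurable_fst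
    have hpre : MeasurableSet {q : (↥(Finset.univ : Finset (Fin p)) → ℝ) × ℝ | (e' q.1, q.2) ∈ A} :=
      ((hem'.comp measurable_fst).prodMk measurable_snd) hAm
    have h1 : F A = (F.map fun z => (e z.1, z.2)) {q | (e' q.1, q.2) ∈ A} := by
      rw [Measure.map_apply (hem1.prodMk measurable_snd) hpre]
      rfl
    have h2 : F.map (fun z => e z.1) ⊗ₘ κ = F.map fun z => (e z.1, z.2) :=
      compProd_map_condDistrib measurable_snd.aemeasurable
    have hmeas : Measurable fun z : (Fin p → ℝ) × ℝ =>
        A.indicator (fun z => ENNReal.ofReal (f (e z.1) z.2)) z :=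
      (ENNReal.measurable_ofReal.comp hgm).indicator hAm
    rw [h1, ← h2, Measure.compProd_apply hpre, lintegral_map
      (Kernel.measurable_kernel_prodMk_left hpre) hem1,
      withDensity_apply _ hAm, ← lintegral_indicator hAm, lintegral_prod _ hmeas.aemeasurable,
      ← lintegral_map (f := fun x => κ (e x) (Prod.mk (e x) ⁻¹' {q | (e' q.1, q.2) ∈ A}))
        ((Kernel.measurable_kernel_prodMk_left hpre).comp hem) measurable_fst]
    refine lintegral_congr_ae ?_
    filter_upwards [hae] with x hx
    rw [hx.2.2, withDensity_apply _ (measurable_prodMk_left hpre),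
      ← lintegral_indicator (measurable_prodMk_left hpre)]
    refine lintegral_congr fun u => ?_
    rfl

/-! ### Integrals against a regular law: one-dimensional bounds given the covariates, then averaged.
-/

section

variable {p : ℕ} {F : Measure ((Fin p → ℝ) × ℝ)} [IsProbabilityMeasure F] {l : ℝ}
  {g : (Fin p → ℝ) → ℝ → ℝ}

theorem integrable_comp_fst {w : (Fin p → ℝ) → ℝ}
    (hw : Integrable (fun z : (Fin p → ℝ) × ℝ => w z.1) F) (hwm : Measurable w) :
    Integrable w F.fst :=
  (integrable_map_measure hwm.aestronglyMeasurable measurable_fst.aemeasurable).2 hw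

theorem integral_comp_fst {w : (Fin p → ℝ) → ℝ} (hwm : Measurable w) :
    ∫ x, w x ∂F.fst = ∫ z, w z.1 ∂F :=
  integral_map measurable_fst.aemeasurable hwm.aestronglyMeasurable

theorem IsRegularLaw.integrable_iff (hF : IsRegularLaw F l g) (ψ : (Fin p → ℝ) × ℝ → ℝ) :
    Integrable ψ F ↔ Integrable (fun z => g z.1 z.2 * ψ z) (F.fst.prod volume) := by
  have hm : Measurable fun z : (Fin p → ℝ) × ℝ => ENNReal.ofReal (g z.1 z.2) :=
    ENNReal.measurable_ofReal.comp hF.measurable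
  have h0 : ∀ᵐ z ∂(F.fst.prod volume), 0 ≤ g z.1 z.2 := by
    have := Measure.ae_prod_mem_iff_ae_ae_mem (μ := F.fst) (ν := (volume : Measure ℝ))
      (s := {z : (Fin p → ℝ) × ℝ | 0 ≤ g z.1 z.2}) (measurableSet_le measurable_const hF.measurable)
    exact this.2 (hF.density.mono fun x hx => .of_forall fun u => hx.nonneg u)
  conv_lhs => rw [hF.eq_withDensity]
  rw [integrable_withDensity_iff_integrable_smul' hm (.of_forall fun _ => ENNReal.ofReal_lt_top)]
  refine integrable_congr ?_
  filter_upwards [h0] with z hz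
  rw [ENNReal.toReal_ofReal hz, smul_eq_mul]

theorem IsRegularLaw.integral_eq (hF : IsRegularLaw F l g) {ψ : (Fin p → ℝ) × ℝ → ℝ}
    (hψ : Integrable ψ F) : ∫ z, ψ z ∂F = ∫ x, (∫ u, g x u * ψ (x, u)) ∂F.fst := by
  have hm : Measurable fun z : (Fin p → ℝ) × ℝ => ENNReal.ofReal (g z.1 z.2) :=
    ENNReal.measurable_ofReal.comp hF.measurable
  have h0 : ∀ᵐ z ∂(F.fst.prod volume), 0 ≤ g z.1 z.2 := by
    have := Measure.ae_prod_mem_iff_ae_ae_mem (μ := F.fst) (ν := (volume : Measure ℝ))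
      (s := {z : (Fin p → ℝ) × ℝ | 0 ≤ g z.1 z.2}) (measurableSet_le measurable_const hF.measurable)
    exact this.2 (hF.density.mono fun x hx => .of_forall fun u => hx.nonneg u)
  rw [← integral_prod _ ((hF.integrable_iff ψ).1 hψ)]
  conv_lhs => rw [hF.eq_withDensity]
  rw [integral_withDensity_eq_integral_toReal_smul hm (.of_forall fun _ => ENNReal.ofReal_lt_top)]
  refine integral_congr_ae ?_
  filter_upwards [h0] with z hz
  rw [ENNReal.toReal_ofReal hz, smul_eq_mul]

/-- The device by which each estimate for a single Lipschitz density becomes an estimate under `F`: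
integrate over `y` first, with `x` frozen. -/
theorem IsRegularLaw.abs_integral_le (hF : IsRegularLaw F l g) {ψ : (Fin p → ℝ) × ℝ → ℝ}
    (hψ : Integrable ψ F) {c : (Fin p → ℝ) → ℝ} (hcm : Measurable c)
    (hc : Integrable (fun z : (Fin p → ℝ) × ℝ => c z.1) F)
    (h : ∀ᵐ x ∂F.fst, IsLipschitzDensity l (g x) → |∫ u, g x u * ψ (x, u)| ≤ c x) :
    |∫ z, ψ z ∂F| ≤ ∫ z, c z.1 ∂F := by
  rw [hF.integral_eq hψ, ← integral_comp_fst hcm, ← Real.norm_eq_abs]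
  refine norm_integral_le_of_norm_le (integrable_comp_fst hc hcm) ?_
  filter_upwards [h, hF.density] with x hx hd using hx hd

/-- For frozen `x` the map `y ↦ s x - y` preserves Lebesgue measure. The null set need not be Borel,
hence the passage to `toMeasurable`. It is applied to `{0}`, to the points where `kernelCdf` lacks
derivative `k`, and to the points where a kernel differs from a measurable version. -/
theorem ae_prod_sub_notMem {s : (Fin p → ℝ) → ℝ} (hs : Measurable s) (μ : Measure (Fin p → ℝ))
    [SFinite μ] {N : Set ℝ} (hN : volume N = 0) :
    ∀ᵐ z ∂(μ.prod volume), s z.1 - z.2 ∉ N := by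
  have h1 : ∀ᵐ z ∂(μ.prod volume), s z.1 - z.2 ∈ (toMeasurable volume N)ᶜ := by
    refine (Measure.ae_prod_mem_iff_ae_ae_mem (s := {z : (Fin p → ℝ) × ℝ | s z.1 - z.2 ∈
      (toMeasurable volume N)ᶜ}) (((hs.comp measurable_fst).sub measurable_snd)
        (measurableSet_toMeasurable _ _).compl)).2 (.of_forall fun x => ?_)
    have h2 : volume ((fun u : ℝ => s x - u) ⁻¹' toMeasurable volume N) = 0 := by
      rw [(Measure.measurePreserving_sub_left volume (s x)).measure_preimage
        (measurableSet_toMeasurable _ _).nullMeasurableSet, measure_toMeasurable, hN]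
    exact measure_eq_zero_iff_ae_notMem.1 h2
  filter_upwards [h1] with z hz hzN using hz (subset_toMeasurable _ _ hzN)

theorem IsRegularLaw.ae_sub_notMem (hF : IsRegularLaw F l g) {s : (Fin p → ℝ) → ℝ}
    (hs : Measurable s) {N : Set ℝ} (hN : volume N = 0) : ∀ᵐ z ∂F, s z.1 - z.2 ∉ N := by
  have : F ≪ F.fst.prod volume := by
    conv_lhs => rw [hF.eq_withDensity]
    exact withDensity_absolutelyContinuous _ _
  exact this.ae_le (ae_prod_sub_notMem hs F.fst hN)

/-- The kernel is unbounded in general and only almost everywhere measurable. Measurability comes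
from changing it on a null set, integrability from its conditional mean being at most `1 + l`. -/
theorem IsRegularLaw.integrable_mul_kernel (hF : IsRegularLaw F l g) {k : ℝ → ℝ} (hk : IsKernel k)
    {s w : (Fin p → ℝ) → ℝ} (hs : Measurable s) (hw : Measurable w)
    (hwi : Integrable (fun z : (Fin p → ℝ) × ℝ => w z.1) F) :
    Integrable (fun z : (Fin p → ℝ) × ℝ => w z.1 * k (s z.1 - z.2)) F := by
  obtain ⟨k', hk'm, hkk'⟩ := hk.integrable.aestronglyMeasurable
  have hmeas : AEStronglyMeasurable (fun z : (Fin p → ℝ) × ℝ => k (s z.1 - z.2))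
      (F.fst.prod volume) := by
    refine (hk'm.measurable.comp ((hs.comp measurable_fst).sub
      measurable_snd)).aestronglyMeasurable.congr ?_
    filter_upwards [ae_prod_sub_notMem hs F.fst (N := {t | ¬ k t = k' t}) hkk'] with z hz
    simp only [not_not] at hz
    exact hz.symm
  have hmeas' : AEStronglyMeasurable (fun z : (Fin p → ℝ) × ℝ =>
      g z.1 z.2 * (w z.1 * k (s z.1 - z.2))) (F.fst.prod volume) :=
    hF.measurable.aestronglyMeasurable.mul ((hw.comp measurable_fst).aestronglyMeasurable.mul hmeas)
  rw [hF.integrable_iff, integrable_prod_iff hmeas']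
  constructor
  · filter_upwards [hF.density] with x hx
    have := (hx.integrable_mul_kernel hk (s x)).const_mul (w x)
    refine this.congr (.of_forall fun u => ?_)
    simp only
    ring
  · refine ((integrable_comp_fst hwi hw).norm.mul_const (1 + l)).mono'
      hmeas'.norm.integral_prod_right' ?_
    filter_upwards [hF.density] with x hx
    have e : ∀ u, ‖g x u * (w x * k (s x - u))‖ = ‖w x‖ * (g x u * k (s x - u)) := by
      intro u
      rw [norm_mul, norm_mul, Real.norm_of_nonneg (hx.nonneg u), Real.norm_of_nonneg (hk.nonneg _)]
      ring
    simp_rw [e]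
    rw [integral_const_mul, Real.norm_of_nonneg (mul_nonneg (norm_nonneg _)
      (integral_nonneg fun u => mul_nonneg (hx.nonneg u) (hk.nonneg _)))]
    exact mul_le_mul_of_nonneg_left (hx.integral_mul_kernel_le hk _) (norm_nonneg _)

theorem integrable_mul_kernelCdf {k : ℝ → ℝ} (hk : IsKernel k)
    {s w : (Fin p → ℝ) → ℝ} (hs : Measurable s)
    (hwi : Integrable (fun z : (Fin p → ℝ) × ℝ => w z.1) F) :
    Integrable (fun z : (Fin p → ℝ) × ℝ => w z.1 * kernelCdf k (s z.1 - z.2)) F :=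
  hwi.mul_bdd (c := 1) ((measurable_kernelCdf hk).comp
    ((hs.comp measurable_fst).sub measurable_snd)).aestronglyMeasurable (.of_forall fun z => by
      rw [Real.norm_of_nonneg (kernelCdf_nonneg hk _)]; exact kernelCdf_le_one hk _)

theorem IsRegularLaw.abs_integral_kernelCdf_taylor (hF : IsRegularLaw F l g) {k : ℝ → ℝ}
    (hk : IsKernel k) {s s' w : (Fin p → ℝ) → ℝ} (hs : Measurable s) (hs' : Measurable s')
    (hw : Measurable w) (hwi : Integrable (fun z : (Fin p → ℝ) × ℝ => w z.1) F)
    (hwi2 : Integrable (fun z : (Fin p → ℝ) × ℝ => |w z.1| * (s' z.1 - s z.1) ^ 2) F) :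
    |(∫ z, w z.1 * kernelCdf k (s' z.1 - z.2) ∂F) - (∫ z, w z.1 * kernelCdf k (s z.1 - z.2) ∂F)
      - ∫ z, w z.1 * (s' z.1 - s z.1) * k (s z.1 - z.2) ∂F|
      ≤ l * ∫ z, |w z.1| * (s' z.1 - s z.1) ^ 2 ∂F := by
  have hwi1 : Integrable (fun z : (Fin p → ℝ) × ℝ => w z.1 * (s' z.1 - s z.1)) F := by
    refine (hwi.norm.add hwi2).mono' ((hw.comp measurable_fst).mul ((hs'.comp measurable_fst).sub
      (hs.comp measurable_fst))).aestronglyMeasurable (.of_forall fun z => ?_)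
    rw [norm_mul, Pi.add_apply, Real.norm_eq_abs, Real.norm_eq_abs, ← sq_abs (s' z.1 - s z.1)]
    nlinarith [abs_nonneg (w z.1), mul_nonneg (abs_nonneg (w z.1))
      (sq_nonneg (|s' z.1 - s z.1| - 1)), mul_nonneg (abs_nonneg (w z.1))
      (abs_nonneg (s' z.1 - s z.1))]
  have i1 := integrable_mul_kernelCdf (F := F) hk hs' hwi
  have i2 := integrable_mul_kernelCdf (F := F) hk hs hwi
  have i3 := hF.integrable_mul_kernel hk hs (hw.mul (hs'.sub hs)) hwi1
  simp only [Pi.mul_apply, Pi.sub_apply] at i3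
  rw [← integral_sub i1 i2, ← integral_sub (integrable_fun_sub i1 i2) i3, ← integral_const_mul]
  refine hF.abs_integral_le (c := fun x => l * (|w x| * (s' x - s x) ^ 2))
    (integrable_fun_sub (integrable_fun_sub i1 i2) i3) (by fun_prop) (hwi2.const_mul l)
    (.of_forall fun x hx => ?_)
  have e : ∀ u, g x u * (w x * kernelCdf k (s' x - u) - w x * kernelCdf k (s x - u)
      - w x * (s' x - s x) * k (s x - u)) = w x * (g x u * (kernelCdf k (s' x - u)
        - kernelCdf k (s x - u) - k (s x - u) * (s' x - s x))) := fun u => by ring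
  simp_rw [e]
  rw [integral_const_mul, abs_mul, mul_left_comm]
  exact mul_le_mul_of_nonneg_left (hx.abs_integral_mul_kernelCdf_taylor hk _ _) (abs_nonneg _)

theorem IsRegularLaw.integral_mul_abs_kernelCdf_sub_le (hF : IsRegularLaw F l g) {k : ℝ → ℝ}
    (hk : IsKernel k) {s s' w : (Fin p → ℝ) → ℝ} (hs : Measurable s) (hs' : Measurable s')
    (hw : Measurable w) (hw0 : ∀ x, 0 ≤ w x)
    (hwi : Integrable (fun z : (Fin p → ℝ) × ℝ => w z.1) F)
    (hwi1 : Integrable (fun z : (Fin p → ℝ) × ℝ => w z.1 * |s' z.1 - s z.1|) F) :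
    ∫ z, w z.1 * |kernelCdf k (s' z.1 - z.2) - kernelCdf k (s z.1 - z.2)| ∂F
      ≤ (1 + l) * ∫ z, w z.1 * |s' z.1 - s z.1| ∂F := by
  have hmk := measurable_kernelCdf hk
  have i1 : Integrable (fun z : (Fin p → ℝ) × ℝ =>
      w z.1 * |kernelCdf k (s' z.1 - z.2) - kernelCdf k (s z.1 - z.2)|) F :=
    hwi.mul_bdd (c := 1) (Measurable.aestronglyMeasurable (by fun_prop)) (.of_forall fun z => by
      rw [norm_abs_eq_norm]; exact abs_kernelCdf_sub_le_one hk _ _)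
  refine (le_abs_self _).trans ?_
  rw [← integral_const_mul]
  refine hF.abs_integral_le (c := fun x => (1 + l) * (w x * |s' x - s x|)) i1
    (by fun_prop) (hwi1.const_mul _) (.of_forall fun x hx => ?_)
  have e : ∀ u, g x u * (w x * |kernelCdf k (s' x - u) - kernelCdf k (s x - u)|)
      = w x * (g x u * |kernelCdf k (s' x - u) - kernelCdf k (s x - u)|) := fun u => by ring
  simp_rw [e]
  rw [integral_const_mul, abs_mul, mul_left_comm, abs_of_nonneg (hw0 x), abs_of_nonneg
    (integral_nonneg fun u => mul_nonneg (hx.nonneg u) (abs_nonneg _))]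
  exact mul_le_mul_of_nonneg_left (hx.integral_mul_abs_kernelCdf_sub_le hk _ _) (hw0 x)

theorem IsRegularLaw.measurable_density_comp (hF : IsRegularLaw F l g) {s : (Fin p → ℝ) → ℝ}
    (hs : Measurable s) : Measurable fun x => g x (s x) :=
  hF.measurable.comp (measurable_id.prodMk hs)

theorem IsRegularLaw.ae_density (hF : IsRegularLaw F l g) :
    ∀ᵐ z ∂F, IsLipschitzDensity l (g z.1) :=
  ae_of_ae_map measurable_fst.aemeasurable hF.density

theorem IsRegularLaw.integrable_mul_density (hF : IsRegularLaw F l g)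
    {s w : (Fin p → ℝ) → ℝ} (hs : Measurable s)
    (hwi : Integrable (fun z : (Fin p → ℝ) × ℝ => w z.1) F) :
    Integrable (fun z : (Fin p → ℝ) × ℝ => w z.1 * g z.1 (s z.1)) F :=
  hwi.mul_bdd (c := 1 + l)
    ((hF.measurable_density_comp hs).comp measurable_fst).aestronglyMeasurable
    (by filter_upwards [hF.ae_density] with z hz using hz.abs_apply_le _)

/-- Each evaluation of the density is displaced by `s' - s` and by the kernel variable, and the
Lipschitz bound charges both. With a scaled kernel the second charge is `O(h)`, which is how `J`
acquires a limit. -/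
theorem IsRegularLaw.abs_integral_kernel_sub_density_le (hF : IsRegularLaw F l g) {k : ℝ → ℝ}
    (hk : IsKernel k) {s s' w : (Fin p → ℝ) → ℝ} (hs : Measurable s) (hs' : Measurable s')
    (hw : Measurable w) (hwi : Integrable (fun z : (Fin p → ℝ) × ℝ => w z.1) F)
    (hwi1 : Integrable (fun z : (Fin p → ℝ) × ℝ => |w z.1| * |s' z.1 - s z.1|) F) :
    |(∫ z, w z.1 * k (s' z.1 - z.2) ∂F) - ∫ z, w z.1 * g z.1 (s z.1) ∂F|
      ≤ l * ((∫ z, |w z.1| * |s' z.1 - s z.1| ∂F) + (∫ v, |v| * k v) * ∫ z, |w z.1| ∂F) := by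
  have i1 := hF.integrable_mul_kernel hk hs' hw hwi
  have i2 := hF.integrable_mul_density hs hwi
  rw [← integral_sub i1 i2, ← integral_const_mul (∫ v, |v| * k v),
    ← integral_add hwi1 (hwi.abs.const_mul _), ← integral_const_mul]
  refine hF.abs_integral_le (c := fun x => l * (|w x| * |s' x - s x| + (∫ v, |v| * k v) * |w x|))
    (integrable_fun_sub i1 i2) (by fun_prop) ((hwi1.add (hwi.abs.const_mul _)).const_mul l)
    (.of_forall fun x hx => ?_)
  have e : ∀ u, g x u * (w x * k (s' x - u) - w x * g x (s x))
      = w x * (g x u * k (s' x - u) - g x (s x) * g x u) := fun u => by ring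
  simp_rw [e]
  rw [integral_const_mul, integral_sub (hx.integrable_mul_kernel hk _) (hx.integrable.const_mul _),
    integral_const_mul, hx.integral_eq_one, mul_one, abs_mul]
  refine (mul_le_mul_of_nonneg_left (hx.abs_integral_mul_kernel_sub_le hk (s x) (s' x))
    (abs_nonneg _)).trans (le_of_eq ?_)
  ring

theorem IsRegularLaw.abs_integral_kernelCdf_bias_le (hF : IsRegularLaw F l g) {k : ℝ → ℝ}
    (hk : IsKernel k) {s w : (Fin p → ℝ) → ℝ} (hs : Measurable s)
    (hw : Measurable w) (hwi : Integrable (fun z : (Fin p → ℝ) × ℝ => w z.1) F) :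
    |(∫ z, w z.1 * kernelCdf k (s z.1 - z.2) ∂F)
        - ∫ z, w z.1 * (if 0 < s z.1 - z.2 then 1 else 0) ∂F|
      ≤ (l * ∫ v, |v| ^ 2 * k v) * ∫ z, |w z.1| ∂F := by
  have i1 := integrable_mul_kernelCdf (F := F) hk hs hwi
  have i2 : Integrable (fun z : (Fin p → ℝ) × ℝ =>
      w z.1 * (if 0 < s z.1 - z.2 then 1 else 0)) F :=
    hwi.mul_bdd (c := 1) (Measurable.aestronglyMeasurable (Measurable.ite (measurableSet_lt
      measurable_const (by fun_prop)) measurable_const measurable_const)) (.of_forall fun z => by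
        split_ifs <;> simp)
  rw [← integral_sub i1 i2, ← integral_const_mul]
  refine hF.abs_integral_le (c := fun x => (l * ∫ v, |v| ^ 2 * k v) * |w x|)
    (integrable_fun_sub i1 i2) (by fun_prop) (hwi.abs.const_mul _)
    (.of_forall fun x hx => ?_)
  have e : ∀ u, g x u * (w x * kernelCdf k (s x - u) - w x * (if 0 < s x - u then 1 else 0))
      = w x * (g x u * kernelCdf k (s x - u) - g x u * (if 0 < s x - u then 1 else 0)) :=
    fun u => by ring
  simp_rw [e]
  have i3 : Integrable fun u => g x u * (if 0 < s x - u then (1 : ℝ) else 0) :=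
    hx.integrable.mul_bdd (c := 1) (Measurable.aestronglyMeasurable (Measurable.ite
      (measurableSet_lt measurable_const (by fun_prop)) measurable_const measurable_const))
        (.of_forall fun z => by split_ifs <;> simp)
  rw [integral_const_mul, integral_sub (hx.integrable_mul_kernelCdf hk _) i3, cdfOf_eq_integral,
    abs_mul, mul_comm]
  exact mul_le_mul_of_nonneg_right (hx.abs_integral_mul_kernelCdf_sub_cdfOf_le hk _) (abs_nonneg _)

end

/-! ### Stochastic orders along a sequence of probability spaces -/

section StochasticOrder

variable {Ω : ℕ → Type*} [∀ n, MeasurableSpace (Ω n)] {P : ∀ n, Measure (Ω n)}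

/-- `f n` tends to zero in probability; the spaces may vary with `n`. -/
def TendstoZeroInProb (P : ∀ n, Measure (Ω n)) (f : ∀ n, Ω n → ℝ) : Prop :=
  ∀ ε : ℝ, 0 < ε → Tendsto (fun n => P n {ω | ε ≤ |f n ω|}) atTop (𝓝 0)

/-- `f n` is bounded in probability; the spaces may vary with `n`. -/
def BoundedInProb (P : ∀ n, Measure (Ω n)) (f : ∀ n, Ω n → ℝ) : Prop :=
  ∀ δ : ENNReal, 0 < δ → ∃ M : ℝ, ∀ᶠ n in atTop, P n {ω | M ≤ |f n ω|} ≤ δ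

/-- The rules of this calculus use only monotonicity and subadditivity of outer measure. They
therefore also apply to random quantities whose measurability is not known. -/
theorem TendstoZeroInProb.mono {f g : ∀ n, Ω n → ℝ} (hg : TendstoZeroInProb P g)
    (h : ∀ᶠ n in atTop, ∀ᵐ ω ∂P n, |f n ω| ≤ |g n ω|) : TendstoZeroInProb P f := fun ε hε =>
  tendsto_of_tendsto_of_tendsto_of_le_of_le' tendsto_const_nhds (hg ε hε)
    (.of_forall fun _ => zero_le) (h.mono fun n hn => measure_mono_ae
      (hn.mono fun ω hω (hε : ε ≤ |f n ω|) => show ε ≤ |g n ω| from hε.trans hω))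

theorem TendstoZeroInProb.congr {f g : ∀ n, Ω n → ℝ} (hg : TendstoZeroInProb P g)
    (h : ∀ᶠ n in atTop, ∀ᵐ ω ∂P n, f n ω = g n ω) : TendstoZeroInProb P f :=
  hg.mono (h.mono fun _ hn => hn.mono fun _ hω => by rw [hω])

theorem tendstoZeroInProb_of_tendsto {c : ℕ → ℝ} (hc : Tendsto c atTop (𝓝 0)) :
    TendstoZeroInProb P fun n _ => c n := by
  intro ε hε
  refine tendsto_const_nhds.congr' ?_
  have := (tendsto_order.1 hc.abs).2 ε (by simpa using hε)
  filter_upwards [this] with n hn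
  simp [not_le.2 hn]

theorem TendstoZeroInProb.add {f g : ∀ n, Ω n → ℝ} (hf : TendstoZeroInProb P f)
    (hg : TendstoZeroInProb P g) : TendstoZeroInProb P fun n ω => f n ω + g n ω := by
  intro ε hε
  have h := (hf (ε / 2) (by positivity)).add (hg (ε / 2) (by positivity))
  rw [add_zero] at h
  refine tendsto_of_tendsto_of_tendsto_of_le_of_le tendsto_const_nhds h
    (fun _ => zero_le) fun n => (measure_mono fun ω hω => ?_).trans (measure_union_le _ _)
  simp only [Set.mem_ofPred_eq, Set.mem_union] at hω ⊢
  by_contra! hcon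
  linarith [abs_add_le (f n ω) (g n ω)]

theorem TendstoZeroInProb.const_mul {f : ∀ n, Ω n → ℝ} (hf : TendstoZeroInProb P f) (c : ℝ) :
    TendstoZeroInProb P fun n ω => c * f n ω := by
  intro ε hε
  refine tendsto_of_tendsto_of_tendsto_of_le_of_le tendsto_const_nhds
    (hf (ε / (|c| + 1)) (by positivity)) (fun _ => zero_le) fun n => measure_mono fun ω hω => ?_
  simp only [Set.mem_ofPred_eq, abs_mul] at hω ⊢
  rw [div_le_iff₀ (by positivity)]
  nlinarith [abs_nonneg (f n ω)]

theorem TendstoZeroInProb.sub {f g : ∀ n, Ω n → ℝ} (hf : TendstoZeroInProb P f)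
    (hg : TendstoZeroInProb P g) : TendstoZeroInProb P fun n ω => f n ω - g n ω :=
  (hf.add (hg.const_mul (-1))).congr (.of_forall fun _ => .of_forall fun _ => by ring)

theorem TendstoZeroInProb.sum {ι : Type*} (s : Finset ι) {f : ι → ∀ n, Ω n → ℝ}
    (hf : ∀ i ∈ s, TendstoZeroInProb P (f i)) :
    TendstoZeroInProb P fun n ω => ∑ i ∈ s, f i n ω := by
  classical
  induction s using Finset.induction_on with
  | empty => simpa using tendstoZeroInProb_of_tendsto (P := P) (tendsto_const_nhds (x := (0 : ℝ)))
  | insert a s ha ih =>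
    simp only [Finset.sum_insert ha]
    exact (hf a (by simp)).add (ih fun i hi => hf i (by simp [hi]))

theorem BoundedInProb.mul_tendsto_zero {f : ∀ n, Ω n → ℝ} (hf : BoundedInProb P f) {c : ℕ → ℝ}
    (hc : Tendsto c atTop (𝓝 0)) : TendstoZeroInProb P fun n ω => c n * f n ω := by
  intro ε hε
  rw [ENNReal.tendsto_nhds_zero]
  intro δ hδ
  obtain ⟨M, hM⟩ := hf δ hδ
  have h1 := (tendsto_order.1 hc.abs).2 (ε / (|M| + 1)) (by rw [abs_zero]; positivity)
  filter_upwards [hM, h1] with n hn hcn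
  refine (measure_mono fun ω hω => ?_).trans hn
  simp only [Set.mem_ofPred_eq, abs_mul] at hω ⊢
  by_contra! hcon
  rw [lt_div_iff₀ (by positivity)] at hcn
  nlinarith [abs_nonneg (c n), le_abs_self M, abs_nonneg (f n ω)]

theorem BoundedInProb.mono {f g : ∀ n, Ω n → ℝ} (hg : BoundedInProb P g)
    (h : ∀ᶠ n in atTop, ∀ᵐ ω ∂P n, |f n ω| ≤ |g n ω|) : BoundedInProb P f := fun δ hδ => by
  obtain ⟨M, hM⟩ := hg δ hδ
  refine ⟨M, ?_⟩
  filter_upwards [hM, h] with n hn hle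
  exact (measure_mono_ae (hle.mono fun ω hω (hM : M ≤ |f n ω|) =>
    show M ≤ |g n ω| from hM.trans hω)).trans hn

theorem TendstoZeroInProb.boundedInProb {f : ∀ n, Ω n → ℝ} (hf : TendstoZeroInProb P f) :
    BoundedInProb P f := fun δ hδ =>
  ⟨1, (ENNReal.tendsto_nhds_zero.1 (hf 1 one_pos)) δ hδ⟩

theorem BoundedInProb.add {f g : ∀ n, Ω n → ℝ} (hf : BoundedInProb P f)
    (hg : BoundedInProb P g) : BoundedInProb P fun n ω => f n ω + g n ω := by
  intro δ hδ
  obtain ⟨M, hM⟩ := hf (δ / 2) (ENNReal.half_pos hδ.ne')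
  obtain ⟨N, hN⟩ := hg (δ / 2) (ENNReal.half_pos hδ.ne')
  refine ⟨M + N, ?_⟩
  filter_upwards [hM, hN] with n h1 h2
  refine (measure_mono fun ω hω => ?_).trans ((measure_union_le _ _).trans
    ((add_le_add h1 h2).trans (ENNReal.add_halves δ).le))
  simp only [Set.mem_ofPred_eq, Set.mem_union] at hω ⊢
  by_contra! hcon
  linarith [abs_add_le (f n ω) (g n ω)]

/-- Equality of the limits of characteristic functions of two asymptotically equivalent
sequences. -/
theorem TendstoZeroInProb.tendsto_integral_cexp [∀ n, IsProbabilityMeasure (P n)]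
    {X Y : ∀ n, Ω n → ℝ} (hX : ∀ n, AEMeasurable (X n) (P n)) (hY : ∀ n, AEMeasurable (Y n) (P n))
    (h : TendstoZeroInProb P fun n ω => X n ω - Y n ω) {c : ℂ}
    (hc : Tendsto (fun n => ∫ ω, Complex.exp (Y n ω * Complex.I) ∂P n) atTop (𝓝 c)) :
    Tendsto (fun n => ∫ ω, Complex.exp (X n ω * Complex.I) ∂P n) atTop (𝓝 c) := by
  have hint : ∀ {Z : ∀ n, Ω n → ℝ} (_ : ∀ n, AEMeasurable (Z n) (P n)) (n : ℕ),
      Integrable (fun ω => Complex.exp (Z n ω * Complex.I)) (P n) := fun hZ n =>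
    (integrable_const (1 : ℝ)).mono' (by have := hZ n; fun_prop)
      (.of_forall fun ω => by rw [Complex.norm_exp_ofReal_mul_I])
  have key : Tendsto (fun n => (∫ ω, Complex.exp (X n ω * Complex.I) ∂P n)
      - ∫ ω, Complex.exp (Y n ω * Complex.I) ∂P n) atTop (𝓝 0) := by
    rw [Metric.tendsto_atTop]
    intro ε hε
    have h1 := h (ε / 2) (by positivity)
    have h2 := (ENNReal.tendsto_toReal (by simp : (0 : ENNReal) ≠ ⊤)).comp h1
    -- The two exponentials differ by at most `2` on the exceptional set and by at most `ε / 2` off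
    -- it, so mass below `ε / 4` is enough.
    obtain ⟨N, hN⟩ := (Metric.tendsto_atTop.1 h2) (ε / 4) (by positivity)
    refine ⟨N, fun n hn => ?_⟩
    have h3 := hN n hn
    simp only [Function.comp_apply, ENNReal.toReal_zero, dist_zero_right, Real.norm_eq_abs] at h3
    rw [abs_of_nonneg ENNReal.toReal_nonneg] at h3
    rw [dist_zero_right, ← integral_sub (hint hX n) (hint hY n)]
    set A := {ω | ε / 2 ≤ |X n ω - Y n ω|} with hA
    have hAm : NullMeasurableSet A (P n) :=
      nullMeasurableSet_le aemeasurable_const ((hX n).sub (hY n)).abs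
    have hb : ∀ ω, ‖Complex.exp (X n ω * Complex.I) - Complex.exp (Y n ω * Complex.I)‖
        ≤ ε / 2 + A.indicator (fun _ => (2 : ℝ)) ω := by
      intro ω
      by_cases hω : ω ∈ A
      · rw [Set.indicator_of_mem hω]
        refine (norm_sub_le _ _).trans ?_
        rw [Complex.norm_exp_ofReal_mul_I, Complex.norm_exp_ofReal_mul_I]
        linarith
      · rw [Set.indicator_of_notMem hω, add_zero]
        have hlt : |X n ω - Y n ω| < ε / 2 := not_le.1 hω
        have e : Complex.exp (X n ω * Complex.I) - Complex.exp (Y n ω * Complex.I)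
            = Complex.exp (Y n ω * Complex.I) *
              (Complex.exp (Complex.I * ((X n ω - Y n ω : ℝ) : ℂ)) - 1) := by
          rw [mul_sub, ← Complex.exp_add, mul_one]
          congr 2
          push_cast
          ring
        rw [e, norm_mul, Complex.norm_exp_ofReal_mul_I, one_mul]
        exact (Real.norm_exp_I_mul_ofReal_sub_one_le).trans hlt.le
    have hbi : Integrable (fun ω => ε / 2 + A.indicator (fun _ => (2 : ℝ)) ω) (P n) :=
      (integrable_const _).add ((integrable_const _).indicator₀ hAm)
    refine (norm_integral_le_of_norm_le hbi (.of_forall hb)).trans_lt ?_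
    rw [integral_add (integrable_const _) ((integrable_const _).indicator₀ hAm),
      integral_indicator₀ hAm]
    simp only [integral_const, smul_eq_mul, Measure.real, Measure.restrict_apply_univ,
      measure_univ, ENNReal.toReal_one]
    linarith
  simpa using key.add hc

end StochasticOrder

/-! ### Normalized sums of independent observations -/

section CentredSum

variable {α : Type*} [MeasurableSpace α] {F : Measure α} [IsProbabilityMeasure F]

/-- `n^{-1/2} ∑ᵢ (ψ(zᵢ) - 𝔼 ψ)`. -/
noncomputable def centredSum (F : Measure α) (ψ : α → ℝ) {n : ℕ} (ω : Fin n → α) : ℝ :=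
  1 / √(n : ℝ) * ∑ i, (ψ (ω i) - ∫ z, ψ z ∂F)

theorem aemeasurable_centredSum {ψ : α → ℝ} (hψ : AEMeasurable ψ F) (n : ℕ) :
    AEMeasurable (fun ω : Fin n → α => centredSum F ψ ω) (Measure.pi fun _ => F) := by
  unfold centredSum
  refine AEMeasurable.const_mul (Finset.aemeasurable_fun_sum _ fun i _ => ?_) _
  exact (hψ.comp_quasiMeasurePreserving
    (Measure.quasiMeasurePreserving_eval (fun _ : Fin n => F) i)).sub_const _

/-- Chebyshev: by independence the variance of the normalized sum is that of one term. The bound by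
the raw second moment does not involve `n`, so it serves both tightness and convergence to zero. -/
theorem measure_centredSum_ge_le {ψ : α → ℝ} (hψ : MemLp ψ 2 F) (n : ℕ) {ε : ℝ} (hε : 0 < ε) :
    (Measure.pi fun _ : Fin n => F) {ω | ε ≤ |centredSum F ψ ω|}
      ≤ ENNReal.ofReal ((∫ z, ψ z ^ 2 ∂F) / ε ^ 2) := by
  have hev : ∀ i : Fin n, MeasurePreserving (fun ω : Fin n → α => ω i)
      (Measure.pi fun _ : Fin n => F) F := fun i => measurePreserving_eval (fun _ : Fin n => F) i
  rcases Nat.eq_zero_or_pos n with rfl | hn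
  · simp [centredSum, not_le.2 hε]
  have hn' : (0 : ℝ) < n := by exact_mod_cast hn
  set X : (Fin n → α) → ℝ := fun ω => 1 / √(n : ℝ) * ∑ i, ψ (ω i) with hX
  have hm : MemLp (∑ i, fun ω : Fin n → α => ψ (ω i)) 2 (Measure.pi fun _ : Fin n => F) :=
    memLp_finsetSum' _ fun i _ => hψ.comp_measurePreserving (hev i)
  have hXe : X = fun ω => 1 / √(n : ℝ) * (∑ i, fun ω : Fin n → α => ψ (ω i)) ω := by
    funext ω; simp [hX]
  have hXm : MemLp X 2 (Measure.pi fun _ : Fin n => F) := by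
    rw [hXe]; exact hm.const_mul _
  have hmean : ∫ ω, X ω ∂(Measure.pi fun _ : Fin n => F)
      = 1 / √(n : ℝ) * ∑ i : Fin n, ∫ z, ψ z ∂F := by
    simp only [hX]
    rw [integral_const_mul, integral_finsetSum (f := fun (i : Fin n) (ω : Fin n → α) => ψ (ω i)) _ fun i _ =>
      ((hψ.comp_measurePreserving (hev i)).integrable one_le_two)]
    congr 1
    refine Finset.sum_congr rfl fun i _ => ?_
    have h1 := integral_map (μ := Measure.pi fun _ : Fin n => F) (φ := fun ω : Fin n → α => ω i)
      (f := ψ) (hev i).measurable.aemeasurable (by rw [(hev i).map_eq]; exact hψ.1)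
    rw [(hev i).map_eq] at h1
    exact h1.symm
  have hvar : Var[X; Measure.pi fun _ : Fin n => F] ≤ ∫ z, ψ z ^ 2 ∂F := by
    rw [hXe, variance_const_mul]
    have := variance_sum_pi (μ := fun _ : Fin n => F) (X := fun _ : Fin n => ψ) fun _ => hψ
    rw [this, Finset.sum_const, Finset.card_univ, Fintype.card_fin, nsmul_eq_mul, ← mul_assoc,
      div_pow, Real.sq_sqrt hn'.le, one_pow, one_div_mul_cancel hn'.ne', one_mul]
    exact variance_le_expectation_sq hψ.1
  have hset : {ω : Fin n → α | ε ≤ |centredSum F ψ ω|}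
      = {ω | ε ≤ |X ω - ∫ ω', X ω' ∂(Measure.pi fun _ : Fin n => F)|} := by
    ext ω
    rw [Set.mem_ofPred_eq, Set.mem_ofPred_eq, hmean]
    simp only [hX, centredSum, Finset.sum_sub_distrib, mul_sub]
  rw [hset]
  refine (meas_ge_le_variance_div_sq hXm hε).trans (ENNReal.ofReal_le_ofReal ?_)
  gcongr

theorem tendstoZeroInProb_centredSum {ψ : ℕ → α → ℝ} (hψ : ∀ n, MemLp (ψ n) 2 F)
    (h : Tendsto (fun n => ∫ z, ψ n z ^ 2 ∂F) atTop (𝓝 0)) :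
    TendstoZeroInProb (fun n => Measure.pi fun _ : Fin n => F)
      fun n ω => centredSum F (ψ n) ω := by
  intro ε hε
  have h1 : Tendsto (fun n => ENNReal.ofReal ((∫ z, ψ n z ^ 2 ∂F) / ε ^ 2)) atTop (𝓝 0) := by
    have := ENNReal.tendsto_ofReal (h.div_const (ε ^ 2))
    simpa using this
  exact tendsto_of_tendsto_of_tendsto_of_le_of_le tendsto_const_nhds h1
    (fun _ => zero_le) fun n => measure_centredSum_ge_le (hψ n) n hε

theorem boundedInProb_centredSum {ψ : α → ℝ} (hψ : MemLp ψ 2 F) :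
    BoundedInProb (fun n => Measure.pi fun _ : Fin n => F) fun _ ω => centredSum F ψ ω := by
  intro δ hδ
  have h1 : Tendsto (fun M : ℝ => ENNReal.ofReal ((∫ z, ψ z ^ 2 ∂F) / M ^ 2)) atTop (𝓝 0) := by
    have := ENNReal.tendsto_ofReal ((tendsto_pow_atTop (α := ℝ) two_ne_zero).const_div_atTop
      (∫ z, ψ z ^ 2 ∂F))
    simpa using this
  obtain ⟨M, hM, hM0⟩ := (((ENNReal.tendsto_nhds_zero.1 h1) δ hδ).and
    (eventually_gt_atTop 0)).exists
  exact ⟨M, .of_forall fun n => (measure_centredSum_ge_le hψ n hM0).trans hM⟩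

/-- Central limit theorem for the normalized sums, in terms of characteristic functions. -/
theorem tendsto_integral_cexp_centredSum {ψ : α → ℝ} (hψ : MemLp ψ 2 F) :
    Tendsto (fun n : ℕ => ∫ ω, Complex.exp (centredSum F ψ ω * Complex.I)
      ∂(Measure.pi fun _ : Fin n => F)) atTop (𝓝 (Complex.exp (-(Var[ψ; F] : ℝ) / 2))) := by
  set v := Var[ψ; F] with hv
  set m := ∫ z, ψ z ∂F with hm
  have e1 : ∀ n : ℕ, ∫ ω, Complex.exp (centredSum F ψ ω * Complex.I)
      ∂(Measure.pi fun _ : Fin n => F)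
      = (∫ z, Complex.exp (((√(n : ℝ))⁻¹ * (ψ z - m) : ℝ) * Complex.I) ∂F) ^ n := by
    intro n
    have := integral_fintype_prod_eq_pow (ι := Fin n) (μ := F)
      (fun z => Complex.exp (((√(n : ℝ))⁻¹ * (ψ z - m) : ℝ) * Complex.I))
    rw [Fintype.card_fin] at this
    rw [← this]
    refine integral_congr_ae (.of_forall fun ω => ?_)
    simp only
    rw [← Complex.exp_sum, centredSum, Finset.mul_sum, one_div]
    congr 1
    push_cast
    rw [Finset.sum_mul]
  simp_rw [e1]
  -- The degenerate case is separate because the general one standardizes by `√v` and evaluates the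
  -- limiting characteristic function at `√v`.
  by_cases hv0 : v = 0
  · have h0 := ae_eq_integral_of_variance_eq_zero hψ hv0
    have : ∀ n : ℕ, ∫ z, Complex.exp (((√(n : ℝ))⁻¹ * (ψ z - m) : ℝ) * Complex.I) ∂F = 1 := by
      intro n
      have e : ∀ᵐ z ∂F, Complex.exp (((√(n : ℝ))⁻¹ * (ψ z - m) : ℝ) * Complex.I) = 1 := by
        filter_upwards [h0] with z hz
        simp [hz, hm]
      rw [integral_congr_ae e]
      simp
    simp only [this, one_pow, hv0]
    simp
  · have hvpos : 0 < v := lt_of_le_of_ne (variance_nonneg _ _) (Ne.symm hv0)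
    set X : α → ℝ := fun z => (ψ z - m) / √v with hX
    have hψm := hψ.1.aemeasurable
    have hXm : AEMeasurable X F := by fun_prop
    have hmean : F[X] = 0 := by
      simp only [hX]
      rw [integral_div, integral_sub (hψ.integrable one_le_two) (integrable_const _)]
      simp [hm]
    have hsq : F[X ^ 2] = 1 := by
      simp only [hX, Pi.pow_apply, div_pow]
      rw [integral_div, Real.sq_sqrt hvpos.le, ← variance_eq_integral hψm]
      exact div_self hv0
    have key := tendsto_charFun_inv_sqrt_mul_pow hXm hmean hsq (√v)
    have e2 : Complex.exp (-(√v : ℂ) ^ 2 / 2) = Complex.exp (-(v : ℝ) / 2) := by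
      rw [← Complex.ofReal_pow, Real.sq_sqrt hvpos.le]
    rw [e2] at key
    refine key.congr fun n => ?_
    congr 1
    rw [charFun_apply_real, integral_map hXm (by fun_prop)]
    refine integral_congr_ae (.of_forall fun z => ?_)
    simp only [hX]
    congr 2
    have : √v ≠ 0 := (Real.sqrt_pos.2 hvpos).ne'
    have h3 : (√(n : ℝ))⁻¹ * √v * ((ψ z - m) / √v) = (√(n : ℝ))⁻¹ * (ψ z - m) := by
      field_simp
    rw [← h3]
    push_cast
    ring

end CentredSum

/-! ### Local behaviour of the empirical score -/

theorem abs_subvec_dotProduct_le {p : ℕ} (E : Finset (Fin p)) (x : Fin p → ℝ) (d : E → ℝ) :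
    |subvec E x ⬝ᵥ d| ≤ E.card * ‖d‖ * ‖x‖ := by
  refine (Finset.abs_sum_le_sum_abs _ _).trans ?_
  have h : ∀ e ∈ (Finset.univ : Finset E), |subvec E x e * d e| ≤ ‖x‖ * ‖d‖ := fun e _ => by
    rw [abs_mul]
    exact mul_le_mul (norm_le_pi_norm x e) (norm_le_pi_norm d e) (abs_nonneg _) (norm_nonneg _)
  refine (Finset.sum_le_card_nsmul _ _ _ h).trans (le_of_eq ?_)
  simp
  ring

theorem measurable_subvec_dotProduct {p : ℕ} (E : Finset (Fin p)) (d : E → ℝ) :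
    Measurable fun x : Fin p → ℝ => subvec E x ⬝ᵥ d := by
  unfold dotProduct subvec
  fun_prop

section

variable {p : ℕ} {F : Measure ((Fin p → ℝ) × ℝ)} [IsProbabilityMeasure F] {l : ℝ}
  {g : (Fin p → ℝ) → ℝ → ℝ}

theorem IsRegularLaw.integrable_of_le (hF : IsRegularLaw F l g) {w : (Fin p → ℝ) → ℝ}
    (hw : Measurable w) {C : ℝ} {r : ℕ} (hC : ∀ x, |w x| ≤ C * ‖x‖ ^ r) :
    Integrable (fun z : (Fin p → ℝ) × ℝ => w z.1) F :=
  ((hF.moments r).const_mul C).mono' (hw.comp measurable_fst).aestronglyMeasurable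
    (.of_forall fun z => hC z.1)

theorem IsRegularLaw.integral_abs_le (hF : IsRegularLaw F l g) {w : (Fin p → ℝ) → ℝ}
    (hw : Measurable w) {C : ℝ} {r : ℕ} (hC : ∀ x, |w x| ≤ C * ‖x‖ ^ r) :
    ∫ z, |w z.1| ∂F ≤ C * ∫ z, ‖z.1‖ ^ r ∂F := by
  rw [← integral_const_mul]
  exact integral_mono (hF.integrable_of_le hw hC).abs ((hF.moments r).const_mul C)
    fun z => hC z.1

theorem IsRegularLaw.const_nonneg (hF : IsRegularLaw F l g) : 0 ≤ l := by
  have : (ae F).NeBot := inferInstance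
  obtain ⟨z, hz⟩ := hF.ae_density.exists
  exact hz.const_nonneg

theorem IsRegularLaw.tendsto_integral_mul_kernel (hF : IsRegularLaw F l g) {K : ℝ → ℝ}
    (hK : IsKernel K) {h : ℕ → ℝ} (hpos : ∀ n, 0 < h n) (h0 : Tendsto h atTop (𝓝 0))
    {E : Finset (Fin p)} {b : ℕ → E → ℝ} {bs : E → ℝ} (hb : Tendsto b atTop (𝓝 bs))
    {w : (Fin p → ℝ) → ℝ} (hw : Measurable w) {C : ℝ} {r : ℕ} (hC : ∀ x, |w x| ≤ C * ‖x‖ ^ r) :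
    Tendsto (fun n => ∫ z, w z.1 * scaledKernel K (h n) (subvec E z.1 ⬝ᵥ b n - z.2) ∂F) atTop
      (𝓝 (∫ z, w z.1 * g z.1 (subvec E z.1 ⬝ᵥ bs) ∂F)) := by
  have hwi := hF.integrable_of_le hw hC
  have hbound : ∀ n x, |(|w x| * |subvec E x ⬝ᵥ b n - subvec E x ⬝ᵥ bs|)|
      ≤ C * (E.card * ‖b n - bs‖) * ‖x‖ ^ (r + 1) := by
    intro n x
    rw [← dotProduct_sub, abs_mul, abs_abs, abs_abs]
    refine (mul_le_mul (hC x) (abs_subvec_dotProduct_le E x _) (abs_nonneg _)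
      ((abs_nonneg _).trans (hC x))).trans (le_of_eq ?_)
    ring
  have hsm := fun d => measurable_subvec_dotProduct E d
  have hmeas : ∀ n, Measurable fun x => |w x| * |subvec E x ⬝ᵥ b n - subvec E x ⬝ᵥ bs| := by
    intro n
    have h1 := hsm (b n)
    have h2 := hsm bs
    fun_prop
  rw [tendsto_iff_dist_tendsto_zero]
  have hlim : Tendsto (fun n => l * (C * (E.card * ‖b n - bs‖) * (∫ z, ‖z.1‖ ^ (r + 1) ∂F)
      + (h n * ∫ v, |v| * K v) * ∫ z, |w z.1| ∂F)) atTop (𝓝 0) := by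
    have e : Tendsto (fun n => ‖b n - bs‖) atTop (𝓝 0) := tendsto_iff_norm_sub_tendsto_zero.1 hb
    have := ((((e.const_mul (E.card : ℝ)).const_mul C).mul_const
      (∫ z, ‖z.1‖ ^ (r + 1) ∂F)).add ((h0.mul_const (∫ v, |v| * K v)).mul_const
      (∫ z, |w z.1| ∂F))).const_mul l
    simpa using this
  refine squeeze_zero (fun _ => dist_nonneg) (fun n => ?_) hlim
  rw [Real.dist_eq]
  refine (hF.abs_integral_kernel_sub_density_le (hK.scaledKernel (hpos n)) (hsm bs) (hsm (b n)) hw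
    hwi (hF.integrable_of_le (hmeas n) (hbound n))).trans ?_
  refine mul_le_mul_of_nonneg_left (add_le_add ?_ ?_) hF.const_nonneg
  · have := hF.integral_abs_le (hmeas n) (hbound n)
    simpa only [abs_mul, abs_abs] using this
  · have := integral_scaledKernel_abs_pow K (hpos n) 1
    simp only [pow_one] at this
    rw [this]

/-- `n^{-1/2} ∑ᵢ w(xᵢ) (G(s(xᵢ) + n^{-1/2} Δ(xᵢ) - yᵢ) - G(s(xᵢ) - yᵢ))`. -/
noncomputable def localIncrement (G : ℝ → ℝ) (s Δ w : (Fin p → ℝ) → ℝ) {n : ℕ} (ω : Sample n p) :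
    ℝ :=
  1 / √(n : ℝ) * ∑ i, w (ω i).1 * (G (s (ω i).1 + Δ (ω i).1 / √(n : ℝ) - (ω i).2)
    - G (s (ω i).1 - (ω i).2))

/-- Split into a centred sum and `√n` times a mean. An increment of `G` is at most one in absolute
value, so its square is at most its absolute value, whose conditional mean is of order `n^{-1/2}`;
the centred sum vanishes. For the mean, the Taylor remainder is `O(1/n)` uniformly in `h`, and the
linear term converges because `K_h` concentrates on the density. -/
theorem IsRegularLaw.tendstoZeroInProb_localIncrement (hF : IsRegularLaw F l g) {K : ℝ → ℝ}
    (hK : IsKernel K) {h : ℕ → ℝ} (hpos : ∀ n, 0 < h n) (h0 : Tendsto h atTop (𝓝 0))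
    {E : Finset (Fin p)} {b : ℕ → E → ℝ} {bs : E → ℝ} (hb : Tendsto b atTop (𝓝 bs))
    {w Δ : (Fin p → ℝ) → ℝ} (hw : Measurable w) (hwb : ∀ x, |w x| ≤ ‖x‖)
    (hΔ : Measurable Δ) {C : ℝ} (hC : ∀ x, |Δ x| ≤ C * ‖x‖) :
    TendstoZeroInProb (sampleLaw F) fun n ω =>
      localIncrement (kernelCdf (scaledKernel K (h n))) (fun x => subvec E x ⬝ᵥ b n) Δ w ω
        - ∫ z, w z.1 * Δ z.1 * g z.1 (subvec E z.1 ⬝ᵥ bs) ∂F := by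
  have hsm := fun d => measurable_subvec_dotProduct E d
  have hk := fun n => hK.scaledKernel (hpos n)
  set s : ℕ → (Fin p → ℝ) → ℝ := fun n x => subvec E x ⬝ᵥ b n with hs
  set s' : ℕ → (Fin p → ℝ) → ℝ := fun n x => s n x + Δ x / √(n : ℝ) with hs'
  have hsn : ∀ n, Measurable (s n) := fun n => hsm (b n)
  have hsn' : ∀ n, Measurable (s' n) := fun n => (hsn n).add (hΔ.div_const _)
  set G : ℕ → ℝ → ℝ := fun n => kernelCdf (scaledKernel K (h n)) with hG
  have hGm : ∀ n, Measurable (G n) := fun n => measurable_kernelCdf (hk n)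
  set ψ : ℕ → (Fin p → ℝ) × ℝ → ℝ := fun n z =>
    w z.1 * (G n (s' n z.1 - z.2) - G n (s n z.1 - z.2)) with hψ
  have hψm : ∀ n, Measurable (ψ n) := by
    intro n
    have h1 := hGm n; have h2 := hsn n; have h3 := hsn' n
    fun_prop
  have hψ1 : ∀ n z, |ψ n z| ≤ ‖z.1‖ := fun n z => by
    rw [abs_mul]
    exact (mul_le_of_le_one_right (abs_nonneg _) (abs_kernelCdf_sub_le_one (hk n) _ _)).trans
      (hwb _)
  have hwi : Integrable (fun z : (Fin p → ℝ) × ℝ => w z.1) F :=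
    hF.integrable_of_le hw (C := 1) (r := 1) fun x => by simpa using hwb x
  have hx2 : ∀ n, MemLp (ψ n) 2 F := fun n => by
    rw [memLp_two_iff_integrable_sq (hψm n).aestronglyMeasurable]
    refine (hF.moments 2).mono' ((hψm n).pow_const 2).aestronglyMeasurable (.of_forall fun z => ?_)
    rw [norm_pow, Real.norm_eq_abs]
    exact pow_le_pow_left₀ (abs_nonneg _) (hψ1 n z) 2
  have hw2 : Integrable (fun z : (Fin p → ℝ) × ℝ => w z.1 ^ 2) F :=
    hF.integrable_of_le (hw.pow_const 2) (C := 1) (r := 2) fun x => by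
      rw [abs_pow, one_mul]; exact pow_le_pow_left₀ (abs_nonneg _) (hwb x) 2
  have hsqrt : Tendsto (fun n : ℕ => (√(n : ℝ))⁻¹) atTop (𝓝 0) :=
    tendsto_inv_atTop_zero.comp (Real.tendsto_sqrt_atTop.comp tendsto_natCast_atTop_atTop)
  have hdiff : ∀ n x, s' n x - s n x = Δ x * (√(n : ℝ))⁻¹ := fun n x => by
    simp only [hs', add_sub_cancel_left, div_eq_mul_inv]
  -- the second moments of the increments vanish
  have hb1 : ∀ n x, |(w x ^ 2 * |s' n x - s n x|)| ≤ C * (√(n : ℝ))⁻¹ * ‖x‖ ^ 3 := fun n x => by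
    rw [hdiff, abs_mul, abs_abs, abs_mul, abs_of_nonneg (inv_nonneg.2 (Real.sqrt_nonneg _)),
      abs_pow]
    have := mul_le_mul (pow_le_pow_left₀ (abs_nonneg _) (hwb x) 2)
      (mul_le_mul_of_nonneg_right (hC x) (inv_nonneg.2 (Real.sqrt_nonneg (n : ℝ))))
      (by positivity) (by positivity)
    refine this.trans (le_of_eq ?_)
    ring
  have hm1 : ∀ n, Measurable fun x => w x ^ 2 * |s' n x - s n x| := fun n => by
    have h2 := hsn n; have h3 := hsn' n
    fun_prop
  have hsq : Tendsto (fun n => ∫ z, ψ n z ^ 2 ∂F) atTop (𝓝 0) := by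
    have hlim : Tendsto (fun n : ℕ => (1 + l) * (C * (√(n : ℝ))⁻¹ * ∫ z, ‖z.1‖ ^ 3 ∂F)) atTop
        (𝓝 0) := by
      simpa using ((hsqrt.const_mul C).mul_const (∫ z, ‖z.1‖ ^ 3 ∂F)).const_mul (1 + l)
    refine squeeze_zero (fun n => integral_nonneg fun z => sq_nonneg _) (fun n => ?_) hlim
    have h1 : ∫ z, ψ n z ^ 2 ∂F
        ≤ ∫ z, w z.1 ^ 2 * |G n (s' n z.1 - z.2) - G n (s n z.1 - z.2)| ∂F := by
      refine integral_mono_of_nonneg (.of_forall fun z => sq_nonneg _) ?_ (.of_forall fun z => ?_)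
      · have h1 := hGm n; have h2 := hsn n; have h3 := hsn' n
        refine hw2.mul_bdd (c := 1) (Measurable.aestronglyMeasurable (by fun_prop))
          (.of_forall fun z => ?_)
        rw [norm_abs_eq_norm]
        exact abs_kernelCdf_sub_le_one (hk n) _ _
      · simp only [hψ, mul_pow]
        refine mul_le_mul_of_nonneg_left ?_ (sq_nonneg _)
        have h4 := abs_kernelCdf_sub_le_one (hk n) (s' n z.1 - z.2) (s n z.1 - z.2)
        rw [← sq_abs]
        nlinarith [abs_nonneg (G n (s' n z.1 - z.2) - G n (s n z.1 - z.2))]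
    refine h1.trans ((hF.integral_mul_abs_kernelCdf_sub_le (hk n) (hsn n) (hsn' n)
      (hw.pow_const 2) (fun x => sq_nonneg _) hw2 (hF.integrable_of_le (hm1 n) (hb1 n))).trans ?_)
    refine mul_le_mul_of_nonneg_left ?_ (by linarith [hF.const_nonneg])
    have h5 := hF.integral_abs_le (hm1 n) (hb1 n)
    refine (integral_mono (hF.integrable_of_le (hm1 n) (hb1 n))
      (hF.integrable_of_le (hm1 n) (hb1 n)).abs fun z => le_abs_self _).trans h5
  -- convergence of the means
  have hCb : ∀ x, |w x * Δ x| ≤ C * ‖x‖ ^ 2 := fun x => by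
    rw [abs_mul]
    refine (mul_le_mul (hwb x) (hC x) (abs_nonneg _) (norm_nonneg _)).trans (le_of_eq ?_)
    ring
  have hmean : Tendsto (fun n : ℕ => √(n : ℝ) * ∫ z, ψ n z ∂F) atTop
      (𝓝 (∫ z, w z.1 * Δ z.1 * g z.1 (subvec E z.1 ⬝ᵥ bs) ∂F)) := by
    have hT := hF.tendsto_integral_mul_kernel hK hpos h0 hb (hw.mul hΔ) hCb
    have hb2 : ∀ n x, |(|w x| * (s' n x - s n x) ^ 2)| ≤ C ^ 2 * (√(n : ℝ))⁻¹ ^ 2 * ‖x‖ ^ 3 := by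
      intro n x
      rw [hdiff, abs_mul, abs_abs, abs_pow, abs_mul,
        abs_of_nonneg (inv_nonneg.2 (Real.sqrt_nonneg (n : ℝ))), mul_pow]
      have := mul_le_mul (hwb x) (mul_le_mul_of_nonneg_right (pow_le_pow_left₀ (abs_nonneg _)
        (hC x) 2) (sq_nonneg (√(n : ℝ))⁻¹)) (by positivity) (by positivity)
      refine this.trans (le_of_eq ?_)
      ring
    have hm2 : ∀ n, Measurable fun x => |w x| * (s' n x - s n x) ^ 2 := fun n => by
      have h2 := hsn n; have h3 := hsn' n
      fun_prop
    have hdist : Tendsto (fun n : ℕ => √(n : ℝ) * (∫ z, ψ n z ∂F)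
        - ∫ z, w z.1 * Δ z.1 * scaledKernel K (h n) (subvec E z.1 ⬝ᵥ b n - z.2) ∂F) atTop
        (𝓝 0) := by
      have hlim : Tendsto (fun n : ℕ => l * (C ^ 2 * (√(n : ℝ))⁻¹ * ∫ z, ‖z.1‖ ^ 3 ∂F)) atTop
          (𝓝 0) := by
        simpa using ((hsqrt.const_mul (C ^ 2)).mul_const (∫ z, ‖z.1‖ ^ 3 ∂F)).const_mul l
      refine squeeze_zero_norm' ?_ hlim
      filter_upwards [eventually_gt_atTop 0] with n hn
      have hn' : 0 < √(n : ℝ) := Real.sqrt_pos.2 (by exact_mod_cast hn)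
      have h1 := hF.abs_integral_kernelCdf_taylor (hk n) (hsn n) (hsn' n) hw hwi
        (hF.integrable_of_le (hm2 n) (hb2 n))
      have h2 := hF.integral_abs_le (hm2 n) (hb2 n)
      have e1 : ∫ z, ψ n z ∂F = (∫ z, w z.1 * G n (s' n z.1 - z.2) ∂F)
          - ∫ z, w z.1 * G n (s n z.1 - z.2) ∂F := by
        rw [← integral_sub (integrable_mul_kernelCdf (hk n) (hsn' n) hwi)
          (integrable_mul_kernelCdf (hk n) (hsn n) hwi)]
        simp only [hψ, mul_sub, hG]
      have e2 : ∫ z, w z.1 * Δ z.1 * scaledKernel K (h n) (subvec E z.1 ⬝ᵥ b n - z.2) ∂F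
          = √(n : ℝ) * ∫ z, w z.1 * (s' n z.1 - s n z.1)
            * scaledKernel K (h n) (s n z.1 - z.2) ∂F := by
        rw [← integral_const_mul]
        refine integral_congr_ae (.of_forall fun z => ?_)
        simp only
        rw [hdiff]
        simp only [hs]
        field_simp
      rw [e1, e2, ← mul_sub, norm_mul, Real.norm_eq_abs, Real.norm_eq_abs, abs_of_pos hn']
      have h3 : ∫ z, |w z.1| * (s' n z.1 - s n z.1) ^ 2 ∂F
          ≤ C ^ 2 * (√(n : ℝ))⁻¹ ^ 2 * ∫ z, ‖z.1‖ ^ 3 ∂F := by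
        refine le_trans (le_of_eq (integral_congr_ae (.of_forall fun z => ?_))) h2
        simp only [abs_mul, abs_abs, abs_of_nonneg (sq_nonneg (s' n z.1 - s n z.1))]
      refine (mul_le_mul_of_nonneg_left (h1.trans (mul_le_mul_of_nonneg_left h3
        hF.const_nonneg)) hn'.le).trans (le_of_eq ?_)
      field_simp
    have := hdist.add hT
    simpa using this
  have hdecomp : ∀ n (ω : Sample n p), localIncrement (G n) (s n) Δ w ω
      = centredSum F (ψ n) ω + √(n : ℝ) * ∫ z, ψ n z ∂F := by
    intro n ω
    simp only [localIncrement, centredSum, Finset.sum_sub_distrib, Finset.sum_const,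
      Finset.card_univ, Fintype.card_fin, nsmul_eq_mul, mul_sub, hψ, hs']
    have : 1 / √(n : ℝ) * ((n : ℝ) * ∫ z, ψ n z ∂F) = √(n : ℝ) * ∫ z, ψ n z ∂F := by
      rw [← mul_assoc, one_div_mul_eq_div, Real.div_sqrt]
    simp only [hψ, hs', mul_sub] at this
    rw [this]
    ring
  have hfin := (tendstoZeroInProb_centredSum hx2 hsq).add
    (tendstoZeroInProb_of_tendsto (P := sampleLaw F) (tendsto_sub_nhds_zero_iff.2 hmean))
  refine hfin.congr (.of_forall fun n => .of_forall fun ω => ?_)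
  rw [hdecomp]
  ring

/-- Local asymptotic linearity of the weighted increments, uniformly over compact sets. -/
theorem IsRegularLaw.tendsto_measure_localIncrement_of_nonneg (hF : IsRegularLaw F l g) {K : ℝ → ℝ}
    (hK : IsKernel K) {h : ℕ → ℝ} (hpos : ∀ n, 0 < h n) (h0 : Tendsto h atTop (𝓝 0))
    {E : Finset (Fin p)} {b : ℕ → E → ℝ} {bs : E → ℝ} (hb : Tendsto b atTop (𝓝 bs))
    {w : (Fin p → ℝ) → ℝ} (hw : Measurable w) (hw0 : ∀ x, 0 ≤ w x) (hwb : ∀ x, |w x| ≤ ‖x‖)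
    (M : ℝ) {ε : ℝ} (hε : 0 < ε) :
    Tendsto (fun n => sampleLaw F n {ω | ∃ t : E → ℝ, ‖t‖ ≤ M ∧
      ε ≤ |localIncrement (kernelCdf (scaledKernel K (h n))) (fun x => subvec E x ⬝ᵥ b n)
        (fun x => subvec E x ⬝ᵥ t) w ω
        - ∫ z, w z.1 * (subvec E z.1 ⬝ᵥ t) * g z.1 (subvec E z.1 ⬝ᵥ bs) ∂F|}) atTop (𝓝 0) := by
  have hsm := fun d => measurable_subvec_dotProduct E d
  set q : ℝ := (E.card : ℝ) with hq
  have hq0 : 0 ≤ q := Nat.cast_nonneg _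
  set D := ∫ z, w z.1 * ‖z.1‖ * g z.1 (subvec E z.1 ⬝ᵥ bs) ∂F with hD
  set L : (E → ℝ) → ℝ := fun t =>
    ∫ z, w z.1 * (subvec E z.1 ⬝ᵥ t) * g z.1 (subvec E z.1 ⬝ᵥ bs) ∂F with hL
  have hD0 : 0 ≤ D := integral_nonneg_of_ae (by
    filter_upwards [hF.ae_density] with z hz
    exact mul_nonneg (mul_nonneg (hw0 _) (norm_nonneg _)) (hz.nonneg _))
  have hiD : Integrable (fun z => w z.1 * ‖z.1‖ * g z.1 (subvec E z.1 ⬝ᵥ bs)) F :=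
    hF.integrable_mul_density (w := fun x => w x * ‖x‖) (hsm bs)
      (hF.integrable_of_le (w := fun x => w x * ‖x‖) (by fun_prop) (C := 1) (r := 2) fun x => by
        rw [abs_mul, abs_norm, one_mul, sq]
        exact mul_le_mul_of_nonneg_right (hwb x) (norm_nonneg _))
  have hiL : ∀ t, Integrable (fun z =>
      w z.1 * (subvec E z.1 ⬝ᵥ t) * g z.1 (subvec E z.1 ⬝ᵥ bs)) F := fun t =>
    hF.integrable_mul_density (w := fun x => w x * (subvec E x ⬝ᵥ t)) (hsm bs)
      (hF.integrable_of_le (w := fun x => w x * (subvec E x ⬝ᵥ t)) (hw.mul (hsm t))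
        (C := q * ‖t‖) (r := 2) fun x => by
        rw [abs_mul]
        refine (mul_le_mul (hwb x) (abs_subvec_dotProduct_le E x t) (abs_nonneg _)
          (norm_nonneg _)).trans (le_of_eq (by ring)))
  have hLadd : ∀ t δ, ∫ z, w z.1 * (subvec E z.1 ⬝ᵥ t + δ * ‖z.1‖) * g z.1 (subvec E z.1 ⬝ᵥ bs) ∂F
      = L t + δ * D := by
    intro t δ
    rw [hL, hD, ← integral_const_mul, ← integral_add (hiL t) (hiD.const_mul δ)]
    refine integral_congr_ae (.of_forall fun z => ?_)
    simp only
    ring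
  have hLlip : ∀ t t', |L t' - L t| ≤ q * ‖t' - t‖ * D := by
    intro t t'
    rw [hL, hD, ← integral_sub (hiL t') (hiL t), ← integral_const_mul, ← Real.norm_eq_abs]
    refine norm_integral_le_of_norm_le (hiD.const_mul _) ?_
    filter_upwards [hF.ae_density] with z hz
    rw [← sub_mul, ← mul_sub, ← dotProduct_sub, Real.norm_eq_abs, abs_mul, abs_mul,
      abs_of_nonneg (hw0 _), abs_of_nonneg (hz.nonneg _), ← mul_assoc]
    refine mul_le_mul_of_nonneg_right ?_ (hz.nonneg _)
    refine (mul_le_mul_of_nonneg_left (abs_subvec_dotProduct_le E z.1 _) (hw0 _)).trans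
      (le_of_eq (by ring))
  -- Moving from `t'` to the net point `t` changes the limit by at most `q η D`, and the bracket of
  -- half-width `q η ‖x‖` changes it by `q η D` once more. The two together must fit into `ε / 2`.
  set η := ε / (4 * (q * D + 1)) with hη
  have hη0 : 0 < η := by positivity
  have hηD : 2 * (q * η * D) ≤ ε / 2 := by
    have : η * (4 * (q * D + 1)) = ε := by rw [hη]; field_simp
    nlinarith
  obtain ⟨S, -, hSf, hS⟩ := (isCompact_closedBall (0 : E → ℝ) M).finite_cover_balls hη0
  -- The brackets `x_E · t ± δ ‖x‖` dominate `x_E · t'` for every `t'` in the ball around `t`. As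
  -- `G` is monotone and `w ≥ 0`, the increments are sandwiched, and uniformity needs only finitely
  -- many fixed directions.
  set T : ∀ n, (E → ℝ) → ℝ → Sample n p → ℝ := fun n t δ ω =>
    localIncrement (kernelCdf (scaledKernel K (h n))) (fun x => subvec E x ⬝ᵥ b n)
        (fun x => subvec E x ⬝ᵥ t + δ * ‖x‖) w ω with hT
  have hTlim : ∀ t δ, TendstoZeroInProb (sampleLaw F) fun n ω => T n t δ ω - (L t + δ * D) := by
    intro t δ
    rw [← hLadd]
    refine hF.tendstoZeroInProb_localIncrement hK hpos h0 hb hw hwb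
      (by have := hsm t; fun_prop) (C := q * ‖t‖ + |δ|) fun x => ?_
    refine (abs_add_le _ _).trans ?_
    rw [add_mul, abs_mul, abs_norm]
    exact add_le_add (abs_subvec_dotProduct_le E x t) le_rfl
  have hmono : ∀ n t t' δ (ω : Sample n p), ‖t' - t‖ ≤ η → q * η ≤ δ →
      T n t (-δ) ω ≤ T n t' 0 ω ∧ T n t' 0 ω ≤ T n t δ ω := by
    intro n t t' δ ω htt hδ
    have hG := monotone_kernelCdf (hK.scaledKernel (hpos n))
    have hx : ∀ x : Fin p → ℝ, |subvec E x ⬝ᵥ t' - subvec E x ⬝ᵥ t| ≤ δ * ‖x‖ := fun x => by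
      rw [← dotProduct_sub]
      refine (abs_subvec_dotProduct_le E x _).trans (mul_le_mul_of_nonneg_right ?_ (norm_nonneg _))
      exact (mul_le_mul_of_nonneg_left htt hq0).trans hδ
    simp only [hT, localIncrement]
    constructor <;>
    · refine mul_le_mul_of_nonneg_left (Finset.sum_le_sum fun i _ => mul_le_mul_of_nonneg_left
        (sub_le_sub_right (hG ?_) _) (hw0 _)) (by positivity)
      have := abs_le.1 (hx (ω i).1)
      refine sub_le_sub_right (add_le_add le_rfl
        (div_le_div_of_nonneg_right ?_ (Real.sqrt_nonneg _))) _
      linarith [this.1, this.2]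
  have hlim : Tendsto (fun n => ∑ t ∈ hSf.toFinset,
      (sampleLaw F n {ω | ε / 2 ≤ |T n t (q * η) ω - (L t + q * η * D)|}
        + sampleLaw F n {ω | ε / 2 ≤ |T n t (-(q * η)) ω - (L t + -(q * η) * D)|})) atTop (𝓝 0) := by
    have := tendsto_finsetSum hSf.toFinset fun t _ =>
      (hTlim t (q * η) (ε / 2) (by positivity)).add (hTlim t (-(q * η)) (ε / 2) (by positivity))
    simpa using this
  refine tendsto_of_tendsto_of_tendsto_of_le_of_le tendsto_const_nhds hlim (fun _ => zero_le)
    fun n => ?_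
  refine le_trans (measure_mono ?_) ((measure_biUnion_finset_le hSf.toFinset fun t =>
      {ω | ε / 2 ≤ |T n t (q * η) ω - (L t + q * η * D)|}
        ∪ {ω | ε / 2 ≤ |T n t (-(q * η)) ω - (L t + -(q * η) * D)|}).trans
    (Finset.sum_le_sum fun t _ => measure_union_le _ _))
  rintro ω ⟨t', ht', hω⟩
  have h1 : t' ∈ Metric.closedBall (0 : E → ℝ) M := by simpa using ht'
  obtain ⟨t, htS, htt⟩ := Set.mem_iUnion₂.1 (hS h1)
  have htt' : ‖t' - t‖ ≤ η := by
    rw [Metric.mem_ball, dist_eq_norm] at htt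
    exact htt.le
  simp only [Set.mem_iUnion, Set.mem_union, Set.mem_ofPred_eq, Set.Finite.mem_toFinset]
  refine ⟨t, htS, ?_⟩
  by_contra! hcon
  obtain ⟨hm1, hm2⟩ := hmono n t t' (q * η) ω htt' le_rfl
  have hT0 : T n t' 0 ω = localIncrement (kernelCdf (scaledKernel K (h n)))
      (fun x => subvec E x ⬝ᵥ b n) (fun x => subvec E x ⬝ᵥ t') w ω := by simp [hT]
  rw [← hT0] at hω
  have h2 := abs_le.1 (hLlip t t')
  have h3 := abs_lt.1 hcon.1
  have h4 := abs_lt.1 hcon.2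
  have h5 : q * ‖t' - t‖ * D ≤ q * η * D := by gcongr
  have h6 : |T n t' 0 ω - L t'| < ε := by
    rw [abs_lt]
    constructor <;> nlinarith [h2.1, h2.2, h3.1, h3.2, h4.1, h4.2]
  exact absurd hω (not_le.2 h6)

/-- Bracketing needs a nonnegative weight, so the coordinate `x a` is split into its positive and
negative parts. -/
theorem IsRegularLaw.tendsto_measure_localIncrement (hF : IsRegularLaw F l g) {K : ℝ → ℝ}
    (hK : IsKernel K) {h : ℕ → ℝ} (hpos : ∀ n, 0 < h n) (h0 : Tendsto h atTop (𝓝 0))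
    {E : Finset (Fin p)} {b : ℕ → E → ℝ} {bs : E → ℝ} (hb : Tendsto b atTop (𝓝 bs))
    (a : Fin p) (M : ℝ) {ε : ℝ} (hε : 0 < ε) :
    Tendsto (fun n => sampleLaw F n {ω | ∃ t : E → ℝ, ‖t‖ ≤ M ∧
      ε ≤ |localIncrement (kernelCdf (scaledKernel K (h n))) (fun x => subvec E x ⬝ᵥ b n)
        (fun x => subvec E x ⬝ᵥ t) (fun x => x a) ω
        - ∫ z, z.1 a * (subvec E z.1 ⬝ᵥ t) * g z.1 (subvec E z.1 ⬝ᵥ bs) ∂F|}) atTop (𝓝 0) := by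
  have hsm := fun d => measurable_subvec_dotProduct E d
  have hb1 : ∀ x : Fin p → ℝ, |max (x a) 0| ≤ ‖x‖ := fun x => by
    rw [abs_of_nonneg (le_max_right _ _)]
    exact max_le ((le_abs_self _).trans (norm_le_pi_norm x a)) (norm_nonneg _)
  have hb2 : ∀ x : Fin p → ℝ, |max (-x a) 0| ≤ ‖x‖ := fun x => by
    rw [abs_of_nonneg (le_max_right _ _)]
    exact max_le ((neg_le_abs _).trans (norm_le_pi_norm x a)) (norm_nonneg _)
  have h1 := hF.tendsto_measure_localIncrement_of_nonneg hK hpos h0 hb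
    (w := fun x => max (x a) 0) (by fun_prop) (fun x => le_max_right _ _) hb1 M (half_pos hε)
  have h2 := hF.tendsto_measure_localIncrement_of_nonneg hK hpos h0 hb
    (w := fun x => max (-x a) 0) (by fun_prop) (fun x => le_max_right _ _) hb2 M (half_pos hε)
  have h3 := h1.add h2
  rw [add_zero] at h3
  refine tendsto_of_tendsto_of_tendsto_of_le_of_le tendsto_const_nhds h3 (fun _ => zero_le)
    fun n => le_trans (measure_mono ?_) (measure_union_le _ _)
  rintro ω ⟨t, ht, hω⟩
  have hi : ∀ {w : (Fin p → ℝ) → ℝ}, Measurable w → (∀ x, |w x| ≤ ‖x‖) → Integrable (fun z =>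
      w z.1 * (subvec E z.1 ⬝ᵥ t) * g z.1 (subvec E z.1 ⬝ᵥ bs)) F := fun {w} hw hwb =>
    hF.integrable_mul_density (w := fun x => w x * (subvec E x ⬝ᵥ t)) (hsm bs)
      (hF.integrable_of_le (w := fun x => w x * (subvec E x ⬝ᵥ t)) (hw.mul (hsm t))
        (C := E.card * ‖t‖) (r := 2) fun x => by
        rw [abs_mul]
        refine (mul_le_mul (hwb x) (abs_subvec_dotProduct_le E x t) (abs_nonneg _)
          (norm_nonneg _)).trans (le_of_eq (by ring)))
  have hpm : ∀ r : ℝ, max r 0 - max (-r) 0 = r := fun r => by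
    rcases le_total r 0 with hr | hr
    · rw [max_eq_right hr, max_eq_left (by linarith)]; ring
    · rw [max_eq_left hr, max_eq_right (by linarith)]; ring
  have e1 : ∫ z, z.1 a * (subvec E z.1 ⬝ᵥ t) * g z.1 (subvec E z.1 ⬝ᵥ bs) ∂F
      = (∫ z, max (z.1 a) 0 * (subvec E z.1 ⬝ᵥ t) * g z.1 (subvec E z.1 ⬝ᵥ bs) ∂F)
      - ∫ z, max (-z.1 a) 0 * (subvec E z.1 ⬝ᵥ t) * g z.1 (subvec E z.1 ⬝ᵥ bs) ∂F := by
    rw [← integral_sub (hi (w := fun x => max (x a) 0) (by fun_prop) hb1)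
      (hi (w := fun x => max (-x a) 0) (by fun_prop) hb2)]
    refine integral_congr_ae (.of_forall fun z => ?_)
    simp only
    rw [← sub_mul, ← sub_mul, hpm]
  have e2 : ∀ (G : ℝ → ℝ) (s Δ : (Fin p → ℝ) → ℝ), localIncrement G s Δ (fun x => x a) ω
      = localIncrement G s Δ (fun x => max (x a) 0) ω
        - localIncrement G s Δ (fun x => max (-x a) 0) ω := fun G s Δ => by
    simp only [localIncrement, ← mul_sub, ← Finset.sum_sub_distrib, ← sub_mul, hpm]
  rw [e1, e2] at hω
  simp only [Set.mem_union, Set.mem_ofPred_eq]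
  by_contra! hcon
  have h5 := hcon.1 t ht
  have h6 := hcon.2 t ht
  refine absurd hω (not_le.2 ?_)
  rw [abs_lt] at h5 h6 ⊢
  constructor <;> linarith [h5.1, h5.2, h6.1, h6.2]

/-- Local asymptotic linearity along a stochastically bounded sequence. -/
theorem IsRegularLaw.tendstoZeroInProb_localIncrement_random (hF : IsRegularLaw F l g) {K : ℝ → ℝ}
    (hK : IsKernel K) {h : ℕ → ℝ} (hpos : ∀ n, 0 < h n) (h0 : Tendsto h atTop (𝓝 0))
    {E : Finset (Fin p)} {b : ℕ → E → ℝ} {bs : E → ℝ} (hb : Tendsto b atTop (𝓝 bs))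
    (a : Fin p) {t : ∀ n, Sample n p → E → ℝ}
    (ht : BoundedInProb (sampleLaw F) fun n ω => ‖t n ω‖) :
    TendstoZeroInProb (sampleLaw F) fun n ω =>
      localIncrement (kernelCdf (scaledKernel K (h n))) (fun x => subvec E x ⬝ᵥ b n)
        (fun x => subvec E x ⬝ᵥ t n ω) (fun x => x a) ω
        - ∫ z, z.1 a * (subvec E z.1 ⬝ᵥ t n ω) * g z.1 (subvec E z.1 ⬝ᵥ bs) ∂F := by
  intro ε hε
  rw [ENNReal.tendsto_nhds_zero]
  intro δ hδ
  obtain ⟨M, hM⟩ := ht (δ / 2) (ENNReal.half_pos hδ.ne')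
  have h1 := ENNReal.tendsto_nhds_zero.1
    (hF.tendsto_measure_localIncrement hK hpos h0 hb a M hε) (δ / 2) (ENNReal.half_pos hδ.ne')
  filter_upwards [hM, h1] with n h2 h3
  refine (measure_mono fun ω hω => ?_).trans ((measure_union_le _ _).trans
    ((add_le_add h2 h3).trans (ENNReal.add_halves δ).le))
  simp only [Set.mem_union, Set.mem_ofPred_eq, abs_norm] at hω ⊢
  rcases le_total M ‖t n ω‖ with h4 | h4
  · exact Or.inl h4
  · exact Or.inr ⟨t n ω, h4, hω⟩

end

/-! ### Sums of functions of independent observations -/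

section SampleSums

variable {α : Type*} [MeasurableSpace α] {F : Measure α} [IsProbabilityMeasure F]

theorem integral_pi_eval {φ : α → ℝ} (hφ : Integrable φ F) {n : ℕ} (i : Fin n) :
    Integrable (fun ω : Fin n → α => φ (ω i)) (Measure.pi fun _ => F) ∧
      ∫ ω : Fin n → α, φ (ω i) ∂(Measure.pi fun _ => F) = ∫ z, φ z ∂F := by
  have hev := measurePreserving_eval (fun _ : Fin n => F) i
  refine ⟨hev.integrable_comp_of_integrable hφ, ?_⟩
  have h1 := integral_map (μ := Measure.pi fun _ : Fin n => F) (φ := Function.eval i)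
    (f := φ) hev.measurable.aemeasurable (by rw [hev.map_eq]; exact hφ.1)
  rw [hev.map_eq] at h1
  exact h1.symm

theorem integral_pi_sum {φ : α → ℝ} (hφ : Integrable φ F) (n : ℕ) :
    ∫ ω : Fin n → α, ∑ i, φ (ω i) ∂(Measure.pi fun _ => F) = n * ∫ z, φ z ∂F := by
  rw [integral_finsetSum (f := fun (i : Fin n) (ω : Fin n → α) => φ (ω i)) _
    fun i _ => (integral_pi_eval hφ i).1]
  simp [(integral_pi_eval hφ _).2]

theorem covariance_pi_sum {φ ψ : α → ℝ} (hφ : MemLp φ 2 F) (hψ : MemLp ψ 2 F) (n : ℕ) :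
    cov[fun ω : Fin n → α => ∑ i, φ (ω i), fun ω => ∑ i, ψ (ω i); Measure.pi fun _ => F]
      = n * cov[φ, ψ; F] := by
  have hev := fun i => measurePreserving_eval (fun _ : Fin n => F) i
  rw [covariance_fun_sum_fun_sum (X := fun (i : Fin n) (ω : Fin n → α) => φ (ω i))
    (Y := fun (i : Fin n) (ω : Fin n → α) => ψ (ω i))
    (fun i => hφ.comp_measurePreserving (hev i)) (fun i => hψ.comp_measurePreserving (hev i))]
  have h1 : ∀ i k : Fin n, cov[fun ω : Fin n → α => φ (ω i), fun ω => ψ (ω k);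
      Measure.pi fun _ => F] = if k = i then cov[φ, ψ; F] else 0 := by
    intro i k
    split_ifs with hik
    · subst hik
      have := covariance_map (μ := Measure.pi fun _ : Fin n => F) (Z := Function.eval k)
        (X := φ) (Y := ψ) (by rw [(hev k).map_eq]; exact hφ.1) (by rw [(hev k).map_eq]; exact hψ.1)
        (hev k).measurable.aemeasurable
      rw [(hev k).map_eq] at this
      exact this.symm
    -- Two different functions at two different indices are placed in one family, to which
    -- independence under a product measure applies.
    · set X : Fin n → α → ℝ := fun m => if m = i then φ else ψ with hX
      have hXm : ∀ m, AEMeasurable (X m) F := fun m => by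
        simp only [hX]; split_ifs
        exacts [hφ.1.aemeasurable, hψ.1.aemeasurable]
      have hind := (iIndepFun_pi (μ := fun _ : Fin n => F) hXm).indepFun (Ne.symm hik)
      have e1 : X i = φ := by simp [hX]
      have e2 : X k = ψ := by simp [hX, hik]
      rw [e1, e2] at hind
      exact hind.covariance_eq_zero (hφ.comp_measurePreserving (hev i))
        (hψ.comp_measurePreserving (hev k))
  simp only [h1]
  simp

end SampleSums

/-! ### First order conditions -/

/-- The limit of the smoothed step functions. -/
noncomputable def stepFn (t : ℝ) : ℝ := if 0 < t then 1 else 0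

theorem measurable_stepFn : Measurable stepFn :=
  Measurable.ite measurableSet_Ioi measurable_const measurable_const

section

variable {p : ℕ} {F : Measure ((Fin p → ℝ) × ℝ)} [IsProbabilityMeasure F] {l : ℝ}
  {g : (Fin p → ℝ) → ℝ → ℝ}

/-- The expected sample loss is a positive multiple of the expected loss of one observation, so a
minimizer of the former minimizes the latter along each coordinate line. -/
theorem IsRegularLaw.integral_mul_deriv_eq_zero (hF : IsRegularLaw F l g)
    (hy : Integrable (fun z : (Fin p → ℝ) × ℝ => z.2) F) {L L' : ℝ → ℝ}
    (hL : ∀ s t, |L s - L t| ≤ |s - t|) (hL' : Measurable L') {E : Finset (Fin p)} {b : E → ℝ}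
    (hd : ∀ᵐ z ∂F, HasDerivAt L (L' (subvec E z.1 ⬝ᵥ b - z.2)) (subvec E z.1 ⬝ᵥ b - z.2)) {n : ℕ}
    (hn : 0 < n) {c : ℝ} (hc : 0 < c)
    (hmin : IsMinOn (fun b' : E → ℝ => ∫ ω : Sample n p, c * ∑ i,
      L (subvec E (ω i).1 ⬝ᵥ b' - (ω i).2) ∂(sampleLaw F n)) Set.univ b) (a : E) :
    ∫ z, z.1 a * L' (subvec E z.1 ⬝ᵥ b - z.2) ∂F = 0 := by
  have hsm := fun d => measurable_subvec_dotProduct E d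
  have hLc : Continuous L := by
    have : LipschitzWith (Real.toNNReal 1) L := LipschitzWith.of_dist_le' fun x y => by
      simpa [Real.dist_eq] using hL x y
    exact this.continuous
  have hx : ∀ d : E → ℝ, Integrable (fun z : (Fin p → ℝ) × ℝ => subvec E z.1 ⬝ᵥ d) F := fun d =>
    hF.integrable_of_le (hsm d) (C := E.card * ‖d‖) (r := 1) fun x => by
      simpa using abs_subvec_dotProduct_le E x d
  have hi : ∀ b' : E → ℝ, Integrable
      (fun z : (Fin p → ℝ) × ℝ => L (subvec E z.1 ⬝ᵥ b' - z.2)) F := by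
    intro b'
    refine (((hx b').sub hy).abs.add (integrable_const |L 0|)).mono'
      (hLc.measurable.comp (((hsm b').comp measurable_fst).sub
        measurable_snd)).aestronglyMeasurable (.of_forall fun z => ?_)
    have := hL (subvec E z.1 ⬝ᵥ b' - z.2) 0
    rw [sub_zero] at this
    simp only [Real.norm_eq_abs, Pi.add_apply, Pi.sub_apply]
    linarith [abs_sub_abs_le_abs_sub (L (subvec E z.1 ⬝ᵥ b' - z.2)) (L 0)]
  have hn' : (0 : ℝ) < n := by exact_mod_cast hn
  refine integral_mul_deriv_eq_zero_of_isMinOn hL hL' (c := fun z : (Fin p → ℝ) × ℝ => z.1 a)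
    (t := fun z => subvec E z.1 ⬝ᵥ b - z.2)
    (hF.integrable_of_le (w := fun x => x a) (by fun_prop) (C := 1) (r := 1) fun x => by
      simpa using norm_le_pi_norm x a)
    (((hx b).1).sub hy.1) (hi b) hd fun s => ?_
  have h1 := hmin (Set.mem_univ (b + s • Pi.single a 1))
  simp only [Set.mem_ofPred_eq] at h1
  rw [integral_const_mul, integral_const_mul, integral_pi_sum (hi b), integral_pi_sum (hi _)] at h1
  have h2 := le_of_mul_le_mul_left (le_of_mul_le_mul_left h1 hc) hn'
  refine h2.trans (le_of_eq (integral_congr_ae (.of_forall fun z => ?_)))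
  simp only
  rw [dotProduct_add, dotProduct_smul, dotProduct_single_one]
  congr 1
  simp only [subvec, smul_eq_mul]
  ring

theorem IsRegularLaw.integral_obsScore_eq_zero_of_isTarget (hF : IsRegularLaw F l g)
    (hy : Integrable (fun z : (Fin p → ℝ) × ℝ => z.2) F) {τ : ℝ} (hτ : τ ∈ Set.Ioo (0 : ℝ) 1)
    {E : Finset (Fin p)} {b : E → ℝ} (hb : IsTarget F τ 1 E b) (a : E) :
    ∫ z, obsScore stepFn τ E b a z ∂F = 0 := by
  refine hF.integral_mul_deriv_eq_zero hy (L := fun t => checkLoss τ (0 - t))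
    (L' := fun t => stepFn t - τ) (fun s t => ?_) (measurable_stepFn.sub_const τ) ?_ one_pos
    (c := 1 / √((1 : ℕ) : ℝ)) (by simp) ?_ a
  · refine (abs_checkLoss_sub_le hτ _ _).trans (le_of_eq ?_)
    rw [sub_sub_sub_cancel_left, abs_sub_comm]
  -- The kink of the check loss is hit with probability zero because `y` has a conditional density.
  · filter_upwards [hF.ae_sub_notMem (measurable_subvec_dotProduct E b)
      (N := {0}) (measure_singleton _)] with z hz
    exact hasDerivAt_checkLoss_sub τ (Ne.symm hz)
  · have := hb
    unfold IsTarget at this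
    simp only [designOn_mulVec, response] at this
    simpa only [zero_sub, neg_sub] using this

theorem IsRegularLaw.integral_obsScore_eq_zero_of_isPseudoParameter (hF : IsRegularLaw F l g)
    (hy : Integrable (fun z : (Fin p → ℝ) × ℝ => z.2) F) {K : ℝ → ℝ} (hK : IsKernel K) {τ : ℝ}
    (hτ : τ ∈ Set.Ioo (0 : ℝ) 1) {h : ℝ} (hh : 0 < h) {n : ℕ} (hn : 0 < n)
    {E : Finset (Fin p)} {b : E → ℝ} (hb : IsPseudoParameter F K τ h n E b) (a : E) :
    ∫ z, obsScore (kernelCdf (scaledKernel K h)) τ E b a z ∂F = 0 := by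
  have hn' : (0 : ℝ) < n := by exact_mod_cast hn
  refine hF.integral_mul_deriv_eq_zero hy (L := smoothCheck (scaledKernel K h) τ)
    (L' := fun t => kernelCdf (scaledKernel K h) t - τ)
    (abs_smoothCheck_sub_le (hK.scaledKernel hh) hτ)
    ((measurable_kernelCdf (hK.scaledKernel hh)).sub_const τ)
    (.of_forall fun z => hasDerivAt_smoothCheck (hK.scaledKernel hh) hτ _) hn
    (c := √(n : ℝ) * (1 / (n : ℝ))) (by positivity) ?_ a
  have := hb
  unfold IsPseudoParameter at this
  simpa only [smoothedLoss_eq, designOn_mulVec, response, ← mul_assoc] using this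

/-! ### `J` and `H` in terms of one observation -/

theorem abs_obsScore_le {G : ℝ → ℝ} (hG0 : ∀ t, 0 ≤ G t) (hG1 : ∀ t, G t ≤ 1) {τ : ℝ}
    (hτ : τ ∈ Set.Ioo (0 : ℝ) 1) (E : Finset (Fin p)) (b : E → ℝ) (a : Fin p)
    (z : (Fin p → ℝ) × ℝ) : |obsScore G τ E b a z| ≤ ‖z.1‖ := by
  rw [obsScore, abs_mul]
  refine (mul_le_of_le_one_right (abs_nonneg _) ?_).trans (norm_le_pi_norm z.1 a)
  rw [abs_le]
  constructor <;> linarith [hτ.1, hτ.2, hG0 (subvec E z.1 ⬝ᵥ b - z.2),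
    hG1 (subvec E z.1 ⬝ᵥ b - z.2)]

theorem measurable_obsScore {G : ℝ → ℝ} (hG : Measurable G) (τ : ℝ) (E : Finset (Fin p))
    (b : E → ℝ) (a : Fin p) : Measurable (obsScore G τ E b a) := by
  have := measurable_subvec_dotProduct E b
  exact ((measurable_pi_apply a).comp measurable_fst).mul
    ((hG.comp ((this.comp measurable_fst).sub measurable_snd)).sub_const τ)

theorem IsRegularLaw.memLp_obsScore (hF : IsRegularLaw F l g) {G : ℝ → ℝ} (hG : Measurable G)
    (hG0 : ∀ t, 0 ≤ G t) (hG1 : ∀ t, G t ≤ 1) {τ : ℝ} (hτ : τ ∈ Set.Ioo (0 : ℝ) 1)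
    (E : Finset (Fin p)) (b : E → ℝ) (a : Fin p) : MemLp (obsScore G τ E b a) 2 F := by
  have hm := measurable_obsScore hG τ E b a
  rw [memLp_two_iff_integrable_sq hm.aestronglyMeasurable]
  refine (hF.moments 2).mono' (hm.pow_const 2).aestronglyMeasurable (.of_forall fun z => ?_)
  rw [norm_pow, Real.norm_eq_abs]
  exact pow_le_pow_left₀ (abs_nonneg _) (abs_obsScore_le hG0 hG1 hτ E b a z) 2

theorem stepFn_nonneg (t : ℝ) : 0 ≤ stepFn t := by unfold stepFn; split_ifs <;> simp

theorem stepFn_le_one (t : ℝ) : stepFn t ≤ 1 := by unfold stepFn; split_ifs <;> simp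

theorem IsRegularLaw.ae_hasDerivAt_kernelCdf (hF : IsRegularLaw F l g) {k : ℝ → ℝ}
    (hk : IsKernel k) (n : ℕ) (E : Finset (Fin p)) (b : E → ℝ) :
    ∀ᵐ ω ∂(sampleLaw F n), ∀ i, HasDerivAt (kernelCdf k)
      (k (subvec E (ω i).1 ⬝ᵥ b - (ω i).2)) (subvec E (ω i).1 ⬝ᵥ b - (ω i).2) := by
  rw [ae_all_iff]
  intro i
  have h1 := hF.ae_sub_notMem (measurable_subvec_dotProduct E b)
    (N := {t | ¬ HasDerivAt (kernelCdf k) (k t) t}) (SQR.ae_hasDerivAt_kernelCdf hk)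
  have h2 := (Measure.quasiMeasurePreserving_eval (fun _ : Fin n => F) i).ae h1
  filter_upwards [h2] with ω hω
  exact not_not.1 hω

/-- `fderiv` returns a default value where `kernelCdf` is not differentiable, but almost surely no
residual falls there, so the expectation does not see it. -/
theorem IsRegularLaw.matJ_eq (hF : IsRegularLaw F l g) {K : ℝ → ℝ} (hK : IsKernel K) {τ : ℝ}
    (hτ : τ ∈ Set.Ioo (0 : ℝ) 1) {h : ℝ} (hh : 0 < h) {n : ℕ} (hn : 0 < n) (E : Finset (Fin p))
    (b : E → ℝ) (a c : Fin p) :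
    matJ F K τ h n E b a c
      = ∫ z, z.1 a * z.1 c * scaledKernel K h (subvec E z.1 ⬝ᵥ b - z.2) ∂F := by
  have hn' : (n : ℝ) ≠ 0 := by positivity
  have hi : Integrable (fun z : (Fin p → ℝ) × ℝ =>
      z.1 a * z.1 c * scaledKernel K h (subvec E z.1 ⬝ᵥ b - z.2)) F :=
    hF.integrable_mul_kernel (hK.scaledKernel hh) (w := fun x => x a * x c)
      (s := fun x => subvec E x ⬝ᵥ b) (measurable_subvec_dotProduct E b) (by fun_prop)
      (hF.integrable_of_le (w := fun x => x a * x c) (by fun_prop) (C := 1) (r := 2) fun x => by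
        rw [abs_mul, one_mul, sq]
        exact mul_le_mul (norm_le_pi_norm x a) (norm_le_pi_norm x c) (abs_nonneg _) (norm_nonneg _))
  have e : matJ F K τ h n E b a c = ∫ ω : Sample n p, 1 / (n : ℝ) * ∑ i, (ω i).1 a * (ω i).1 c *
          scaledKernel K h (subvec E (ω i).1 ⬝ᵥ b - (ω i).2) ∂(sampleLaw F n) := by
    rw [matJ, Matrix.of_apply]
    refine integral_congr_ae ?_
    filter_upwards [hF.ae_hasDerivAt_kernelCdf (hK.scaledKernel hh) n E b] with ω hω
    exact design_hess_design hK hτ hh E b ω hω a c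
  rw [e, integral_const_mul, integral_pi_sum hi, ← mul_assoc, one_div_mul_cancel hn', one_mul]

theorem IsRegularLaw.integral_score (hF : IsRegularLaw F l g) {K : ℝ → ℝ} (hK : IsKernel K) {τ : ℝ}
    (hτ : τ ∈ Set.Ioo (0 : ℝ) 1) {h : ℝ} (hh : 0 < h) {n : ℕ} (hn : 0 < n) (E : Finset (Fin p))
    (b : E → ℝ) (a : Fin p) :
    ∫ ω : Sample n p, score K τ h E b ω a ∂(sampleLaw F n)
      = ∫ z, obsScore (kernelCdf (scaledKernel K h)) τ E b a z ∂F := by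
  have hn' : (n : ℝ) ≠ 0 := by positivity
  have hk := hK.scaledKernel hh
  have hm := (hF.memLp_obsScore (measurable_kernelCdf hk) (kernelCdf_nonneg hk)
    (kernelCdf_le_one hk) hτ E b a).integrable one_le_two
  simp_rw [score_eq hK hτ hh]
  rw [integral_const_mul, integral_pi_sum hm]
  field_simp

theorem IsRegularLaw.matH_eq (hF : IsRegularLaw F l g) {K : ℝ → ℝ} (hK : IsKernel K) {τ : ℝ}
    (hτ : τ ∈ Set.Ioo (0 : ℝ) 1) {h : ℝ} (hh : 0 < h) {n : ℕ} (hn : 0 < n) (E : Finset (Fin p))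
    (b : E → ℝ) (a c : Fin p) :
    matH F K τ h n E b a c
      = cov[obsScore (kernelCdf (scaledKernel K h)) τ E b a,
          obsScore (kernelCdf (scaledKernel K h)) τ E b c; F] := by
  have hn' : (0 : ℝ) < n := by positivity
  have hk := hK.scaledKernel hh
  have hm := fun a => hF.memLp_obsScore (measurable_kernelCdf hk) (kernelCdf_nonneg hk)
    (kernelCdf_le_one hk) hτ E b a
  simp only [matH, Matrix.of_apply]
  simp_rw [score_eq hK hτ hh, ← mul_assoc]
  rw [covariance_const_mul_left, covariance_const_mul_right, covariance_pi_sum (hm a) (hm c),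
    ← mul_assoc, ← mul_assoc]
  have : √(n : ℝ) * (1 / n) * (√(n : ℝ) * (1 / n)) * n = 1 := by
    have := Real.mul_self_sqrt hn'.le
    field_simp
    rw [sq, this]
  rw [this, one_mul]

/-! ### Limits of `J` and `H` -/

/-- The limit of `J`. -/
noncomputable def limJ (F : Measure ((Fin p → ℝ) × ℝ)) (g : (Fin p → ℝ) → ℝ → ℝ)
    (E : Finset (Fin p)) (b : E → ℝ) : Matrix (Fin p) (Fin p) ℝ :=
  Matrix.of fun a c => ∫ z, z.1 a * z.1 c * g z.1 (subvec E z.1 ⬝ᵥ b) ∂F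

/-- The limit of `H`. -/
noncomputable def limH (F : Measure ((Fin p → ℝ) × ℝ)) (τ : ℝ)
    (E : Finset (Fin p)) (b : E → ℝ) : Matrix (Fin p) (Fin p) ℝ :=
  Matrix.of fun a c => cov[obsScore stepFn τ E b a, obsScore stepFn τ E b c; F]

theorem IsRegularLaw.tendsto_matJ (hF : IsRegularLaw F l g) {K : ℝ → ℝ} (hK : IsKernel K) {τ : ℝ}
    (hτ : τ ∈ Set.Ioo (0 : ℝ) 1) {h : ℕ → ℝ} (hpos : ∀ n, 0 < h n) (h0 : Tendsto h atTop (𝓝 0))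
    {E : Finset (Fin p)} {b : ℕ → E → ℝ} {bs : E → ℝ} (hb : Tendsto b atTop (𝓝 bs)) :
    Tendsto (fun n => matJ F K τ (h n) n E (b n)) atTop (𝓝 (limJ F g E bs)) := by
  refine tendsto_pi_nhds.2 fun a => tendsto_pi_nhds.2 fun c => ?_
  have := hF.tendsto_integral_mul_kernel hK hpos h0 hb (w := fun x => x a * x c) (by fun_prop)
    (C := 1) (r := 2) fun x => by
        rw [abs_mul, one_mul, sq]
        exact mul_le_mul (norm_le_pi_norm x a) (norm_le_pi_norm x c) (abs_nonneg _) (norm_nonneg _)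
  refine this.congr' ?_
  filter_upwards [eventually_gt_atTop 0] with n hn
  rw [hF.matJ_eq hK hτ (hpos n) hn]

/-- Off a null event the limiting residual is nonzero, so the residual divided by `h n` escapes to
plus or minus infinity according to its sign. -/
theorem IsRegularLaw.ae_tendsto_kernelCdf (hF : IsRegularLaw F l g) {K : ℝ → ℝ} (hK : IsKernel K)
    {h : ℕ → ℝ} (hpos : ∀ n, 0 < h n) (h0 : Tendsto h atTop (𝓝 0))
    {E : Finset (Fin p)} {b : ℕ → E → ℝ} {bs : E → ℝ} (hb : Tendsto b atTop (𝓝 bs)) :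
    ∀ᵐ z ∂F, Tendsto (fun n => kernelCdf (scaledKernel K (h n)) (subvec E z.1 ⬝ᵥ b n - z.2)) atTop
      (𝓝 (stepFn (subvec E z.1 ⬝ᵥ bs - z.2))) := by
  filter_upwards [hF.ae_sub_notMem (measurable_subvec_dotProduct E bs)
      (N := {0}) (measure_singleton _)] with z hz
  have hz' : subvec E z.1 ⬝ᵥ bs - z.2 ≠ 0 := hz
  have hinv : Tendsto (fun n => (h n)⁻¹) atTop atTop :=
    tendsto_inv_nhdsGT_zero.comp (tendsto_nhdsWithin_iff.2 ⟨h0, .of_forall hpos⟩)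
  have ht : Tendsto (fun n => subvec E z.1 ⬝ᵥ b n - z.2) atTop
      (𝓝 (subvec E z.1 ⬝ᵥ bs - z.2)) := by
    refine Tendsto.sub_const ?_ _
    have hc : Continuous fun d : E → ℝ => subvec E z.1 ⬝ᵥ d := by
      unfold dotProduct; fun_prop
    exact (hc.tendsto bs).comp hb
  simp_rw [fun n => kernelCdf_scaledKernel K (hpos n), div_eq_mul_inv]
  rcases lt_or_gt_of_ne hz' with hlt | hgt
  · rw [stepFn, if_neg (not_lt.2 hlt.le)]
    exact (tendsto_kernelCdf_atBot hK).comp (ht.neg_mul_atTop hlt hinv)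
  · rw [stepFn, if_pos hgt]
    exact (tendsto_kernelCdf_atTop hK).comp (ht.pos_mul_atTop hgt hinv)

theorem IsRegularLaw.ae_tendsto_obsScore (hF : IsRegularLaw F l g) {K : ℝ → ℝ} (hK : IsKernel K)
    (τ : ℝ) {h : ℕ → ℝ} (hpos : ∀ n, 0 < h n) (h0 : Tendsto h atTop (𝓝 0))
    {E : Finset (Fin p)} {b : ℕ → E → ℝ} {bs : E → ℝ} (hb : Tendsto b atTop (𝓝 bs)) :
    ∀ᵐ z ∂F, ∀ a, Tendsto (fun n => obsScore (kernelCdf (scaledKernel K (h n))) τ E (b n) a z) atTop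
      (𝓝 (obsScore stepFn τ E bs a z)) := by
  filter_upwards [hF.ae_tendsto_kernelCdf hK hpos h0 hb] with z hz a
  exact (hz.sub_const τ).const_mul (z.1 a)

theorem IsRegularLaw.tendsto_matH (hF : IsRegularLaw F l g) {K : ℝ → ℝ} (hK : IsKernel K) {τ : ℝ}
    (hτ : τ ∈ Set.Ioo (0 : ℝ) 1) {h : ℕ → ℝ} (hpos : ∀ n, 0 < h n) (h0 : Tendsto h atTop (𝓝 0))
    {E : Finset (Fin p)} {b : ℕ → E → ℝ} {bs : E → ℝ} (hb : Tendsto b atTop (𝓝 bs)) :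
    Tendsto (fun n => matH F K τ (h n) n E (b n)) atTop (𝓝 (limH F τ E bs)) := by
  refine tendsto_pi_nhds.2 fun a => tendsto_pi_nhds.2 fun c => ?_
  have hk := fun n => hK.scaledKernel (hpos n)
  have hm := fun n a => hF.memLp_obsScore (measurable_kernelCdf (hk n)) (kernelCdf_nonneg (hk n))
    (kernelCdf_le_one (hk n)) hτ E (b n) a
  have hm0 := fun a => hF.memLp_obsScore measurable_stepFn stepFn_nonneg stepFn_le_one hτ E bs a
  have hbd := fun n a z => abs_obsScore_le (kernelCdf_nonneg (hk n))
    (kernelCdf_le_one (hk n)) hτ E (b n) a z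
  have hae := hF.ae_tendsto_obsScore hK τ hpos h0 hb
  have h1 : ∀ a, Tendsto (fun n => ∫ z, obsScore (kernelCdf (scaledKernel K (h n))) τ E (b n) a z ∂F)
      atTop (𝓝 (∫ z, obsScore stepFn τ E bs a z ∂F)) := fun a =>
    tendsto_integral_of_dominated_convergence (fun z => ‖z.1‖) (fun n => (hm n a).1)
      (by simpa using hF.moments 1) (fun n => .of_forall fun z => hbd n a z)
      (hae.mono fun z hz => hz a)
  have h2 : Tendsto (fun n => ∫ z, obsScore (kernelCdf (scaledKernel K (h n))) τ E (b n) a z *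
      obsScore (kernelCdf (scaledKernel K (h n))) τ E (b n) c z ∂F)
      atTop (𝓝 (∫ z, obsScore stepFn τ E bs a z * obsScore stepFn τ E bs c z ∂F)) :=
    tendsto_integral_of_dominated_convergence (fun z => ‖z.1‖ ^ 2)
      (fun n => (hm n a).1.mul (hm n c).1) (hF.moments 2) (fun n => .of_forall fun z => by
        rw [norm_mul, sq]
        exact mul_le_mul (hbd n a z) (hbd n c z) (norm_nonneg _) (norm_nonneg _))
      (hae.mono fun z hz => (hz a).mul (hz c))
  have e0 : limH F τ E bs a c = (∫ z, obsScore stepFn τ E bs a z * obsScore stepFn τ E bs c z ∂F)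
      - (∫ z, obsScore stepFn τ E bs a z ∂F) * ∫ z, obsScore stepFn τ E bs c z ∂F :=
    covariance_eq_sub (hm0 a) (hm0 c)
  rw [e0]
  refine (h2.sub ((h1 a).mul (h1 c))).congr' ?_
  filter_upwards [eventually_gt_atTop 0] with n hn
  rw [hF.matH_eq hK hτ (hpos n) hn, covariance_eq_sub (hm n a) (hm n c)]
  rfl

/-! ### Localization of zeros of monotone maps and the pseudo-parameter -/

/-- A zero of a map which is monotone along rays and points outward on the sphere of radius `r`
has norm less than `r`. -/
theorem norm_lt_of_ray_monotone {ι : Type*} [Fintype ι] {S : (ι → ℝ) → ι → ℝ}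
    (hmono : ∀ d : ι → ℝ, Monotone fun s : ℝ => d ⬝ᵥ S (s • d)) {r : ℝ} (hr : 0 < r)
    (hpos : ∀ t : ι → ℝ, ‖t‖ = r → 0 < t ⬝ᵥ S t) {t₀ : ι → ℝ} (h0 : S t₀ = 0) : ‖t₀‖ < r := by
  by_contra! hle
  have ht0 : 0 < ‖t₀‖ := hr.trans_le hle
  -- A zero outside the sphere is compared with its radial projection onto it. Monotonicity makes
  -- the radial component there at most zero, against `hpos`.
  have h1 := hmono t₀ ((div_le_one ht0).2 hle)
  simp only [one_smul, h0, dotProduct_zero] at h1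
  have h2 := hpos ((r / ‖t₀‖) • t₀) (by
    rw [norm_smul, Real.norm_of_nonneg (by positivity), div_mul_cancel₀ _ ht0.ne'])
  rw [smul_dotProduct, smul_eq_mul] at h2
  have h3 : 0 < r / ‖t₀‖ := by positivity
  nlinarith

theorem sq_norm_le_dotProduct {ι : Type*} [Fintype ι] (t : ι → ℝ) : ‖t‖ ^ 2 ≤ t ⬝ᵥ t := by
  rcases isEmpty_or_nonempty ι with hι | hι
  · have : t = 0 := Subsingleton.elim _ _
    simp [this]
  · obtain ⟨a, ha⟩ := Finite.exists_max fun a => |t a|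
    have h4 : ‖t‖ ≤ |t a| := (pi_norm_le_iff_of_nonneg (abs_nonneg _)).2 ha
    have h5 : t a * t a ≤ t ⬝ᵥ t :=
      Finset.single_le_sum (f := fun a => t a * t a) (fun _ _ => mul_self_nonneg _)
        (Finset.mem_univ a)
    calc ‖t‖ ^ 2 ≤ |t a| ^ 2 := pow_le_pow_left₀ (norm_nonneg _) h4 2
      _ = t a * t a := by rw [sq_abs, sq]
      _ ≤ _ := h5

theorem dotProduct_sum_obsScore (G : ℝ → ℝ) (τ : ℝ) (E : Finset (Fin p)) (b d : E → ℝ)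
    (z : (Fin p → ℝ) × ℝ) : (∑ a : E, d a * obsScore G τ E b a z)
      = (subvec E z.1 ⬝ᵥ d) * (G (subvec E z.1 ⬝ᵥ b - z.2) - τ) := by
  simp only [obsScore, dotProduct, subvec, Finset.sum_mul]
  exact Finset.sum_congr rfl fun a _ => by ring

/-- The slope `c` appears both inside and outside `G`, so its sign cancels. This is the convexity of
the loss along a line, seen on its derivative. -/
theorem monotone_mul_comp_ray {G : ℝ → ℝ} (hG : Monotone G) (τ c t : ℝ) :
    Monotone fun s : ℝ => c * (G (t + s * c) - τ) := by
  intro s s' hs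
  simp only
  rcases le_total 0 c with hc | hc
  · exact mul_le_mul_of_nonneg_left (sub_le_sub_right (hG (by nlinarith)) _) hc
  · exact mul_le_mul_of_nonpos_left (sub_le_sub_right (hG (by nlinarith)) _) hc

theorem IsRegularLaw.curvature (hF : IsRegularLaw F l g) {K : ℝ → ℝ} (hK : IsKernel K) {h : ℝ}
    (hh : 0 < h) {E : Finset (Fin p)} {b : E → ℝ} {m : ℝ} (hB : CurvatureBound F K h E b m)
    (t : E → ℝ) :
    m * (t ⬝ᵥ t)
      ≤ ∫ z, (subvec E z.1 ⬝ᵥ t) ^ 2 * scaledKernel K h (subvec E z.1 ⬝ᵥ b - z.2) ∂F := by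
  have hk := hK.scaledKernel hh
  have h1 := Matrix.PosSemidef.dotProduct_mulVec_nonneg hB t
  rw [Matrix.sub_mulVec, dotProduct_sub, star_trivial, Matrix.smul_mulVec, Matrix.one_mulVec,
    dotProduct_smul, smul_eq_mul] at h1
  have hi : ∀ a c : E, Integrable (fun z : (Fin p → ℝ) × ℝ =>
      scaledKernel K h (z.2 - subvec E z.1 ⬝ᵥ b) * (z.1 a * z.1 c)) F := fun a c => by
    have := hF.integrable_mul_kernel hk (w := fun x => x a * x c)
      (measurable_subvec_dotProduct E b) (by fun_prop)
      (hF.integrable_of_le (w := fun x => x a * x c) (by fun_prop) (C := 1) (r := 2) fun x => by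
        rw [abs_mul, one_mul, sq]
        exact mul_le_mul (norm_le_pi_norm x a) (norm_le_pi_norm x c) (abs_nonneg _) (norm_nonneg _))
    refine this.congr (.of_forall fun z => ?_)
    simp only
    rw [← hk.symm (z.2 - _), neg_sub, mul_comm]
  have e : t ⬝ᵥ ((Matrix.of fun a c : E =>
      ∫ z, scaledKernel K h (z.2 - subvec E z.1 ⬝ᵥ b) * (z.1 a * z.1 c) ∂F) *ᵥ t)
      = ∫ z, (subvec E z.1 ⬝ᵥ t) ^ 2 * scaledKernel K h (subvec E z.1 ⬝ᵥ b - z.2) ∂F := by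
    simp only [Matrix.mulVec, dotProduct, Matrix.of_apply, Finset.mul_sum]
    have e1 : ∀ a c : E, t a * ((∫ z, scaledKernel K h (z.2 - subvec E z.1 ⬝ᵥ b) *
        (z.1 a * z.1 c) ∂F) * t c) = ∫ z, t a * (scaledKernel K h (z.2 - subvec E z.1 ⬝ᵥ b) *
        (z.1 a * z.1 c) * t c) ∂F := fun a c => by
      rw [integral_const_mul, integral_mul_const]
    simp only [dotProduct] at e1
    simp_rw [e1]
    have hi' := fun a c => ((hi a c).mul_const (t c)).const_mul (t a)
    simp only [dotProduct] at hi'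
    simp_rw [← integral_finsetSum Finset.univ fun c _ => hi' _ c]
    rw [← integral_finsetSum Finset.univ fun a _ => integrable_finsetSum _ fun c _ => hi' a c]
    refine integral_congr_ae (.of_forall fun z => ?_)
    simp only
    rw [← hk.symm (z.2 - _), neg_sub, sq, Finset.sum_mul_sum, Finset.sum_mul]
    refine Finset.sum_congr rfl fun a _ => ?_
    rw [Finset.sum_mul]
    refine Finset.sum_congr rfl fun c _ => ?_
    simp only [subvec]
    ring
  rw [e] at h1
  linarith

end

theorem abs_dotProduct_le {ι : Type*} [Fintype ι] (t v : ι → ℝ) {c : ℝ} (hc : ∀ a, |v a| ≤ c) :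
    |t ⬝ᵥ v| ≤ Fintype.card ι * ‖t‖ * c := by
  refine (Finset.abs_sum_le_sum_abs _ _).trans ?_
  have h : ∀ e ∈ (Finset.univ : Finset ι), |t e * v e| ≤ ‖t‖ * c := fun e _ => by
    rw [abs_mul]
    exact mul_le_mul (norm_le_pi_norm t e) (hc e) (abs_nonneg _) (norm_nonneg _)
  refine (Finset.sum_le_card_nsmul _ _ _ h).trans (le_of_eq ?_)
  simp
  ring

section

variable {p : ℕ} {F : Measure ((Fin p → ℝ) × ℝ)} [IsProbabilityMeasure F] {l : ℝ}
  {g : (Fin p → ℝ) → ℝ → ℝ}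

/-! ### The smoothing bias of the pseudo-parameter -/

theorem IsRegularLaw.integral_dotProduct_obsScore (hF : IsRegularLaw F l g) {G : ℝ → ℝ}
    (hG : Measurable G) (hG0 : ∀ t, 0 ≤ G t) (hG1 : ∀ t, G t ≤ 1) {τ : ℝ}
    (hτ : τ ∈ Set.Ioo (0 : ℝ) 1) (E : Finset (Fin p)) (b d : E → ℝ) :
    (d ⬝ᵥ fun a : E => ∫ z, obsScore G τ E b a z ∂F)
      = ∫ z, (subvec E z.1 ⬝ᵥ d) * (G (subvec E z.1 ⬝ᵥ b - z.2) - τ) ∂F := by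
  have hi : ∀ a : E, Integrable (fun z => d a * obsScore G τ E b a z) F := fun a =>
    ((hF.memLp_obsScore hG hG0 hG1 hτ E b a).integrable one_le_two).const_mul _
  simp_rw [← dotProduct_sum_obsScore]
  rw [integral_finsetSum _ fun a _ => hi a]
  simp only [dotProduct, integral_const_mul]

/-- On the sphere of radius `r` about `bs`, the radial component of the smoothed population score is
at least `m r²` from curvature, minus a cubic Taylor remainder, minus a smoothing bias of order `r
h²`. Hypothesis `hm`, multiplied by `r`, says this is positive, so the zero `b` lies inside by ray
monotonicity. -/
theorem IsRegularLaw.norm_sub_lt_of_curvature (hF : IsRegularLaw F l g) {K : ℝ → ℝ}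
    (hK : IsKernel K) {τ : ℝ} (hτ : τ ∈ Set.Ioo (0 : ℝ) 1) {h : ℝ} (hh : 0 < h)
    {E : Finset (Fin p)} {bs b : E → ℝ} (hbs : ∀ a : E, ∫ z, obsScore stepFn τ E bs a z ∂F = 0)
    {m : ℝ} (hB : CurvatureBound F K h E bs m)
    (hb : ∀ a : E, ∫ z, obsScore (kernelCdf (scaledKernel K h)) τ E b a z ∂F = 0) {r : ℝ}
    (hr : 0 < r)
    (hm : l * (E.card : ℝ) ^ 3 * (∫ z, ‖z.1‖ ^ 3 ∂F) * r ^ 2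
      + l * (∫ v, |v| ^ 2 * K v) * E.card * (∫ z, ‖z.1‖ ^ 1 ∂F) * h ^ 2 < m * r) :
    ‖b - bs‖ < r := by
  have hk := hK.scaledKernel hh
  -- The left side of `hm` is nonnegative, so a negative `m` would contradict it.
  have hm0 : 0 ≤ m := by
    by_contra! hneg
    have h1 : 0 ≤ l * (E.card : ℝ) ^ 3 * (∫ z, ‖z.1‖ ^ 3 ∂F) * r ^ 2 :=
      mul_nonneg (mul_nonneg (mul_nonneg hF.const_nonneg (by positivity))
        (integral_nonneg fun z => by positivity)) (sq_nonneg _)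
    have h2 : 0 ≤ l * (∫ v, |v| ^ 2 * K v) * E.card * (∫ z, ‖z.1‖ ^ 1 ∂F) * h ^ 2 :=
      mul_nonneg (mul_nonneg (mul_nonneg (mul_nonneg hF.const_nonneg
        (integral_nonneg fun v => mul_nonneg (by positivity) (hK.nonneg v))) (by positivity))
        (integral_nonneg fun z => by positivity)) (sq_nonneg _)
    nlinarith
  set G := kernelCdf (scaledKernel K h) with hG
  have hGm : Measurable G := measurable_kernelCdf hk
  have hsm := fun d => measurable_subvec_dotProduct E d
  have hx : ∀ d : E → ℝ, Integrable (fun z : (Fin p → ℝ) × ℝ => subvec E z.1 ⬝ᵥ d) F := fun d =>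
    hF.integrable_of_le (hsm d) (C := E.card * ‖d‖) (r := 1) fun x => by
      simpa using abs_subvec_dotProduct_le E x d
  have hGi : ∀ d t : E → ℝ, Integrable (fun z : (Fin p → ℝ) × ℝ =>
      (subvec E z.1 ⬝ᵥ d) * G (subvec E z.1 ⬝ᵥ t - z.2)) F := fun d t =>
    integrable_mul_kernelCdf hk (w := fun x => subvec E x ⬝ᵥ d) (s := fun x => subvec E x ⬝ᵥ t)
      (hsm t) (hx d)
  set S : (E → ℝ) → E → ℝ := fun d a => ∫ z, obsScore G τ E (bs + d) a z ∂F with hS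
  have hdS : ∀ d t : E → ℝ, d ⬝ᵥ S t
      = ∫ z, (subvec E z.1 ⬝ᵥ d) * (G (subvec E z.1 ⬝ᵥ (bs + t) - z.2) - τ) ∂F := fun d t =>
    hF.integral_dotProduct_obsScore hGm (kernelCdf_nonneg hk) (kernelCdf_le_one hk) hτ E (bs + t) d
  have hGi' : ∀ d t : E → ℝ, Integrable (fun z : (Fin p → ℝ) × ℝ =>
      (subvec E z.1 ⬝ᵥ d) * (G (subvec E z.1 ⬝ᵥ t - z.2) - τ)) F := fun d t => by
    simp_rw [mul_sub]
    exact (hGi d t).sub ((hx d).mul_const τ)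
  refine norm_lt_of_ray_monotone (S := S) (fun d s s' hs => ?_) hr (fun d hd => ?_) ?_
  · simp only [hdS]
    refine integral_mono (hGi' d _) (hGi' d _) fun z => ?_
    have := monotone_mul_comp_ray (monotone_kernelCdf hk) τ (subvec E z.1 ⬝ᵥ d)
      (subvec E z.1 ⬝ᵥ bs - z.2) hs
    simp only [dotProduct_add, dotProduct_smul, smul_eq_mul]
    refine le_trans (le_of_eq ?_) (this.trans (le_of_eq ?_))
    · simp only [hG]; congr 3; ring
    · simp only [hG]; congr 3; ring
  · rw [hdS]
    have hbd1 : ∀ x : Fin p → ℝ, |subvec E x ⬝ᵥ d| ≤ E.card * r * ‖x‖ ^ 1 := fun x => by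
      have := abs_subvec_dotProduct_le E x d
      rwa [hd, ← pow_one ‖x‖] at this
    have hbd3 : ∀ x : Fin p → ℝ, |(|subvec E x ⬝ᵥ d| * (subvec E x ⬝ᵥ (bs + d)
        - subvec E x ⬝ᵥ bs) ^ 2)| ≤ (E.card * r) ^ 3 * ‖x‖ ^ 3 := fun x => by
      rw [← dotProduct_sub, add_sub_cancel_left, abs_mul, abs_abs, abs_pow, ← pow_succ', ← mul_pow]
      refine pow_le_pow_left₀ (abs_nonneg _) ?_ 3
      simpa using hbd1 x
    have hm3 : Measurable fun x : Fin p → ℝ => |subvec E x ⬝ᵥ d| * (subvec E x ⬝ᵥ (bs + d)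
        - subvec E x ⬝ᵥ bs) ^ 2 := by
      have h1 := hsm d; have h2 := hsm bs; have h3 := hsm (bs + d)
      fun_prop
    have hT := hF.abs_integral_kernelCdf_taylor hk (s := fun x => subvec E x ⬝ᵥ bs)
      (s' := fun x => subvec E x ⬝ᵥ (bs + d)) (w := fun x => subvec E x ⬝ᵥ d) (hsm bs)
      (hsm (bs + d)) (hsm d) (hx d) (hF.integrable_of_le hm3 hbd3)
    have hT2 : ∫ z, |subvec E z.1 ⬝ᵥ d| * (subvec E z.1 ⬝ᵥ (bs + d) - subvec E z.1 ⬝ᵥ bs) ^ 2 ∂F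
        ≤ (E.card * r) ^ 3 * ∫ z, ‖z.1‖ ^ 3 ∂F :=
      (integral_mono (hF.integrable_of_le hm3 hbd3) (hF.integrable_of_le hm3 hbd3).abs
        fun z => le_abs_self _).trans (hF.integral_abs_le hm3 hbd3)
    have hBias := hF.abs_integral_kernelCdf_bias_le hk (s := fun x => subvec E x ⬝ᵥ bs)
      (w := fun x => subvec E x ⬝ᵥ d) (hsm bs) (hsm d) (hx d)
    have hB2 := hF.integral_abs_le (hsm d) hbd1
    rw [integral_scaledKernel_abs_pow K hh 2] at hBias
    have hcurv := hF.curvature hK hh hB d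
    have hsq := sq_norm_le_dotProduct d
    have hzero := hF.integral_dotProduct_obsScore measurable_stepFn stepFn_nonneg stepFn_le_one hτ
      E bs d
    -- The unsmoothed score vanishes at `bs`, so `τ` can be traded for the step function and only
    -- the smoothing bias remains at `bs`.
    simp_rw [hbs] at hzero
    have hstep : Integrable (fun z : (Fin p → ℝ) × ℝ =>
        (subvec E z.1 ⬝ᵥ d) * stepFn (subvec E z.1 ⬝ᵥ bs - z.2)) F :=
      (hx d).mul_bdd (c := 1) (measurable_stepFn.comp
        (((hsm bs).comp measurable_fst).sub measurable_snd)).aestronglyMeasurable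
        (.of_forall fun z => by
          rw [Real.norm_of_nonneg (stepFn_nonneg _)]; exact stepFn_le_one _)
    have hz0 : (∫ z, (subvec E z.1 ⬝ᵥ d) * stepFn (subvec E z.1 ⬝ᵥ bs - z.2) ∂F)
        = ∫ z, (subvec E z.1 ⬝ᵥ d) * τ ∂F := by
      have : (d ⬝ᵥ fun _ : E => (0 : ℝ)) = 0 := by simp [dotProduct]
      rw [this] at hzero
      simp_rw [mul_sub] at hzero
      rw [integral_sub hstep ((hx d).mul_const τ)] at hzero
      linarith
    have e1 : ∫ z, (subvec E z.1 ⬝ᵥ d) * (G (subvec E z.1 ⬝ᵥ (bs + d) - z.2) - τ) ∂F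
        = (∫ z, (subvec E z.1 ⬝ᵥ d) * G (subvec E z.1 ⬝ᵥ (bs + d) - z.2) ∂F)
          - ∫ z, (subvec E z.1 ⬝ᵥ d) * τ ∂F := by
      simp_rw [mul_sub]
      exact integral_sub (hGi _ _) ((hx d).mul_const τ)
    have e2 : ∫ z, (subvec E z.1 ⬝ᵥ d) * (subvec E z.1 ⬝ᵥ (bs + d) - subvec E z.1 ⬝ᵥ bs)
          * scaledKernel K h (subvec E z.1 ⬝ᵥ bs - z.2) ∂F
        = ∫ z, (subvec E z.1 ⬝ᵥ d) ^ 2 * scaledKernel K h (subvec E z.1 ⬝ᵥ bs - z.2) ∂F := by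
      refine integral_congr_ae (.of_forall fun z => ?_)
      simp only
      rw [← dotProduct_sub, add_sub_cancel_left, ← sq]
    rw [e2] at hT
    rw [e1, ← hz0]
    have h1 := (abs_le.1 hT).1
    have h2 := (abs_le.1 hBias).1
    rw [hd] at hsq
    have hl := hF.const_nonneg
    have hκ : 0 ≤ ∫ v, |v| ^ 2 * K v :=
      integral_nonneg fun v => mul_nonneg (by positivity) (hK.nonneg v)
    have h3 := mul_le_mul_of_nonneg_left hT2 hl
    have h4 := mul_le_mul_of_nonneg_left hB2 (mul_nonneg hl (mul_nonneg (sq_nonneg h) hκ))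
    have h5 := mul_le_mul_of_nonneg_left hsq hm0
    have h6 := mul_lt_mul_of_pos_left hm hr
    simp only [stepFn] at h2 ⊢
    simp only [hG] at *
    nlinarith [h1, h2, h3, h4, h5, h6, hcurv]
  · funext a
    simp only [hS, add_sub_cancel]
    exact hb a

theorem IsRegularLaw.exists_norm_pseudoParameter_sub_le (hF : IsRegularLaw F l g)
    (hy : Integrable (fun z : (Fin p → ℝ) × ℝ => z.2) F) {K : ℝ → ℝ}
    (hK : IsKernel K) {τ : ℝ} (hτ : τ ∈ Set.Ioo (0 : ℝ) 1) {h : ℕ → ℝ} (hpos : ∀ n, 0 < h n)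
    (h0 : Tendsto h atTop (𝓝 0)) {E : Finset (Fin p)} {bs : E → ℝ} (hbs : IsTarget F τ 1 E bs)
    {m : ℝ} (hm : 0 < m) (hB : ∀ n, CurvatureBound F K (h n) E bs m) {b : ℕ → E → ℝ}
    (hb : ∀ n, IsPseudoParameter F K τ (h n) n E (b n)) :
    ∃ C, ∀ᶠ n in atTop, ‖b n - bs‖ ≤ C * h n ^ 2 := by
  set c1 := l * (∫ v, |v| ^ 2 * K v) * E.card * (∫ z, ‖z.1‖ ^ 1 ∂F) with hc1
  set c3 := l * (E.card : ℝ) ^ 3 * (∫ z, ‖z.1‖ ^ 3 ∂F) with hc3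
  have hc10 : 0 ≤ c1 :=
    mul_nonneg (mul_nonneg (mul_nonneg hF.const_nonneg
      (integral_nonneg fun v => mul_nonneg (by positivity) (hK.nonneg v))) (by positivity))
      (integral_nonneg fun z => by positivity)
  -- With `r = C h²` the right side of the radius condition is `(c1 + 1) h²`. The bias uses up `c1
  -- h²`, and the remaining `h²` absorbs the remainder `c3 C² h⁴` once `h` is small.
  set C := (c1 + 1) / m with hC
  have hC0 : 0 < C := by positivity
  refine ⟨C, ?_⟩
  have hsmall : Tendsto (fun n => c3 * C ^ 2 * h n ^ 2) atTop (𝓝 0) := by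
    simpa using (h0.pow 2).const_mul (c3 * C ^ 2)
  filter_upwards [eventually_gt_atTop 0, (tendsto_order.1 hsmall).2 1 one_pos] with n hn hlt
  have hh := hpos n
  refine (hF.norm_sub_lt_of_curvature hK hτ hh
    (hF.integral_obsScore_eq_zero_of_isTarget hy hτ hbs) (hB n)
    (hF.integral_obsScore_eq_zero_of_isPseudoParameter hy hK hτ hh hn (hb n))
    (r := C * h n ^ 2) (by positivity) ?_).le
  rw [← hc1, ← hc3]
  have e : m * (C * h n ^ 2) = (c1 + 1) * h n ^ 2 := by rw [hC]; field_simp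
  rw [e]
  have h2 : 0 < h n ^ 2 := by positivity
  nlinarith

/-- The curvature bounds are available at each bandwidth with the same `m`, and pass to the limit as
the kernel concentrates. This is what makes the limit of `J_{E,E}` positive definite. -/
theorem IsRegularLaw.curvature_limit (hF : IsRegularLaw F l g) {K : ℝ → ℝ} (hK : IsKernel K)
    {h : ℕ → ℝ} (hpos : ∀ n, 0 < h n) (h0 : Tendsto h atTop (𝓝 0)) {E : Finset (Fin p)}
    {bs : E → ℝ} {m : ℝ} (hB : ∀ n, CurvatureBound F K (h n) E bs m) (t : E → ℝ) :
    m * (t ⬝ᵥ t) ≤ ∫ z, (subvec E z.1 ⬝ᵥ t) ^ 2 * g z.1 (subvec E z.1 ⬝ᵥ bs) ∂F := by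
  have hT := hF.tendsto_integral_mul_kernel hK hpos h0 (b := fun _ => bs) tendsto_const_nhds
    (w := fun x => (subvec E x ⬝ᵥ t) ^ 2) ((measurable_subvec_dotProduct E t).pow_const 2)
    (C := (E.card * ‖t‖) ^ 2) (r := 2) fun x => by
      rw [abs_pow, ← mul_pow]
      exact pow_le_pow_left₀ (abs_nonneg _) (abs_subvec_dotProduct_le E x t) 2
  exact ge_of_tendsto hT (.of_forall fun n => hF.curvature hK (hpos n) (hB n) t)

/-! ### Linearization of the empirical score -/

theorem sqrt_mul_score {K : ℝ → ℝ} (hK : IsKernel K) {τ h : ℝ} (hτ : τ ∈ Set.Ioo (0 : ℝ) 1)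
    (hh : 0 < h) {n : ℕ} (E : Finset (Fin p)) (b : E → ℝ) (ω : Sample n p) (a : Fin p) :
    √(n : ℝ) * score K τ h E b ω a
      = 1 / √(n : ℝ) * ∑ i, obsScore (kernelCdf (scaledKernel K h)) τ E b a (ω i) := by
  rw [score_eq hK hτ hh, ← mul_assoc]
  congr 1
  rw [mul_one_div, Real.sqrt_div_self']

theorem sqrt_mul_score_add {K : ℝ → ℝ} (hK : IsKernel K) {τ h : ℝ} (hτ : τ ∈ Set.Ioo (0 : ℝ) 1)
    (hh : 0 < h) {n : ℕ} (E : Finset (Fin p)) (b t : E → ℝ) (ω : Sample n p) (a : Fin p) :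
    √(n : ℝ) * score K τ h E (b + (√(n : ℝ))⁻¹ • t) ω a
      = √(n : ℝ) * score K τ h E b ω a
        + localIncrement (kernelCdf (scaledKernel K h)) (fun x => subvec E x ⬝ᵥ b)
          (fun x => subvec E x ⬝ᵥ t) (fun x => x a) ω := by
  rw [sqrt_mul_score hK hτ hh, sqrt_mul_score hK hτ hh, localIncrement, ← mul_add,
    ← Finset.sum_add_distrib]
  congr 1
  refine Finset.sum_congr rfl fun i _ => ?_
  simp only [obsScore, dotProduct_add, dotProduct_smul, smul_eq_mul, inv_mul_eq_div]
  ring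

/-- The difference is itself a centred sum, of functions whose second moments vanish by dominated
convergence. The central limit theorem is thereby needed only for one fixed function, not for a
triangular array. -/
theorem IsRegularLaw.tendstoZeroInProb_score_sub (hF : IsRegularLaw F l g) {K : ℝ → ℝ}
    (hK : IsKernel K) {τ : ℝ} (hτ : τ ∈ Set.Ioo (0 : ℝ) 1) {h : ℕ → ℝ} (hpos : ∀ n, 0 < h n)
    (h0 : Tendsto h atTop (𝓝 0)) {E : Finset (Fin p)} {b : ℕ → E → ℝ} {bs : E → ℝ}
    (hb : Tendsto b atTop (𝓝 bs)) (a : Fin p) :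
    TendstoZeroInProb (sampleLaw F) fun n ω => √(n : ℝ) * score K τ (h n) E (b n) ω a
      - √(n : ℝ) * (∫ z, obsScore (kernelCdf (scaledKernel K (h n))) τ E (b n) a z ∂F)
      - centredSum F (obsScore stepFn τ E bs a) ω := by
  have hk := fun n => hK.scaledKernel (hpos n)
  have hm := fun n => hF.memLp_obsScore (measurable_kernelCdf (hk n)) (kernelCdf_nonneg (hk n))
    (kernelCdf_le_one (hk n)) hτ E (b n) a
  have hm0 := hF.memLp_obsScore measurable_stepFn stepFn_nonneg stepFn_le_one hτ E bs a
  set ψ : ℕ → (Fin p → ℝ) × ℝ → ℝ := fun n z =>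
    obsScore (kernelCdf (scaledKernel K (h n))) τ E (b n) a z - obsScore stepFn τ E bs a z with hψ
  have hψm : ∀ n, MemLp (ψ n) 2 F := fun n => (hm n).sub hm0
  have hsq : Tendsto (fun n => ∫ z, ψ n z ^ 2 ∂F) atTop (𝓝 0) := by
    have := tendsto_integral_of_dominated_convergence (F := fun n z => ψ n z ^ 2) (f := fun _ => 0)
      (μ := F) (fun z => 4 * ‖z.1‖ ^ 2) (fun n => ((hψm n).1.pow 2)) ((hF.moments 2).const_mul 4)
      (fun n => .of_forall fun z => by
        have h1 := abs_obsScore_le (kernelCdf_nonneg (hk n)) (kernelCdf_le_one (hk n)) hτ E (b n) a z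
        have h2 := abs_obsScore_le stepFn_nonneg stepFn_le_one hτ E bs a z
        have h3 : |ψ n z| ≤ 2 * ‖z.1‖ := (abs_sub _ _).trans (by linarith)
        rw [norm_pow, Real.norm_eq_abs]
        refine (pow_le_pow_left₀ (abs_nonneg _) h3 2).trans (le_of_eq (by ring)))
      (by
        filter_upwards [hF.ae_tendsto_obsScore hK τ hpos h0 hb] with z hz
        have := ((hz a).sub_const (obsScore stepFn τ E bs a z)).pow 2
        simpa using this)
    simpa using this
  refine (tendstoZeroInProb_centredSum hψm hsq).congr (.of_forall fun n => .of_forall fun ω => ?_)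
  rw [sqrt_mul_score hK hτ (hpos n)]
  simp only [centredSum, hψ]
  rw [integral_sub ((hm n).integrable one_le_two) (hm0.integrable one_le_two)]
  have : √(n : ℝ) * (∫ z, obsScore (kernelCdf (scaledKernel K (h n))) τ E (b n) a z ∂F)
      = 1 / √(n : ℝ) * ∑ _i : Fin n,
        ∫ z, obsScore (kernelCdf (scaledKernel K (h n))) τ E (b n) a z ∂F := by
    rw [Finset.sum_const, Finset.card_univ, Fintype.card_fin, nsmul_eq_mul, ← mul_assoc,
      one_div_mul_eq_div, Real.div_sqrt]
  rw [this, ← mul_sub, ← mul_sub, ← Finset.sum_sub_distrib, ← Finset.sum_sub_distrib]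
  congr 1
  exact Finset.sum_congr rfl fun i _ => by ring

/-- The refitted estimator is root-`n` consistent for the pseudo-parameter. -/
theorem IsRegularLaw.boundedInProb_estimator (hF : IsRegularLaw F l g)
    (hy : Integrable (fun z : (Fin p → ℝ) × ℝ => z.2) F) {K : ℝ → ℝ}
    (hK : IsKernel K) {τ : ℝ} (hτ : τ ∈ Set.Ioo (0 : ℝ) 1) {h : ℕ → ℝ} (hpos : ∀ n, 0 < h n)
    (h0 : Tendsto h atTop (𝓝 0)) {E : Finset (Fin p)} {bs : E → ℝ}
    {m : ℝ} (hm : 0 < m) (hB : ∀ n, CurvatureBound F K (h n) E bs m) {b : ℕ → E → ℝ}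
    (hbt : Tendsto b atTop (𝓝 bs)) (hb : ∀ n, IsPseudoParameter F K τ (h n) n E (b n))
    {bhat : (n : ℕ) → Sample n p → E → ℝ}
    (hbhat : ∀ n, ∀ᵐ ω ∂(sampleLaw F n), IsRefittedEstimate K τ (h n) E ω (bhat n ω)) :
    BoundedInProb (sampleLaw F) fun n ω => ‖√(n : ℝ) • (bhat n ω - b n)‖ := by
  have hZ : ∀ a : E, BoundedInProb (sampleLaw F)
      fun n ω => √(n : ℝ) * score K τ (h n) E (b n) ω a := by
    intro a
    have h1 := hF.tendstoZeroInProb_score_sub hK hτ hpos h0 hbt a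
    have h2 := boundedInProb_centredSum
      (hF.memLp_obsScore measurable_stepFn stepFn_nonneg stepFn_le_one hτ E bs a)
    refine (h1.boundedInProb.add h2).mono ?_
    filter_upwards [eventually_gt_atTop 0] with n hn
    refine .of_forall fun ω => le_of_eq ?_
    rw [hF.integral_obsScore_eq_zero_of_isPseudoParameter hy hK hτ (hpos n) hn (hb n) a]
    ring_nf
  intro δ hδ
  set q : ℕ := Fintype.card E with hq
  -- There are two bad events for each of the `q` coordinates; the `+ 1` avoids dividing by zero
  -- when `E` is empty.
  set δ' : ENNReal := δ / (2 * (q + 1)) with hδ'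
  have hδ'0 : 0 < δ' := ENNReal.div_pos hδ.ne' (by finiteness)
  choose M hM using fun a => hZ a δ' hδ'0
  set M0 : ℝ := ∑ a, |M a| with hM0
  have hMM : ∀ a, M a ≤ M0 := fun a => (le_abs_self _).trans
    (Finset.single_le_sum (f := fun a => |M a|) (fun _ _ => abs_nonneg _) (Finset.mem_univ a))
  have hM00 : 0 ≤ M0 := Finset.sum_nonneg fun _ _ => abs_nonneg _
  -- On `‖t‖ = r` curvature contributes `m r²`, while the score at `b n` and the linearization error
  -- take away at most `q r (M0 + 1)`. This choice leaves `r > 0`.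
  set r : ℝ := (q * (M0 + 1) + 1) / m with hr
  have hr0 : 0 < r := by positivity
  have hW : ∀ a : E, ∀ᶠ n in atTop, sampleLaw F n {ω | ∃ t : E → ℝ, ‖t‖ ≤ r ∧
      1 ≤ |localIncrement (kernelCdf (scaledKernel K (h n))) (fun x => subvec E x ⬝ᵥ b n)
        (fun x => subvec E x ⬝ᵥ t) (fun x => x a) ω
        - ∫ z, z.1 a * (subvec E z.1 ⬝ᵥ t) * g z.1 (subvec E z.1 ⬝ᵥ bs) ∂F|} ≤ δ' := fun a =>
    ENNReal.tendsto_nhds_zero.1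
      (hF.tendsto_measure_localIncrement hK hpos h0 hbt a r one_pos) δ' hδ'0
  refine ⟨r, ?_⟩
  filter_upwards [eventually_all.2 hM, eventually_all.2 hW, eventually_gt_atTop 0] with n hMn hWn hn
  have hn' : 0 < √(n : ℝ) := Real.sqrt_pos.2 (by exact_mod_cast hn)
  set B : E → Set (Sample n p) := fun a => {ω | M a ≤ |√(n : ℝ) * score K τ (h n) E (b n) ω a|} ∪
    {ω | ∃ t : E → ℝ, ‖t‖ ≤ r ∧
      1 ≤ |localIncrement (kernelCdf (scaledKernel K (h n))) (fun x => subvec E x ⬝ᵥ b n)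
        (fun x => subvec E x ⬝ᵥ t) (fun x => x a) ω
        - ∫ z, z.1 a * (subvec E z.1 ⬝ᵥ t) * g z.1 (subvec E z.1 ⬝ᵥ bs) ∂F|} with hBdef
  have hBm : sampleLaw F n (⋃ a ∈ (Finset.univ : Finset E), B a) ≤ δ := by
    refine (measure_biUnion_finset_le _ _).trans ?_
    have : ∀ a ∈ (Finset.univ : Finset E), sampleLaw F n (B a) ≤ δ' + δ' := fun a _ =>
      (measure_union_le _ _).trans (add_le_add (hMn a) (hWn a))
    refine (Finset.sum_le_card_nsmul _ _ _ this).trans ?_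
    rw [Finset.card_univ, ← hq, nsmul_eq_mul, ← two_mul, ← mul_assoc]
    calc (q : ENNReal) * 2 * δ' ≤ (2 * (q + 1)) * δ' := by
          rw [mul_comm (q : ENNReal) 2]
          gcongr
          exact le_self_add
      _ ≤ δ := ENNReal.mul_div_le
  refine (measure_mono_ae ?_).trans hBm
  filter_upwards [hbhat n] with ω hω hle
  by_contra hnot
  have hnotB : ∀ a : E, |√(n : ℝ) * score K τ (h n) E (b n) ω a| < M a ∧ ∀ t : E → ℝ, ‖t‖ ≤ r →
      |localIncrement (kernelCdf (scaledKernel K (h n))) (fun x => subvec E x ⬝ᵥ b n)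
        (fun x => subvec E x ⬝ᵥ t) (fun x => x a) ω
        - ∫ z, z.1 a * (subvec E z.1 ⬝ᵥ t) * g z.1 (subvec E z.1 ⬝ᵥ bs) ∂F| < 1 := by
    intro a
    have : ω ∉ B a := fun hB => hnot (Set.mem_biUnion (Finset.mem_univ a) hB)
    simp only [hBdef, Set.mem_union, Set.mem_ofPred_eq, not_or, not_le, not_exists, not_and] at this
    exact this
  have hle' : r ≤ ‖√(n : ℝ) • (bhat n ω - b n)‖ := by
    have : r ≤ |‖√(n : ℝ) • (bhat n ω - b n)‖| := hle
    rwa [abs_norm] at this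
  set S : (E → ℝ) → E → ℝ := fun t a =>
    √(n : ℝ) * score K τ (h n) E (b n + (√(n : ℝ))⁻¹ • t) ω a with hS
  -- Off the bad events the rescaled score points outward on the sphere of radius `r`. Its zero, the
  -- rescaled estimation error, must then lie inside.
  refine absurd (norm_lt_of_ray_monotone (S := S) (r := r)
    (t₀ := √(n : ℝ) • (bhat n ω - b n)) (fun d s s' hs => ?_) hr0 (fun t ht => ?_) ?_)
      (not_lt.2 hle')
  · have e : ∀ s : ℝ, d ⬝ᵥ S (s • d) = 1 / √(n : ℝ) * ∑ i, (subvec E (ω i).1 ⬝ᵥ d) *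
        (kernelCdf (scaledKernel K (h n)) (subvec E (ω i).1 ⬝ᵥ b n - (ω i).2
          + (√(n : ℝ))⁻¹ * s * (subvec E (ω i).1 ⬝ᵥ d)) - τ) := by
      intro s
      simp only [hS, sqrt_mul_score hK hτ (hpos n)]
      rw [Finset.mul_sum]
      conv_lhs => simp only [dotProduct, Finset.mul_sum]
      rw [Finset.sum_comm]
      refine Finset.sum_congr rfl fun i _ => ?_
      have := dotProduct_sum_obsScore (kernelCdf (scaledKernel K (h n))) τ E
        (b n + (√(n : ℝ))⁻¹ • s • d) d (ω i)
      have e2 : subvec E (ω i).1 ⬝ᵥ b n - (ω i).2 + (√(n : ℝ))⁻¹ * s * (subvec E (ω i).1 ⬝ᵥ d)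
          = subvec E (ω i).1 ⬝ᵥ (b n + (√(n : ℝ))⁻¹ • s • d) - (ω i).2 := by
        simp only [dotProduct_add, dotProduct_smul, smul_eq_mul]
        ring
      rw [e2, ← this, Finset.mul_sum]
      exact Finset.sum_congr rfl fun a _ => by ring
    simp only [e]
    refine mul_le_mul_of_nonneg_left (Finset.sum_le_sum fun i _ => ?_) (by positivity)
    exact monotone_mul_comp_ray (monotone_kernelCdf (hK.scaledKernel (hpos n))) τ _ _
      (mul_le_mul_of_nonneg_left hs (by positivity))
  · have hsm := fun d => measurable_subvec_dotProduct E d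
    have hi : ∀ a : E, Integrable (fun z =>
        z.1 a * (subvec E z.1 ⬝ᵥ t) * g z.1 (subvec E z.1 ⬝ᵥ bs)) F := fun a =>
      hF.integrable_mul_density (w := fun x => x a * (subvec E x ⬝ᵥ t))
        (s := fun x => subvec E x ⬝ᵥ bs) (hsm bs)
        (hF.integrable_of_le (w := fun x => x a * (subvec E x ⬝ᵥ t))
          ((measurable_pi_apply _).mul (hsm t)) (C := E.card * ‖t‖) (r := 2) fun x => by
          rw [abs_mul]
          refine (mul_le_mul (norm_le_pi_norm x a) (abs_subvec_dotProduct_le E x t) (abs_nonneg _)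
            (norm_nonneg _)).trans (le_of_eq (by ring)))
    have e1 : t ⬝ᵥ (fun a : E => ∫ z, z.1 a * (subvec E z.1 ⬝ᵥ t)
        * g z.1 (subvec E z.1 ⬝ᵥ bs) ∂F)
        = ∫ z, (subvec E z.1 ⬝ᵥ t) ^ 2 * g z.1 (subvec E z.1 ⬝ᵥ bs) ∂F := by
      conv_lhs => rw [dotProduct]
      simp_rw [← integral_const_mul]
      rw [← integral_finsetSum _ fun a _ => (hi a).const_mul (t a)]
      refine integral_congr_ae (.of_forall fun z => ?_)
      simp only
      have : ∑ a : E, t a * (z.1 a * (subvec E z.1 ⬝ᵥ t) * g z.1 (subvec E z.1 ⬝ᵥ bs))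
          = (∑ a : E, z.1 a * t a) * ((subvec E z.1 ⬝ᵥ t) * g z.1 (subvec E z.1 ⬝ᵥ bs)) := by
        rw [Finset.sum_mul]
        exact Finset.sum_congr rfl fun a _ => by ring
      rw [this, sq, mul_assoc]
      rfl
    have h1 := hF.curvature_limit hK hpos h0 hB t
    rw [← e1] at h1
    have h2 := sq_norm_le_dotProduct t
    have e2 : S t = (fun a : E => ∫ z, z.1 a * (subvec E z.1 ⬝ᵥ t)
        * g z.1 (subvec E z.1 ⬝ᵥ bs) ∂F) + fun a : E =>
          (√(n : ℝ) * score K τ (h n) E (b n) ω a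
          + (localIncrement (kernelCdf (scaledKernel K (h n))) (fun x => subvec E x ⬝ᵥ b n)
            (fun x => subvec E x ⬝ᵥ t) (fun x => x a) ω
          - ∫ z, z.1 a * (subvec E z.1 ⬝ᵥ t) * g z.1 (subvec E z.1 ⬝ᵥ bs) ∂F)) := by
      funext a
      simp only [hS, Pi.add_apply]
      rw [sqrt_mul_score_add hK hτ (hpos n)]
      ring
    rw [e2, dotProduct_add]
    have h3 := abs_dotProduct_le t (fun a : E =>
          (√(n : ℝ) * score K τ (h n) E (b n) ω a
          + (localIncrement (kernelCdf (scaledKernel K (h n))) (fun x => subvec E x ⬝ᵥ b n)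
            (fun x => subvec E x ⬝ᵥ t) (fun x => x a) ω
          - ∫ z, z.1 a * (subvec E z.1 ⬝ᵥ t) * g z.1 (subvec E z.1 ⬝ᵥ bs) ∂F))) (c := M0 + 1)
      fun a => (abs_add_le _ _).trans (add_le_add ((hnotB a).1.le.trans (hMM a))
        ((hnotB a).2 t ht.le).le)
    rw [ht] at h2 h3
    have h4 := (abs_le.1 h3).1
    have h5 := mul_le_mul_of_nonneg_left h2 hm.le
    have h6 : m * r = q * (M0 + 1) + 1 := by rw [hr]; field_simp
    have h7 : m * r ^ 2 = r * (q * (M0 + 1) + 1) := by rw [← h6]; ring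
    rw [← hq] at h4
    nlinarith
  · funext a
    simp only [hS, smul_smul, inv_mul_cancel₀ hn'.ne', one_smul, add_sub_cancel, Pi.zero_apply]
    rw [score_eq_zero_of_isRefittedEstimate hK hτ (hpos n) E _ ω hω a, mul_zero]

end

/-! ### Linear algebra of the limiting covariance -/

section LinearAlgebra

variable {p : ℕ} {E : Finset (Fin p)} {j : E}

/-- The matrix `Λ₂ H^{-1/2}`. -/
noncomputable def adjustCoeff {p : ℕ} (E : Finset (Fin p)) (j : E) (J H : Matrix (Fin p) (Fin p) ℝ) :
    Matrix (Minus j ⊕ Compl E) (E ⊕ Compl E) ℝ :=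
  Matrix.fromBlocks
    (Matrix.of fun (k : Minus j) (c : E) =>
      1 / matSigma E J H j j * matSigma E J H k j * (blockEE E J)⁻¹ j c - (blockEE E J)⁻¹ k c)
    0
    (-(blockCE E H * (blockEE E H)⁻¹))
    1

/-- The linear map that sends the limit of the score to the limit of the centred statistic. -/
noncomputable def influenceCoeff {p : ℕ} (E : Finset (Fin p)) (j : E)
    (J H : Matrix (Fin p) (Fin p) ℝ) : Matrix (Unit ⊕ (Minus j ⊕ Compl E)) (E ⊕ Compl E) ℝ :=
  Matrix.fromRows (Matrix.of fun _ => Sum.elim (fun c => -(blockEE E J)⁻¹ j c) 0)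
    (adjustCoeff E j J H)

/-- Only the square of `H^{1/2}` matters. Positive semidefiniteness is needed for `CFC.sqrt` to be a
genuine square root; after that, convergence of the product requires no continuity of the root. -/
theorem matLambda₂_mul_transpose {J H : Matrix (Fin p) (Fin p) ℝ}
    (hH : (ordered E H).PosSemidef) :
    matLambda₂ E j J H * (matLambda₂ E j J H)ᵀ
      = adjustCoeff E j J H * ordered E H * (adjustCoeff E j J H)ᵀ := by
  have h1 : CFC.sqrt (ordered E H) * CFC.sqrt (ordered E H) = ordered E H :=
    CFC.sqrt_mul_sqrt_self _ hH.nonneg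
  have h2 : (CFC.sqrt (ordered E H))ᵀ = CFC.sqrt (ordered E H) := by
    have := (Matrix.nonneg_iff_posSemidef.1 (CFC.sqrt_nonneg (ordered E H))).isHermitian
    rwa [Matrix.IsHermitian, Matrix.conjTranspose_eq_transpose_of_trivial] at this
  change adjustCoeff E j J H * CFC.sqrt (ordered E H)
    * (adjustCoeff E j J H * CFC.sqrt (ordered E H))ᵀ = _
  rw [Matrix.transpose_mul, h2, Matrix.mul_assoc, ← Matrix.mul_assoc (CFC.sqrt _), h1,
    Matrix.mul_assoc]

/-- Two projections. The covariance of the `j` entry with the `k` entry of the upper nuisance block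
is `Σ_jk - (Σ_kj / Σ_jj) Σ_jj = 0`. In the lower block, subtracting `H_{E',E} H_{E,E}⁻¹ Z_E` leaves
a residual uncorrelated with `Z_E`, hence with the `j` entry, which is a linear function of `Z_E`.
-/
theorem influenceCoeff_mul_ordered_mul_transpose {J H : Matrix (Fin p) (Fin p) ℝ}
    (hJ : J.IsSymm) (hH : H.IsSymm) (hHd : IsUnit (blockEE E H).det)
    (hs : matSigma E J H j j ≠ 0) :
    influenceCoeff E j J H * ordered E H * (influenceCoeff E j J H)ᵀ
      = Matrix.fromBlocks (Matrix.of fun _ _ : Unit => matSigma E J H j j) 0 0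
        (adjustCoeff E j J H * ordered E H * (adjustCoeff E j J H)ᵀ) := by
  have hPs : ((blockEE E J)⁻¹)ᵀ = (blockEE E J)⁻¹ := by
    rw [Matrix.transpose_nonsing_inv]
    congr 1
    exact hJ.submatrix _
  set P := (blockEE E J)⁻¹ with hP
  set u : Matrix Unit (E ⊕ Compl E) ℝ :=
    Matrix.of fun _ => Sum.elim (fun c => -P j c) 0 with hu
  have hHs : (blockEE E H)ᵀ = blockEE E H := hH.submatrix _
  have hCE : (blockCE E H)ᵀ = H.submatrix Subtype.val Subtype.val := by
    rw [blockCE, Matrix.transpose_submatrix, hH]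
  have hord : (ordered E H)ᵀ = ordered E H := hH.submatrix _
  have huH : u * ordered E H = Matrix.of fun _ => Sum.elim (fun c => -(P * blockEE E H) j c)
      (fun c => -(P * (blockCE E H)ᵀ) j c) := by
    ext i (c | c)
    · simp [hu, Matrix.mul_apply, ordered, blockEE]
    · simp [hu, Matrix.mul_apply, ordered, hCE]
  have hSig : matSigma E J H = P * blockEE E H * P := rfl
  have h11 : u * ordered E H * uᵀ = Matrix.of fun _ _ : Unit => matSigma E J H j j := by
    rw [huH]
    ext i k
    conv_rhs => rw [Matrix.of_apply, hSig, Matrix.mul_apply]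
    rw [Matrix.mul_apply, Fintype.sum_sum_type]
    simp only [hu, Matrix.of_apply, Matrix.transpose_apply, Sum.elim_inl, Sum.elim_inr,
      Pi.zero_apply, mul_zero, Finset.sum_const_zero, add_zero, neg_mul_neg]
    refine Finset.sum_congr rfl fun e _ => ?_
    rw [← hPs, Matrix.transpose_apply, hPs]
  have h12 : u * ordered E H * (adjustCoeff E j J H)ᵀ = 0 := by
    rw [huH]
    ext i (k | k)
    · rw [Matrix.mul_apply, Fintype.sum_sum_type]
      simp only [adjustCoeff, Matrix.of_apply, Matrix.transpose_apply, Sum.elim_inl, Sum.elim_inr,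
        Matrix.fromBlocks_apply₁₁, Matrix.fromBlocks_apply₁₂, Matrix.zero_apply, mul_zero,
        Finset.sum_const_zero, add_zero, ← hP, mul_sub, Finset.sum_sub_distrib]
      have e1 : ∀ a : E, ∑ x, -(P * blockEE E H) j x * P a x = - matSigma E J H j a := by
        intro a
        rw [hSig, Matrix.mul_apply (M := P * blockEE E H)]
        simp only [neg_mul, Finset.sum_neg_distrib]
        congr 1
        refine Finset.sum_congr rfl fun e _ => ?_
        rw [← hPs, Matrix.transpose_apply, hPs]
      have e2 : matSigma E J H (k : E) j = matSigma E J H j (k : E) := by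
        have : (matSigma E J H)ᵀ = matSigma E J H := by
          rw [hSig, Matrix.transpose_mul, Matrix.transpose_mul, hPs, hHs, Matrix.mul_assoc]
        conv_lhs => rw [← this, Matrix.transpose_apply]
      rw [e1 k]
      have e3 := e1 j
      have e4 : ∀ x : E, -(P * blockEE E H) j x * (1 / matSigma E J H j j * matSigma E J H k j
          * P j x) = (1 / matSigma E J H j j * matSigma E J H k j)
            * (-(P * blockEE E H) j x * P j x) := fun x => by ring
      simp_rw [e4]
      rw [← Finset.mul_sum, e3, e2]
      field_simp
      ring
    · rw [Matrix.mul_apply, Fintype.sum_sum_type]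
      simp only [adjustCoeff, Matrix.of_apply, Matrix.transpose_apply, Sum.elim_inl, Sum.elim_inr,
        Matrix.fromBlocks_apply₂₁, Matrix.fromBlocks_apply₂₂, Matrix.zero_apply, Matrix.neg_apply,
        neg_mul_neg]
      have e1 : ∑ x, (P * blockEE E H) j x * (blockCE E H * (blockEE E H)⁻¹) k x
          = (P * (blockCE E H)ᵀ) j k := by
        have : P * blockEE E H * (blockCE E H * (blockEE E H)⁻¹)ᵀ = P * (blockCE E H)ᵀ := by
          rw [Matrix.transpose_mul, Matrix.transpose_nonsing_inv, hHs, Matrix.mul_assoc,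
            ← Matrix.mul_assoc (blockEE E H), Matrix.mul_nonsing_inv _ hHd, Matrix.one_mul]
        rw [← this, Matrix.mul_apply]
        rfl
      rw [e1]
      simp [Matrix.one_apply]
  -- The other off-diagonal block is the transpose of `h12`, as `H` is symmetric.
  have h21 : adjustCoeff E j J H * ordered E H * uᵀ = 0 := by
    have := congrArg Matrix.transpose h12
    rwa [Matrix.transpose_mul, Matrix.transpose_mul, Matrix.transpose_transpose, hord,
      Matrix.transpose_zero, ← Matrix.mul_assoc] at this
  change Matrix.fromRows u (adjustCoeff E j J H) * _ * (Matrix.fromRows u _)ᵀ = _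
  rw [Matrix.fromRows_mul, Matrix.transpose_fromRows, Matrix.fromRows_mul_fromCols, h11, h12, h21]

theorem tendsto_matrix_inv {ι : Type*} [Fintype ι] [DecidableEq ι] {A : ℕ → Matrix ι ι ℝ}
    {A₀ : Matrix ι ι ℝ} (h : Tendsto A atTop (𝓝 A₀)) (h0 : IsUnit A₀.det) :
    Tendsto (fun n => (A n)⁻¹) atTop (𝓝 A₀⁻¹) := by
  have hd : Tendsto (fun n => (A n).det) atTop (𝓝 A₀.det) :=
    (continuous_id.matrix_det.tendsto A₀).comp h
  have ha : Tendsto (fun n => (A n).adjugate) atTop (𝓝 A₀.adjugate) :=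
    (continuous_id.matrix_adjugate.tendsto A₀).comp h
  simp only [Matrix.inv_def, Ring.inverse_eq_inv']
  exact (hd.inv₀ h0.ne_zero).smul ha

theorem tendsto_matrix_mul {ι κ μ : Type*} [Fintype κ] {A : ℕ → Matrix ι κ ℝ}
    {A₀ : Matrix ι κ ℝ} {B : ℕ → Matrix κ μ ℝ} {B₀ : Matrix κ μ ℝ} (hA : Tendsto A atTop (𝓝 A₀))
    (hB : Tendsto B atTop (𝓝 B₀)) : Tendsto (fun n => A n * B n) atTop (𝓝 (A₀ * B₀)) := by
  have : Continuous fun q : Matrix ι κ ℝ × Matrix κ μ ℝ => q.1 * q.2 :=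
    continuous_fst.matrix_mul continuous_snd
  exact (this.tendsto (A₀, B₀)).comp (hA.prodMk_nhds hB)

theorem tendsto_submatrix {ι κ : Type*} {A : ℕ → Matrix (Fin p) (Fin p) ℝ}
    {A₀ : Matrix (Fin p) (Fin p) ℝ} (hA : Tendsto A atTop (𝓝 A₀)) (r : ι → Fin p)
    (c : κ → Fin p) : Tendsto (fun n => (A n).submatrix r c) atTop (𝓝 (A₀.submatrix r c)) :=
  ((continuous_id.matrix_submatrix r c).tendsto A₀).comp hA

theorem tendsto_matSigma {J H : ℕ → Matrix (Fin p) (Fin p) ℝ} {J₀ H₀ : Matrix (Fin p) (Fin p) ℝ}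
    (hJ : Tendsto J atTop (𝓝 J₀)) (hH : Tendsto H atTop (𝓝 H₀))
    (hJd : IsUnit (blockEE E J₀).det) :
    Tendsto (fun n => matSigma E (J n) (H n)) atTop (𝓝 (matSigma E J₀ H₀)) := by
  have h1 := tendsto_matrix_inv (tendsto_submatrix hJ (Subtype.val : E → Fin p) Subtype.val) hJd
  exact tendsto_matrix_mul (tendsto_matrix_mul h1 (tendsto_submatrix hH _ _)) h1

theorem tendsto_apply_apply {ι κ : Type*} {A : ℕ → Matrix ι κ ℝ} {A₀ : Matrix ι κ ℝ}
    (hA : Tendsto A atTop (𝓝 A₀)) (i : ι) (k : κ) :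
    Tendsto (fun n => A n i k) atTop (𝓝 (A₀ i k)) :=
  tendsto_pi_nhds.1 (tendsto_pi_nhds.1 hA i) k

theorem tendsto_adjustCoeff {J H : ℕ → Matrix (Fin p) (Fin p) ℝ}
    {J₀ H₀ : Matrix (Fin p) (Fin p) ℝ} (hJ : Tendsto J atTop (𝓝 J₀)) (hH : Tendsto H atTop (𝓝 H₀))
    (hJd : IsUnit (blockEE E J₀).det) (hHd : IsUnit (blockEE E H₀).det)
    (hs : matSigma E J₀ H₀ j j ≠ 0) :
    Tendsto (fun n => adjustCoeff E j (J n) (H n)) atTop (𝓝 (adjustCoeff E j J₀ H₀)) := by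
  have h1 := tendsto_matrix_inv (tendsto_submatrix hJ (Subtype.val : E → Fin p) Subtype.val) hJd
  have h2 := tendsto_matrix_inv (tendsto_submatrix hH (Subtype.val : E → Fin p) Subtype.val) hHd
  have h3 := tendsto_matSigma hJ hH hJd
  have h4 := tendsto_matrix_mul
    (tendsto_submatrix hH (Subtype.val : Compl E → Fin p) (Subtype.val : E → Fin p)) h2
  refine tendsto_pi_nhds.2 fun a => tendsto_pi_nhds.2 fun c => ?_
  rcases a with k | k <;> rcases c with c | c
  · exact ((((tendsto_const_nhds.div (tendsto_apply_apply h3 j j) hs).mul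
      (tendsto_apply_apply h3 k j)).mul (tendsto_apply_apply h1 j c)).sub
        (tendsto_apply_apply h1 k c))
  · exact tendsto_const_nhds
  · exact (tendsto_apply_apply h4 k c).neg
  · exact tendsto_const_nhds

end LinearAlgebra

/-! ### Positivity of the limiting matrices -/

section Positivity

variable {α : Type*} [MeasurableSpace α] {F : Measure α} [IsProbabilityMeasure F]

theorem variance_sum_mul {ι : Type*} [Fintype ι] {φ : ι → α → ℝ} (hφ : ∀ i, MemLp (φ i) 2 F)
    (v : ι → ℝ) : Var[fun z => ∑ i, v i * φ i z; F]
      = v ⬝ᵥ (Matrix.of fun a c => cov[φ a, φ c; F]) *ᵥ v := by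
  have hm : ∀ i, MemLp (fun z => v i * φ i z) 2 F := fun i => (hφ i).const_mul _
  rw [← covariance_self (memLp_finsetSum _ fun i _ => hm i).1.aemeasurable,
    covariance_fun_sum_fun_sum hm hm]
  simp only [covariance_const_mul_left, covariance_const_mul_right, dotProduct, Matrix.mulVec,
    Matrix.of_apply, Finset.mul_sum]
  exact Finset.sum_congr rfl fun i _ => Finset.sum_congr rfl fun k _ => by ring

theorem posSemidef_covariance {ι : Type*} [Fintype ι] {φ : ι → α → ℝ}
    (hφ : ∀ i, MemLp (φ i) 2 F) : (Matrix.of fun a c => cov[φ a, φ c; F]).PosSemidef := by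
  refine Matrix.PosSemidef.of_dotProduct_mulVec_nonneg ?_ fun v => ?_
  · ext a c
    simp [covariance_comm (φ c)]
  · rw [star_trivial, ← variance_sum_mul hφ]
    exact variance_nonneg _ _

end Positivity

section

variable {p : ℕ} {F : Measure ((Fin p → ℝ) × ℝ)} [IsProbabilityMeasure F] {l : ℝ}
  {g : (Fin p → ℝ) → ℝ → ℝ}

theorem isSymm_limJ (E : Finset (Fin p)) (b : E → ℝ) : (limJ F g E b).IsSymm := by
  ext a c
  simp only [Matrix.transpose_apply, limJ, Matrix.of_apply, mul_comm]

theorem isSymm_limH (τ : ℝ) (E : Finset (Fin p)) (b : E → ℝ) : (limH F τ E b).IsSymm := by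
  ext a c
  simp only [Matrix.transpose_apply, limH, Matrix.of_apply, covariance_comm]

theorem IsRegularLaw.blockEE_limJ_mulVec (hF : IsRegularLaw F l g) (E : Finset (Fin p))
    (bs t : E → ℝ) (c : Fin p) : ∑ e : E, limJ F g E bs c e * t e
      = ∫ z, z.1 c * (subvec E z.1 ⬝ᵥ t) * g z.1 (subvec E z.1 ⬝ᵥ bs) ∂F := by
  have hi : ∀ e : E, Integrable (fun z => z.1 c * z.1 e * g z.1 (subvec E z.1 ⬝ᵥ bs)) F :=
    fun e => hF.integrable_mul_density (w := fun x => x c * x e)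
      (s := fun x => subvec E x ⬝ᵥ bs) (measurable_subvec_dotProduct E bs)
      (hF.integrable_of_le (w := fun x => x c * x e) (by fun_prop) (C := 1) (r := 2) fun x => by
        rw [abs_mul, one_mul, sq]
        exact mul_le_mul (norm_le_pi_norm x c) (norm_le_pi_norm x e) (abs_nonneg _)
          (norm_nonneg _))
  simp only [limJ, Matrix.of_apply, ← integral_mul_const]
  rw [← integral_finsetSum _ fun e _ => (hi e).mul_const (t e)]
  refine integral_congr_ae (.of_forall fun z => ?_)
  simp only [dotProduct, subvec, Finset.mul_sum, Finset.sum_mul]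
  exact Finset.sum_congr rfl fun e _ => by ring

theorem IsRegularLaw.dotProduct_blockEE_limJ (hF : IsRegularLaw F l g) (E : Finset (Fin p))
    (bs t : E → ℝ) : t ⬝ᵥ blockEE E (limJ F g E bs) *ᵥ t
      = ∫ z, (subvec E z.1 ⬝ᵥ t) ^ 2 * g z.1 (subvec E z.1 ⬝ᵥ bs) ∂F := by
  have hsm := measurable_subvec_dotProduct E t
  have hi : ∀ a : E, Integrable (fun z =>
      z.1 a * (subvec E z.1 ⬝ᵥ t) * g z.1 (subvec E z.1 ⬝ᵥ bs)) F := fun a =>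
    hF.integrable_mul_density (w := fun x => x a * (subvec E x ⬝ᵥ t))
      (s := fun x => subvec E x ⬝ᵥ bs) (measurable_subvec_dotProduct E bs)
      (hF.integrable_of_le (w := fun x => x a * (subvec E x ⬝ᵥ t))
        ((measurable_pi_apply _).mul hsm) (C := E.card * ‖t‖) (r := 2) fun x => by
        rw [abs_mul]
        refine (mul_le_mul (norm_le_pi_norm x a) (abs_subvec_dotProduct_le E x t) (abs_nonneg _)
          (norm_nonneg _)).trans (le_of_eq (by ring)))
  have h1 : ∀ a : E, (blockEE E (limJ F g E bs) *ᵥ t) a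
      = ∫ z, z.1 a * (subvec E z.1 ⬝ᵥ t) * g z.1 (subvec E z.1 ⬝ᵥ bs) ∂F := fun a =>
    hF.blockEE_limJ_mulVec E bs t a
  rw [dotProduct]
  simp_rw [h1, ← integral_const_mul]
  rw [← integral_finsetSum _ fun a _ => (hi a).const_mul (t a)]
  refine integral_congr_ae (.of_forall fun z => ?_)
  simp only
  have : ∑ a : E, t a * (z.1 a * (subvec E z.1 ⬝ᵥ t) * g z.1 (subvec E z.1 ⬝ᵥ bs))
      = (∑ a : E, z.1 a * t a) * ((subvec E z.1 ⬝ᵥ t) * g z.1 (subvec E z.1 ⬝ᵥ bs)) := by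
    rw [Finset.sum_mul]
    exact Finset.sum_congr rfl fun a _ => by ring
  rw [this, sq, mul_assoc]
  rfl

theorem IsRegularLaw.posDef_blockEE_limJ (hF : IsRegularLaw F l g) {E : Finset (Fin p)}
    {bs : E → ℝ} {m : ℝ} (hm : 0 < m) (hc : ∀ t : E → ℝ, m * (t ⬝ᵥ t)
      ≤ ∫ z, (subvec E z.1 ⬝ᵥ t) ^ 2 * g z.1 (subvec E z.1 ⬝ᵥ bs) ∂F) :
    (blockEE E (limJ F g E bs)).PosDef := by
  refine Matrix.PosDef.of_dotProduct_mulVec_pos ?_ fun t ht => ?_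
  · rw [Matrix.IsHermitian, Matrix.conjTranspose_eq_transpose_of_trivial]
    exact (isSymm_limJ E bs).submatrix _
  · rw [star_trivial, hF.dotProduct_blockEE_limJ]
    have h1 : 0 < t ⬝ᵥ t := lt_of_lt_of_le (by positivity) (sq_norm_le_dotProduct t)
    exact lt_of_lt_of_le (by positivity) (hc t)

/-- The score has mean zero at the target, so its quadratic form is the mean of `(x_E · t)² (1{x_E ·
bs - y > 0} - τ)²`. The second factor is at least `(τ (1 - τ))²`, and the mean of `(x_E · t)²` is
positive because the curvature is at most `1 + l` times it. -/
theorem IsRegularLaw.posDef_blockEE_limH (hF : IsRegularLaw F l g) {τ : ℝ}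
    (hτ : τ ∈ Set.Ioo (0 : ℝ) 1) {E : Finset (Fin p)} {bs : E → ℝ}
    (hbs : ∀ a : E, ∫ z, obsScore stepFn τ E bs a z ∂F = 0) {m : ℝ} (hm : 0 < m)
    (hc : ∀ t : E → ℝ, m * (t ⬝ᵥ t)
      ≤ ∫ z, (subvec E z.1 ⬝ᵥ t) ^ 2 * g z.1 (subvec E z.1 ⬝ᵥ bs) ∂F) :
    (blockEE E (limH F τ E bs)).PosDef := by
  have hM := fun a : Fin p =>
    hF.memLp_obsScore measurable_stepFn stepFn_nonneg stepFn_le_one hτ E bs a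
  refine Matrix.PosDef.of_dotProduct_mulVec_pos ?_ fun t ht => ?_
  · rw [Matrix.IsHermitian, Matrix.conjTranspose_eq_transpose_of_trivial]
    exact (isSymm_limH τ E bs).submatrix _
  rw [star_trivial]
  have h1 : 0 < t ⬝ᵥ t := lt_of_lt_of_le (by positivity) (sq_norm_le_dotProduct t)
  have e1 : t ⬝ᵥ blockEE E (limH F τ E bs) *ᵥ t
      = Var[fun z => ∑ a : E, t a * obsScore stepFn τ E bs a z; F] :=
    (variance_sum_mul (φ := fun a : E => obsScore stepFn τ E bs a) (fun a => hM a) t).symm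
  have hi : ∀ a : E, Integrable (fun z => t a * obsScore stepFn τ E bs a z) F := fun a =>
    ((hM a).integrable one_le_two).const_mul _
  have e2 : ∫ z, ∑ a : E, t a * obsScore stepFn τ E bs a z ∂F = 0 := by
    rw [integral_finsetSum _ fun a _ => hi a]
    simp [integral_const_mul, hbs]
  have hmem : MemLp (fun z => ∑ a : E, t a * obsScore stepFn τ E bs a z) 2 F :=
    memLp_finsetSum _ fun a _ => (hM a).const_mul _
  rw [e1, variance_of_integral_eq_zero hmem.1.aemeasurable e2]
  have hw : Integrable (fun z : (Fin p → ℝ) × ℝ => (subvec E z.1 ⬝ᵥ t) ^ 2) F :=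
    hF.integrable_of_le (w := fun x => (subvec E x ⬝ᵥ t) ^ 2)
      ((measurable_subvec_dotProduct E t).pow_const 2)
      (C := (E.card * ‖t‖) ^ 2) (r := 2) fun x => by
        rw [abs_pow, ← mul_pow]
        exact pow_le_pow_left₀ (abs_nonneg _) (abs_subvec_dotProduct_le E x t) 2
  have h2 : ∫ z, (subvec E z.1 ⬝ᵥ t) ^ 2 * g z.1 (subvec E z.1 ⬝ᵥ bs) ∂F
      ≤ (1 + l) * ∫ z, (subvec E z.1 ⬝ᵥ t) ^ 2 ∂F := by
    rw [← integral_const_mul]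
    refine integral_mono_ae (hF.integrable_mul_density (w := fun x => (subvec E x ⬝ᵥ t) ^ 2)
      (s := fun x => subvec E x ⬝ᵥ bs) (measurable_subvec_dotProduct E bs) hw)
      (hw.const_mul _) ?_
    filter_upwards [hF.ae_density] with z hz
    rw [mul_comm]
    exact mul_le_mul_of_nonneg_right (hz.le _) (sq_nonneg _)
  have h3 : (τ * (1 - τ)) ^ 2 * ∫ z, (subvec E z.1 ⬝ᵥ t) ^ 2 ∂F
      ≤ ∫ z, (∑ a : E, t a * obsScore stepFn τ E bs a z) ^ 2 ∂F := by
    rw [← integral_const_mul]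
    refine integral_mono (hw.const_mul _) hmem.integrable_sq fun z => ?_
    simp only [dotProduct_sum_obsScore]
    rw [mul_pow (subvec E z.1 ⬝ᵥ t), mul_comm]
    refine mul_le_mul_of_nonneg_left ?_ (sq_nonneg _)
    have h4 : 0 ≤ τ * (1 - τ) := mul_nonneg hτ.1.le (by linarith [hτ.2])
    rw [sq_le_sq, abs_of_nonneg h4]
    unfold stepFn
    split_ifs
    · rw [abs_of_nonneg (by linarith [hτ.2])]
      nlinarith [hτ.1, hτ.2]
    · rw [zero_sub, abs_neg, abs_of_nonneg hτ.1.le]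
      nlinarith [hτ.1, hτ.2]
  have hl := hF.const_nonneg
  have h5 : 0 < ∫ z, (subvec E z.1 ⬝ᵥ t) ^ 2 ∂F := by
    have := (mul_pos hm h1).trans_le ((hc t).trans h2)
    exact pos_of_mul_pos_right this (by linarith)
  refine lt_of_lt_of_le (mul_pos (pow_pos (mul_pos hτ.1 ?_) 2) h5) h3
  linarith [hτ.2]

/-- This is the quadratic form of `H_{E,E}` at the `j` row of `J_{E,E}⁻¹`, and a row of an inverse
matrix is not zero. -/
theorem matSigma_apply_pos {E : Finset (Fin p)} {J H : Matrix (Fin p) (Fin p) ℝ}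
    (hJs : J.IsSymm) (hJ : IsUnit (blockEE E J).det) (hH : (blockEE E H).PosDef) (j : E) :
    0 < matSigma E J H j j := by
  have hPs : ((blockEE E J)⁻¹)ᵀ = (blockEE E J)⁻¹ := by
    rw [Matrix.transpose_nonsing_inv]
    congr 1
    exact hJs.submatrix _
  have h1 : matSigma E J H j j = (blockEE E J)⁻¹ j ⬝ᵥ blockEE E H *ᵥ (blockEE E J)⁻¹ j := by
    rw [matSigma, Matrix.mul_assoc, Matrix.mul_apply]
    refine Finset.sum_congr rfl fun e _ => ?_
    congr 1
    rw [Matrix.mul_apply]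
    refine Finset.sum_congr rfl fun e' _ => ?_
    conv_lhs => rw [← hPs, Matrix.transpose_apply]
  rw [h1]
  have h2 : (blockEE E J)⁻¹ j ≠ 0 := by
    intro h0
    have h3 := congrFun (congrFun (Matrix.nonsing_inv_mul _ hJ) j) j
    rw [Matrix.mul_apply] at h3
    simp [h0] at h3
  have := hH.dotProduct_mulVec_pos h2
  rwa [star_trivial] at this

end

/-! ### Multivariate central limit theorem for asymptotically linear statistics -/

section AsymptoticallyLinear

variable {α : Type*} [MeasurableSpace α] {F : Measure α} [IsProbabilityMeasure F]

theorem centredSum_sum_mul {κ : Type*} [Fintype κ] {φ : κ → α → ℝ}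
    (hφ : ∀ c, Integrable (φ c) F) (v : κ → ℝ) {n : ℕ} (ω : Fin n → α) :
    centredSum F (fun z => ∑ c, v c * φ c z) ω = ∑ c, v c * centredSum F (φ c) ω := by
  have h1 : ∫ z, ∑ c, v c * φ c z ∂F = ∑ c, v c * ∫ z, φ c z ∂F := by
    rw [integral_finsetSum _ fun c _ => (hφ c).const_mul _]
    simp only [integral_const_mul]
  simp only [centredSum, h1, ← Finset.sum_sub_distrib, ← mul_sub]
  rw [Finset.sum_comm, Finset.mul_sum]
  refine Finset.sum_congr rfl fun c _ => ?_
  rw [← Finset.mul_sum]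
  ring

/-- Cramér–Wold through characteristic functions: the projection on `u` is asymptotically a scalar
centred sum with coefficients `Dᵀ u`. Since only characteristic functions are compared, the limiting
covariance may be singular. -/
theorem tendstoInDistribution_of_tendstoZeroInProb {ι κ : Type*} [Fintype ι] [DecidableEq ι]
    [Fintype κ] {φ : κ → α → ℝ} (hφ : ∀ c, MemLp (φ c) 2 F) (D : Matrix ι κ ℝ)
    {X : ∀ n : ℕ, (Fin n → α) → EuclideanSpace ℝ ι}
    (hX : ∀ n, AEMeasurable (X n) (Measure.pi fun _ : Fin n => F))
    (h : ∀ i, TendstoZeroInProb (fun n => Measure.pi fun _ : Fin n => F)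
      fun n ω => X n ω i - ∑ c, D i c * centredSum F (φ c) ω) :
    TendstoInDistribution X atTop (id : EuclideanSpace ℝ ι → _)
      (fun n => Measure.pi fun _ : Fin n => F)
      (multivariateGaussian 0 (D * (Matrix.of fun a c => cov[φ a, φ c; F]) * Dᵀ)) := by
  set C : Matrix κ κ ℝ := Matrix.of fun a c => cov[φ a, φ c; F] with hC
  have hS : (D * C * Dᵀ).PosSemidef := by
    have := (posSemidef_covariance hφ).mul_mul_conjTranspose_same D
    rwa [Matrix.conjTranspose_eq_transpose_of_trivial] at this
  refine ⟨hX, aemeasurable_id, ?_⟩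
  refine ProbabilityMeasure.tendsto_iff_tendsto_charFun.2 fun u => ?_
  set v : κ → ℝ := fun c => ∑ i, u i * D i c with hv
  have hvD : v = Dᵀ *ᵥ (u : ι → ℝ) := by
    funext c
    simp only [hv, Matrix.mulVec, dotProduct, Matrix.transpose_apply, mul_comm]
  have hψ : MemLp (fun z => ∑ c, v c * φ c z) 2 F := memLp_finsetSum _ fun c _ => (hφ c).const_mul _
  have e1 : charFun ((multivariateGaussian 0 (D * C * Dᵀ)).map id) u
      = Complex.exp (-(Var[fun z => ∑ c, v c * φ c z; F] : ℝ) / 2) := by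
    rw [Measure.map_id, charFun_multivariateGaussian hS, variance_sum_mul hφ, hvD]
    have : (u : ι → ℝ) ⬝ᵥ (D * C * Dᵀ) *ᵥ (u : ι → ℝ)
        = (Dᵀ *ᵥ (u : ι → ℝ)) ⬝ᵥ C *ᵥ (Dᵀ *ᵥ (u : ι → ℝ)) := by
      rw [← Matrix.mulVec_mulVec, ← Matrix.mulVec_mulVec, Matrix.dotProduct_mulVec,
        ← Matrix.mulVec_transpose]
    rw [this]
    congr 1
    simp only [inner_zero_right, Complex.ofReal_zero, zero_mul, zero_sub, hC]
    ring
  have e2 : ∀ n, charFun ((Measure.pi fun _ : Fin n => F).map (X n)) u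
      = ∫ ω, Complex.exp (((∑ i, u i * X n ω i : ℝ) : ℂ) * Complex.I)
        ∂(Measure.pi fun _ : Fin n => F) := by
    intro n
    rw [charFun_apply, integral_map (hX n) (by fun_prop)]
    simp [PiLp.inner_apply]
  simp only [ProbabilityMeasure.coe_mk]
  rw [e1]
  refine Tendsto.congr (fun n => (e2 n).symm) ?_
  refine TendstoZeroInProb.tendsto_integral_cexp
    (Y := fun n ω => centredSum F (fun z => ∑ c, v c * φ c z) ω) (fun n => ?_)
    (fun n => aemeasurable_centredSum hψ.1.aemeasurable n) ?_
    (tendsto_integral_cexp_centredSum hψ)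
  · have := hX n
    fun_prop
  · refine (TendstoZeroInProb.sum Finset.univ fun i _ => (h i).const_mul (u i)).congr
      (.of_forall fun n => .of_forall fun ω => ?_)
    rw [centredSum_sum_mul fun c => (hφ c).integrable one_le_two]
    simp only [hv, mul_sub, Finset.sum_sub_distrib, Finset.sum_mul, Finset.mul_sum]
    congr 1
    rw [Finset.sum_comm]
    exact Finset.sum_congr rfl fun i _ => Finset.sum_congr rfl fun c _ => by ring

end AsymptoticallyLinear

/-! ### From the linearized score to the adjusted statistic. -/

section Adjust

variable {p : ℕ} {E : Finset (Fin p)} {j : E}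

/-- `adjust` is linear in `(b, g)` for given `J` and `H`, so centring and scaling can be done on the
estimator and on the score separately. -/
theorem mul_adjust_sub_adjust (J H : Matrix (Fin p) (Fin p) ℝ) (b b' : E → ℝ) (g g' : Fin p → ℝ)
    (r : ℝ) (i : Minus j ⊕ Compl E) : r * (adjust E j J H b g i - adjust E j J H b' g' i)
      = adjust E j J H (r • (b - b')) (r • (g - g')) i := by
  rcases i with k | k
  · simp only [adjust, Sum.elim_inl, Pi.smul_apply, Pi.sub_apply, smul_eq_mul]
    ring
  · simp only [adjust, Sum.elim_inr, Matrix.mulVec_smul, Matrix.mulVec_sub, Pi.smul_apply,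
      Pi.sub_apply, smul_eq_mul]
    ring

variable {Ω : ℕ → Type*} [∀ n, MeasurableSpace (Ω n)] {P : ∀ n, Measure (Ω n)}
  {t : ∀ n, Ω n → E → ℝ} {S Z : ∀ n, Ω n → Fin p → ℝ} {J₀ : Matrix (Fin p) (Fin p) ℝ}

theorem tendstoZeroInProb_add_blockEE_mul
    (hlin : ∀ c, TendstoZeroInProb P fun n ω => S n ω c - Z n ω c - ∑ e : E, J₀ c e * t n ω e)
    (hzero : ∀ a : E, TendstoZeroInProb P fun n ω => S n ω a) (a : E) :
    TendstoZeroInProb P fun n ω => Z n ω a + ∑ e : E, J₀ a e * t n ω e :=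
  ((hzero a).sub (hlin a)).congr (.of_forall fun n => .of_forall fun ω => by ring)

/-- The score equations on `E` read `J_{E,E} t = -Z_E + o_p(1)`, and they are solved for `t`. -/
theorem tendstoZeroInProb_add_inv_mul (hJd : IsUnit (blockEE E J₀).det)
    (hlin : ∀ c, TendstoZeroInProb P fun n ω => S n ω c - Z n ω c - ∑ e : E, J₀ c e * t n ω e)
    (hzero : ∀ a : E, TendstoZeroInProb P fun n ω => S n ω a) (e : E) :
    TendstoZeroInProb P fun n ω => t n ω e + ∑ c : E, (blockEE E J₀)⁻¹ e c * Z n ω c := by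
  refine (TendstoZeroInProb.sum Finset.univ fun a _ =>
    (tendstoZeroInProb_add_blockEE_mul hlin hzero a).const_mul ((blockEE E J₀)⁻¹ e a)).congr
      (.of_forall fun n => .of_forall fun ω => ?_)
  have h1 : ((blockEE E J₀)⁻¹ *ᵥ blockEE E J₀ *ᵥ t n ω) e = t n ω e := by
    rw [Matrix.mulVec_mulVec, Matrix.nonsing_inv_mul _ hJd, Matrix.one_mulVec]
  simp only [mul_add, Finset.sum_add_distrib]
  rw [add_comm]
  congr 1
  exact h1.symm

/-- The coefficients converge and `t` is bounded in probability, so they may be replaced by their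
limits. In the `E'` rows, `-J_{E',E} t` cancels the linear part of the score, and `H_{E',E}
H_{E,E}⁻¹ J_{E,E} t` becomes `-H_{E',E} H_{E,E}⁻¹ Z_E` by the score equations on `E`. -/
theorem tendstoZeroInProb_adjust {J H : ℕ → Matrix (Fin p) (Fin p) ℝ}
    {H₀ : Matrix (Fin p) (Fin p) ℝ} (hJ : Tendsto J atTop (𝓝 J₀)) (hH : Tendsto H atTop (𝓝 H₀))
    (hJd : IsUnit (blockEE E J₀).det) (hHd : IsUnit (blockEE E H₀).det)
    (hs : matSigma E J₀ H₀ j j ≠ 0) (ht : ∀ e, BoundedInProb P fun n ω => t n ω e)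
    (hlin : ∀ c, TendstoZeroInProb P fun n ω => S n ω c - Z n ω c - ∑ e : E, J₀ c e * t n ω e)
    (hzero : ∀ a : E, TendstoZeroInProb P fun n ω => S n ω a) (i : Minus j ⊕ Compl E) :
    TendstoZeroInProb P fun n ω => adjust E j (J n) (H n) (t n ω) (S n ω) i
      - ∑ c : E ⊕ Compl E, adjustCoeff E j J₀ H₀ i c
        * Z n ω (Sum.elim Subtype.val Subtype.val c) := by
  have h3 := tendsto_matSigma (E := E) hJ hH hJd
  have hinv := tendstoZeroInProb_add_inv_mul hJd hlin hzero
  rcases i with k | k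
  · have hc : Tendsto (fun n => 1 / matSigma E (J n) (H n) j j * matSigma E (J n) (H n) k j) atTop
        (𝓝 (1 / matSigma E J₀ H₀ j j * matSigma E J₀ H₀ k j)) :=
      (tendsto_const_nhds (x := (1 : ℝ)).div (tendsto_apply_apply h3 j j) hs).mul
      (tendsto_apply_apply h3 k j)
    have hc' := hc.sub_const (1 / matSigma E J₀ H₀ j j * matSigma E J₀ H₀ k j)
    rw [sub_self] at hc'
    refine (((hinv k).sub ((hinv j).const_mul
      (1 / matSigma E J₀ H₀ j j * matSigma E J₀ H₀ k j))).sub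
        ((ht j).mul_tendsto_zero hc')).congr (.of_forall fun n => .of_forall fun ω => ?_)
    rw [Fintype.sum_sum_type]
    simp only [adjust, adjustCoeff, Sum.elim_inl, Sum.elim_inr, Matrix.fromBlocks_apply₁₁,
      Matrix.fromBlocks_apply₁₂, Matrix.zero_apply, zero_mul, Finset.sum_const_zero, add_zero,
      Matrix.of_apply, sub_mul, Finset.sum_sub_distrib, mul_add, Finset.mul_sum, mul_assoc]
    ring
  · have h2 := tendsto_matrix_inv
      (tendsto_submatrix hH (Subtype.val : E → Fin p) Subtype.val) hHd
    have h4 := tendsto_matrix_mul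
      (tendsto_submatrix hH (Subtype.val : Compl E → Fin p) (Subtype.val : E → Fin p)) h2
    have h5 := tendsto_matrix_mul h4
      (tendsto_submatrix hJ (Subtype.val : E → Fin p) (Subtype.val : E → Fin p))
    set N₀ := blockCE E H₀ * (blockEE E H₀)⁻¹ with hN
    have h6 : Tendsto (fun n => blockCE E (H n) * (blockEE E (H n))⁻¹ * blockEE E (J n)
        - blockCE E (J n)) atTop (𝓝 (N₀ * blockEE E J₀ - blockCE E J₀)) :=
      h5.sub (tendsto_submatrix hJ (Subtype.val : Compl E → Fin p) (Subtype.val : E → Fin p))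
    have h7 : ∀ e : E, Tendsto (fun n => (blockCE E (H n) * (blockEE E (H n))⁻¹
        * blockEE E (J n) - blockCE E (J n)) k e
        - (N₀ * blockEE E J₀ - blockCE E J₀) k e) atTop (𝓝 0) := fun e => by
      have := (tendsto_apply_apply h6 k e).sub_const ((N₀ * blockEE E J₀ - blockCE E J₀) k e)
      rw [sub_self] at this
      exact this
    -- Three errors: the linearization of the score at `k`, the fluctuation of the coefficients
    -- against `t`, and the score equations on `E` weighted by row `k` of `N₀`.
    refine (((hlin k).add (TendstoZeroInProb.sum Finset.univ fun e _ =>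
      (ht e).mul_tendsto_zero (h7 e))).add (TendstoZeroInProb.sum Finset.univ fun a _ =>
        (tendstoZeroInProb_add_blockEE_mul hlin hzero a).const_mul (N₀ k a))).congr
          (.of_forall fun n => .of_forall fun ω => ?_)
    rw [Fintype.sum_sum_type]
    have e1 : ∑ a : E, N₀ k a * (Z n ω a + ∑ e : E, J₀ a e * t n ω e)
        = ∑ a : E, N₀ k a * Z n ω a + ((N₀ * blockEE E J₀) *ᵥ t n ω) k := by
      rw [← Matrix.mulVec_mulVec]
      simp only [mul_add, Finset.sum_add_distrib]
      rfl
    have e2 : ∑ e : E, J₀ k e * t n ω e = (blockCE E J₀ *ᵥ t n ω) k := rfl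
    simp only [adjust, adjustCoeff, Sum.elim_inl, Sum.elim_inr, Matrix.fromBlocks_apply₂₁,
      Matrix.fromBlocks_apply₂₂, Matrix.neg_apply, ← hN, neg_mul, Finset.sum_neg_distrib,
      Matrix.one_apply, ite_mul, one_mul, zero_mul, Finset.sum_ite_eq, Finset.mem_univ, if_true,
      sub_mul, Finset.sum_sub_distrib]
    rw [e1, e2]
    have e3 : ∀ M : Matrix (Compl E) E ℝ, ∑ e : E, M k e * t n ω e = (M *ᵥ t n ω) k :=
      fun M => rfl
    simp only [e3, Matrix.sub_mulVec, Pi.sub_apply]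
    ring

end Adjust

/-! ### Asymptotic linearity of the centred statistic -/

/-- `√n h²` is the square of `h / n^{-1/4}`: the rate assumption is exactly what makes the smoothing
bias negligible against `n^{-1/2}`. -/
theorem tendsto_bandwidth {h : ℕ → ℝ}
    (hrate : h =o[atTop] fun n : ℕ => (n : ℝ) ^ (-(1 / 4) : ℝ)) :
    Tendsto h atTop (𝓝 0) ∧ Tendsto (fun n : ℕ => √(n : ℝ) * h n ^ 2) atTop (𝓝 0) := by
  constructor
  · exact hrate.trans_tendsto
      ((tendsto_rpow_neg_atTop (by norm_num)).comp tendsto_natCast_atTop_atTop)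
  · have h1 := hrate.tendsto_div_nhds_zero.pow 2
    rw [zero_pow two_ne_zero] at h1
    refine h1.congr' ?_
    filter_upwards [eventually_gt_atTop 0] with n hn
    have hn' : (0 : ℝ) < n := by exact_mod_cast hn
    rw [div_pow, ← Real.rpow_natCast ((n : ℝ) ^ (-(1 / 4) : ℝ)), ← Real.rpow_mul hn'.le,
      Real.sqrt_eq_rpow, show (-(1 / 4) : ℝ) * ((2 : ℕ) : ℝ) = -(1 / 2) by norm_num,
      Real.rpow_neg hn'.le, div_inv_eq_mul, mul_comm]

section

variable {p : ℕ} {F : Measure ((Fin p → ℝ) × ℝ)} [IsProbabilityMeasure F] {l : ℝ}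
  {g : (Fin p → ℝ) → ℝ → ℝ}

theorem IsRegularLaw.tendstoZeroInProb_score_estimator (hF : IsRegularLaw F l g) {K : ℝ → ℝ}
    (hK : IsKernel K) {τ : ℝ} (hτ : τ ∈ Set.Ioo (0 : ℝ) 1) {h : ℕ → ℝ} (hpos : ∀ n, 0 < h n)
    (h0 : Tendsto h atTop (𝓝 0)) {E : Finset (Fin p)} {b : ℕ → E → ℝ} {bs : E → ℝ}
    (hb : Tendsto b atTop (𝓝 bs)) {bhat : (n : ℕ) → Sample n p → E → ℝ}
    (ht : BoundedInProb (sampleLaw F) fun n ω => ‖√(n : ℝ) • (bhat n ω - b n)‖) (c : Fin p) :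
    TendstoZeroInProb (sampleLaw F) fun n ω =>
      (√(n : ℝ) • (score K τ (h n) E (bhat n ω) ω
        - fun k => ∫ ω', score K τ (h n) E (b n) ω' k ∂(sampleLaw F n))) c
      - centredSum F (obsScore stepFn τ E bs c) ω
      - ∑ e : E, limJ F g E bs c e * (√(n : ℝ) • (bhat n ω - b n)) e := by
  refine ((hF.tendstoZeroInProb_score_sub hK hτ hpos h0 hb c).add
    (hF.tendstoZeroInProb_localIncrement_random hK hpos h0 hb c ht)).congr ?_
  filter_upwards [eventually_gt_atTop 0] with n hn
  refine .of_forall fun ω => ?_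
  have hn' : 0 < √(n : ℝ) := Real.sqrt_pos.2 (by exact_mod_cast hn)
  have h1 := sqrt_mul_score_add hK hτ (hpos n) E (b n) (√(n : ℝ) • (bhat n ω - b n)) ω c
  rw [smul_smul, inv_mul_cancel₀ hn'.ne', one_smul, add_sub_cancel] at h1
  rw [hF.blockEE_limJ_mulVec]
  simp only [Pi.smul_apply, Pi.sub_apply, smul_eq_mul, mul_sub, h1,
    hF.integral_score hK hτ (hpos n) hn]
  ring

theorem IsRegularLaw.posSemidef_ordered_matH (hF : IsRegularLaw F l g) {K : ℝ → ℝ}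
    (hK : IsKernel K) {τ : ℝ} (hτ : τ ∈ Set.Ioo (0 : ℝ) 1) {h : ℝ} (hh : 0 < h) {n : ℕ}
    (hn : 0 < n) (E : Finset (Fin p)) (b : E → ℝ) :
    (ordered E (matH F K τ h n E b)).PosSemidef := by
  have hk := hK.scaledKernel hh
  have h1 : matH F K τ h n E b
      = Matrix.of fun a c => cov[obsScore (kernelCdf (scaledKernel K h)) τ E b a,
          obsScore (kernelCdf (scaledKernel K h)) τ E b c; F] := by
    ext a c
    exact hF.matH_eq hK hτ hh hn E b a c
  rw [h1]
  exact (posSemidef_covariance fun a => hF.memLp_obsScore (measurable_kernelCdf hk)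
    (kernelCdf_nonneg hk) (kernelCdf_le_one hk) hτ E b a).submatrix _

theorem aemeasurable_score {K : ℝ → ℝ} (hK : IsKernel K) {τ : ℝ} (hτ : τ ∈ Set.Ioo (0 : ℝ) 1)
    {h : ℝ} (hh : 0 < h) {n : ℕ} {E : Finset (Fin p)} {bhat : Sample n p → E → ℝ}
    (hbhat : AEMeasurable bhat (sampleLaw F n)) (a : Fin p) :
    AEMeasurable (fun ω => score K τ h E (bhat ω) ω a) (sampleLaw F n) := by
  have hG := measurable_kernelCdf (hK.scaledKernel hh)
  simp only [score_eq hK hτ hh, obsScore, dotProduct, subvec]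
  refine AEMeasurable.const_mul (Finset.aemeasurable_fun_sum _ fun i _ => ?_) _
  refine AEMeasurable.mul (Measurable.aemeasurable (by fun_prop)) (AEMeasurable.sub_const (hG.comp_aemeasurable ?_) _)
  refine AEMeasurable.sub (Finset.aemeasurable_fun_sum _ fun e _ => ?_)
    (Measurable.aemeasurable (by fun_prop))
  exact AEMeasurable.mul (Measurable.aemeasurable (by fun_prop)) ((measurable_pi_apply e).comp_aemeasurable hbhat)

theorem aemeasurable_centredStatistic {K : ℝ → ℝ} (hK : IsKernel K) {τ : ℝ}
    (hτ : τ ∈ Set.Ioo (0 : ℝ) 1) {h : ℝ} (hh : 0 < h) {n : ℕ} {E : Finset (Fin p)} (j : E)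
    (bs b : E → ℝ) {bhat : Sample n p → E → ℝ} (hbhat : AEMeasurable bhat (sampleLaw F n)) :
    AEMeasurable (fun ω => centredStatistic F K τ h E j bs b (bhat ω) ω) (sampleLaw F n) := by
  have hS := aemeasurable_score (F := F) hK hτ hh hbhat
  have hb : ∀ e, AEMeasurable (fun ω => bhat ω e) (sampleLaw F n) := fun e =>
    (measurable_pi_apply e).comp_aemeasurable hbhat
  refine (WithLp.measurable_toLp 2 _).comp_aemeasurable (aemeasurable_pi_lambda _ fun i => ?_)
  rcases i with i | k | k
  · exact ((hb j).sub_const _).const_mul _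
  · exact ((((hb k).sub ((hb j).const_mul _)).sub_const _).const_mul _)
  · refine ((AEMeasurable.add (hS k) ?_).sub_const _).const_mul _
    exact Finset.aemeasurable_fun_sum _ fun e _ => (hb e).const_mul _

end

end SQR

/-! ### Assembly: bias, limits of the matrices, linearization, central limit theorem. -/

theorem mainTheorem8 {p : ℕ}
    (F : Measure ((Fin p → ℝ) × ℝ)) [IsProbabilityMeasure F]
    (hy : Integrable (fun z : (Fin p → ℝ) × ℝ => z.2) F)
    (σ : ℝ) (hA : SQR.SubGaussianCovariates F σ)
    (hB₁ : ∀ S : Finset (Fin p), SQR.HasLipschitzCondDensity F S)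
    (τ : ℝ) (hτ : τ ∈ Set.Ioo (0 : ℝ) 1)
    (K : ℝ → ℝ) (hK : SQR.IsKernel K)
    (h : ℕ → ℝ) (hpos : ∀ n, 0 < h n)
    (hrate : h =o[atTop] fun n : ℕ => (n : ℝ) ^ (-(1 / 4) : ℝ))
    (E : Finset (Fin p)) (j : E)
    (bstar : E → ℝ) (hbstar : ∀ n, SQR.IsTarget F τ n E bstar)
    (m : ℝ) (hm : 0 < m) (hB₂ : ∀ n, SQR.CurvatureBound F K (h n) E bstar m)
    (b : ℕ → E → ℝ) (hb : ∀ n, SQR.IsPseudoParameter F K τ (h n) n E (b n))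
    (bhat : (n : ℕ) → SQR.Sample n p → E → ℝ)
    (hbhat_meas : ∀ n, AEMeasurable (bhat n) (SQR.sampleLaw F n))
    (hbhat : ∀ n, ∀ᵐ ω ∂(SQR.sampleLaw F n), SQR.IsRefittedEstimate K τ (h n) E ω (bhat n ω)) :
    let J : ℕ → Matrix (Fin p) (Fin p) ℝ := fun n => SQR.matJ F K τ (h n) n E (b n)
    let H : ℕ → Matrix (Fin p) (Fin p) ℝ := fun n => SQR.matH F K τ (h n) n E (b n)
    (∀ᶠ n in atTop, IsUnit (SQR.blockEE E (J n)).det ∧ IsUnit (SQR.blockEE E (H n)).det) ∧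
    ∃ (s : ℝ) (V : Matrix (SQR.Minus j ⊕ SQR.Compl E) (SQR.Minus j ⊕ SQR.Compl E) ℝ),
      0 < s ∧
      Tendsto (fun n => SQR.matSigma E (J n) (H n) j j) atTop (𝓝 s) ∧
      Tendsto (fun n => SQR.matLambda₂ E j (J n) (H n) * (SQR.matLambda₂ E j (J n) (H n))ᵀ)
        atTop (𝓝 V) ∧
      TendstoInDistribution
        (fun n ω => SQR.centredStatistic F K τ (h n) E j bstar (b n) (bhat n ω) ω)
        atTop
        (id : EuclideanSpace ℝ (Unit ⊕ (SQR.Minus j ⊕ SQR.Compl E)) → _)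
        (fun n => SQR.sampleLaw F n)
        (multivariateGaussian 0
          (Matrix.fromBlocks (Matrix.of fun _ _ : Unit => s) 0 0 V)) := by
  intro J H
  obtain ⟨h0, hrate2⟩ := SQR.tendsto_bandwidth hrate
  obtain ⟨l, g, hF⟩ := SQR.exists_isRegularLaw F hA (hB₁ Finset.univ)
  -- Sample size one suffices for the target: its objective is then the expected loss of a single
  -- observation.
  obtain ⟨C, hC⟩ := hF.exists_norm_pseudoParameter_sub_le hy hK hτ hpos h0 (hbstar 1) hm hB₂ hb
  have hbt : Tendsto b atTop (𝓝 bstar) := by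
    rw [tendsto_iff_norm_sub_tendsto_zero]
    refine squeeze_zero' (.of_forall fun n => norm_nonneg _) hC ?_
    have := (h0.pow 2).const_mul C
    rwa [zero_pow two_ne_zero, mul_zero] at this
  have hbias : Tendsto (fun n : ℕ => √(n : ℝ) * (b n j - bstar j)) atTop (𝓝 0) := by
    refine squeeze_zero_norm' (a := fun n : ℕ => C * (√(n : ℝ) * h n ^ 2)) ?_ ?_
    · filter_upwards [hC] with n hn
      rw [norm_mul, Real.norm_of_nonneg (Real.sqrt_nonneg _)]
      have := mul_le_mul_of_nonneg_left ((norm_le_pi_norm (b n - bstar) j).trans hn)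
        (Real.sqrt_nonneg (n : ℝ))
      rw [Pi.sub_apply] at this
      linarith
    · simpa using hrate2.const_mul C
  set J₀ := SQR.limJ F g E bstar with hJ₀
  set H₀ := SQR.limH F τ E bstar with hH₀
  have hJ : Tendsto J atTop (𝓝 J₀) := hF.tendsto_matJ hK hτ hpos h0 hbt
  have hH : Tendsto H atTop (𝓝 H₀) := hF.tendsto_matH hK hτ hpos h0 hbt
  have hcurv := fun t => hF.curvature_limit hK hpos h0 hB₂ t
  have hJp : (SQR.blockEE E J₀).PosDef := hF.posDef_blockEE_limJ hm hcurv
  have hHp : (SQR.blockEE E H₀).PosDef := hF.posDef_blockEE_limH hτ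
    (fun a => hF.integral_obsScore_eq_zero_of_isTarget hy hτ (hbstar 1) a) hm hcurv
  have hJd : IsUnit (SQR.blockEE E J₀).det := hJp.det_pos.ne'.isUnit
  have hHd : IsUnit (SQR.blockEE E H₀).det := hHp.det_pos.ne'.isUnit
  have hs := SQR.matSigma_apply_pos (SQR.isSymm_limJ E bstar) hJd hHp j
  have hM := fun a => hF.memLp_obsScore SQR.measurable_stepFn SQR.stepFn_nonneg
    SQR.stepFn_le_one hτ E bstar a
  have hdet : ∀ {A : ℕ → Matrix (Fin p) (Fin p) ℝ} {A₀ : Matrix (Fin p) (Fin p) ℝ},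
      Tendsto A atTop (𝓝 A₀) → IsUnit (SQR.blockEE E A₀).det →
        ∀ᶠ n in atTop, IsUnit (SQR.blockEE E (A n)).det := fun {A A₀} hA hd =>
    ((((continuous_id.matrix_det.tendsto _).comp
      (SQR.tendsto_submatrix hA (Subtype.val : E → Fin p) Subtype.val)).eventually_ne
        hd.ne_zero).mono fun n hn => hn.isUnit)
  refine ⟨(hdet hJ hJd).and (hdet hH hHd), SQR.matSigma E J₀ H₀ j j,
    SQR.adjustCoeff E j J₀ H₀ * SQR.ordered E H₀ * (SQR.adjustCoeff E j J₀ H₀)ᵀ, hs,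
    SQR.tendsto_apply_apply (SQR.tendsto_matSigma hJ hH hJd) j j, ?_, ?_⟩
  · have h1 := SQR.tendsto_adjustCoeff hJ hH hJd hHd hs.ne'
    have h2 : Tendsto (fun n => (SQR.adjustCoeff E j (J n) (H n))ᵀ) atTop
        (𝓝 (SQR.adjustCoeff E j J₀ H₀)ᵀ) :=
      (continuous_id.matrix_transpose.tendsto _).comp h1
    refine (SQR.tendsto_matrix_mul (SQR.tendsto_matrix_mul h1
      (SQR.tendsto_submatrix hH _ _)) h2).congr' ?_
    filter_upwards [eventually_gt_atTop 0] with n hn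
    exact (SQR.matLambda₂_mul_transpose
      (hF.posSemidef_ordered_matH hK hτ (hpos n) hn E (b n))).symm
  -- The block diagonal covariance is rewritten as `D H₀ Dᵀ`, the form in which the central limit
  -- theorem delivers it.
  rw [← SQR.influenceCoeff_mul_ordered_mul_transpose (SQR.isSymm_limJ E bstar)
    (SQR.isSymm_limH τ E bstar) hHd hs.ne']
  have ht := hF.boundedInProb_estimator hy hK hτ hpos h0 hm hB₂ hbt hb hbhat
  have hlin := hF.tendstoZeroInProb_score_estimator hK hτ hpos h0 hbt ht
  -- On `E` both terms vanish: the sample score at `β̂` and the population score at `b n`, each by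
  -- its own first order condition.
  have hzero : ∀ a : E, SQR.TendstoZeroInProb (SQR.sampleLaw F) fun n ω =>
      (√(n : ℝ) • (SQR.score K τ (h n) E (bhat n ω) ω
        - fun k => ∫ ω', SQR.score K τ (h n) E (b n) ω' k ∂(SQR.sampleLaw F n))) a := fun a => by
    refine (SQR.tendstoZeroInProb_of_tendsto (tendsto_const_nhds (x := (0 : ℝ)))).congr ?_
    filter_upwards [eventually_gt_atTop 0] with n hn
    filter_upwards [hbhat n] with ω hω
    simp only [Pi.smul_apply, Pi.sub_apply, smul_eq_mul,
      SQR.score_eq_zero_of_isRefittedEstimate hK hτ (hpos n) E _ ω hω,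
      hF.integral_score hK hτ (hpos n) hn,
      hF.integral_obsScore_eq_zero_of_isPseudoParameter hy hK hτ (hpos n) hn (hb n), sub_zero,
      mul_zero]
  have hte : ∀ e : E, SQR.BoundedInProb (SQR.sampleLaw F) fun n ω =>
      (√(n : ℝ) • (bhat n ω - b n)) e := fun e =>
    ht.mono (.of_forall fun n => .of_forall fun ω => by
      rw [abs_norm]
      exact norm_le_pi_norm (√(n : ℝ) • (bhat n ω - b n)) e)
  refine SQR.tendstoInDistribution_of_tendstoZeroInProb
    (φ := fun c : E ⊕ SQR.Compl E =>
      SQR.obsScore SQR.stepFn τ E bstar (Sum.elim Subtype.val Subtype.val c))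
    (fun c => hM _) (SQR.influenceCoeff E j J₀ H₀)
    (fun n => SQR.aemeasurable_centredStatistic hK hτ (hpos n) j bstar (b n) (hbhat_meas n)) ?_
  rintro (i | i)
  -- The first coordinate is centred at `bstar j`, so the deterministic bias of `b n j` is added to
  -- the linear expansion.
  · refine ((SQR.tendstoZeroInProb_add_inv_mul hJd hlin hzero j).add
      (SQR.tendstoZeroInProb_of_tendsto hbias)).congr (.of_forall fun n => .of_forall fun ω => ?_)
    rw [Fintype.sum_sum_type]
    simp only [SQR.centredStatistic, SQR.influenceCoeff, Matrix.fromRows_apply_inl,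
      Matrix.of_apply, Sum.elim_inl, Sum.elim_inr, Pi.zero_apply, zero_mul,
      Finset.sum_const_zero, add_zero, neg_mul, Finset.sum_neg_distrib, Pi.smul_apply,
      Pi.sub_apply, smul_eq_mul]
    ring
  · refine (SQR.tendstoZeroInProb_adjust hJ hH hJd hHd hs.ne' hte hlin hzero i).congr
      (.of_forall fun n => .of_forall fun ω => ?_)
    simp only [SQR.centredStatistic, SQR.influenceCoeff, Matrix.fromRows_apply_inr, Sum.elim_inr,
      SQR.gammaHat, SQR.gammaPar, SQR.mul_adjust_sub_adjust]
    rfl
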